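/- Let $p\ge 1$ and $n\ge 1$ be integers. Write $x=(t,y)$ with $t\in\mathbb R$, $y\in\mathbb T^{n-1}=[0,2\pi]^{n-1}$; functions on $\mathbb R\times\mathbb T^{n-1}$ are complex-valued functions on $\mathbb R^n$ that are $2\pi$-periodic in each coordinate of $y$, and $dy$ denotes normalized Lebesgue measure on $\mathbb T^{n-1}$. A polyspline on strips (of order $p$) is a function $f\in C^{2p-2}(\mathbb R\times\mathbb T^{n-1})$ which is of class $C^{2p}$ and satisfies $\Delta^p f=0$ at all points with $t\notin\mathbb Z$. Let $PV_0$ be the closure in $L_2(\mathbb R\times\mathbb T^{n-1})$ of the set of square-integrable polysplines. For $\kappa\in\mathbb Z^{n-1}$ let $k=|\kappa|=(\sum_i\kappa_i^2)^{1/2}$ and let $\Lambda=[\lambda_1,\dots,\lambda_{2p}]$ consist of $-k$ ($p$ times) and $k$ ($p$ times). Let $\varphi$ be the function with Fourier transform $$\widehat\varphi(\xi)=\int_{\mathbb R}\varphi(t)e^{-i\xi t}\,dt=\prod_{j=1}^{2p}\frac{e^{-\lambda_j}-e^{-i\xi}}{i\xi-\lambda_j},\qquad \varphi^*(\xi)=\sum_{j\in\mathbb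 Z}\varphi(j)e^{-i\xi j},$$ and let $$S_0^{(\kappa)}(t)=\frac1{2\pi}\int_{\mathbb R}e^{i\xi t}\,\frac{\widehat\varphi(\xi)}{\varphi^*(\xi)}\,d\xi .$$ Let $S_0$ be the Shannon polyspline distribution $$S_0(t,y,y')=\sum_{\kappa\in\mathbb Z^{n-1}}S_0^{(\kappa)}(t)\,e^{-i\langle\kappa,y\rangle}e^{i\langle\kappa,y'\rangle}.$$ The functions $S_0^{(\kappa)}$ are bounded on $\mathbb R$ uniformly in $\kappa$, so this series converges in the sense of distributions. Integrals against $S_0$ are understood in the distributional sense, that is, for $g\in L_2(\mathbb T^{n-1})$, $$\int_{\mathbb T^{n-1}}S_0(t,y,y')\,g(y)\,dy:=\sum_{\kappa}S_0^{(\kappa)}(t)\,e^{i\langle\kappa,y'\rangle}\int_{\mathbb T^{n-1}}e^{-i\langle\kappa,y\rangle}g(y)\,dy .$$ Then for every $f\in PV_0\cap C(\mathbb R\times\mathbb T^{n-1})$ the Shannon type formula $$f(t,y')=\sum_{j\in\mathbb Z}\int_{\mathbb T^{n-1}}S_0(t-j,y,y')\,f(j,y)\,dy$$ holds in the following sense.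 For every $t\in\mathbb R$, it holds as an identity between functions of $y'$, where for each $j$ the series over $\kappa$ that defines the integral converges in $L_2(\mathbb T^{n-1})$ and the sum over $j$ converges unconditionally in $L_2(\mathbb T^{n-1})$. If $t\notin\mathbb Z$, it moreover holds at every point $y'$, where for each $j$ the series over $\kappa$ converges absolutely and the sum over $j$ converges absolutely. -/

import Mathlib

open MeasureTheory Filter Topology

/-! ### One-dimensional exponential splines attached to a non-ordered vector of frequencies -/

/-- The function `∏_j (e^{-λ_j} - e^{-iξ}) / (iξ - λ_j)`, the Fourier transform
`∫ Q(t) e^{-iξt} dt` of the `TB`-spline `Q` of the non-ordered vector `Λ` of real frequencies.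
The one possible removable singularity, `ξ = 0` when `0 ∈ Λ`, is a null set; the function is only
used under integrals in `ξ`. -/
noncomputable def tbSplineHat (L : Multiset ℝ) (ξ : ℝ) : ℂ :=
  (L.map fun l : ℝ =>
    (Complex.exp (-(l : ℂ)) - Complex.exp (-(Complex.I * ξ))) / (Complex.I * ξ - (l : ℂ))).prod

/-- The `TB`-spline `φ = Q_N[Λ]`, recovered from its Fourier transform. -/
noncomputable def tbSpline (L : Multiset ℝ) (t : ℝ) : ℂ :=
  (2 * (Real.pi : ℂ))⁻¹ * ∫ ξ : ℝ, Complex.exp (Complex.I * ξ * t) * tbSplineHat L ξ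

/-- The symbol `φ^*(ξ) = ∑_{j ∈ ℤ} φ(j) e^{-iξj}` (finitely many terms are nonzero). -/
noncomputable def tbSymbol (L : Multiset ℝ) (ξ : ℝ) : ℂ :=
  ∑' j : ℤ, tbSpline L j * Complex.exp (-(Complex.I * ξ * (j : ℂ)))

/-- The Shannon-Walter exponential spline of `Λ`: the function with Fourier transform
`φ̂(ξ) / φ^*(ξ)`. -/
noncomputable def shannonWalter (L : Multiset ℝ) (t : ℝ) : ℂ :=
  (2 * (Real.pi : ℂ))⁻¹ *
    ∫ ξ : ℝ, Complex.exp (Complex.I * ξ * t) * (tbSplineHat L ξ / tbSymbol L ξ)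

/-- The symmetric vector `[-k, …, -k, k, …, k]` (`p` times each), the frequencies of
`(d²/dt² - k²)^p`. -/
noncomputable def stripFrequencies (p : ℕ) (k : ℝ) : Multiset ℝ :=
  Multiset.replicate p (-k) + Multiset.replicate p k

/-- The Euclidean length `|κ|` of a multi-index. -/
noncomputable def multiIndexNorm {d : ℕ} (κ : Fin d → ℤ) : ℝ :=
  Real.sqrt (∑ i, (κ i : ℝ) ^ 2)

/-- `S_0^{(κ)}`, the Shannon-Walter spline for the frequencies `±|κ|`. -/
noncomputable def stripShannon (p : ℕ) {d : ℕ} (κ : Fin d → ℤ) : ℝ → ℂ :=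
  shannonWalter (stripFrequencies p (multiIndexNorm κ))

/-! ### Functions on `ℝ × 𝕋^d` and on `𝕋^d`, as `2π`-periodic functions -/

/-- The point `x = (t, y)` of `ℝ^{d+1}`. -/
noncomputable def stripPoint {d : ℕ} (t : ℝ) (y : Fin d → ℝ) : EuclideanSpace ℝ (Fin (d + 1)) :=
  WithLp.toLp 2 (Fin.cons t y)

/-- `2π`-periodicity in each of the variables `y_1, …, y_d` of `x = (t, y)`. -/
def IsPeriodicInY {d : ℕ} (f : EuclideanSpace ℝ (Fin (d + 1)) → ℂ) : Prop :=
  ∀ (i : Fin d) (x : EuclideanSpace ℝ (Fin (d + 1))),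
    f (x + EuclideanSpace.single i.succ (2 * Real.pi)) = f x

/-- Lebesgue measure on `ℝ × [0, 2π]^d`. -/
noncomputable def stripMeasure (d : ℕ) : Measure (EuclideanSpace ℝ (Fin (d + 1))) :=
  volume.restrict {x | ∀ i : Fin d, x i.succ ∈ Set.Icc 0 (2 * Real.pi)}

/-- Normalized Lebesgue measure `(2π)^{-d} dy` on `[0, 2π]^d`. -/
noncomputable def torusMeasure (d : ℕ) : Measure (Fin d → ℝ) :=
  ProbabilityTheory.cond volume (Set.Icc 0 fun _ => 2 * Real.pi)

/-- The exponential `e^{i⟨κ, y⟩}`. -/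
noncomputable def torusExp {d : ℕ} (κ : Fin d → ℤ) (y : Fin d → ℝ) : ℂ :=
  Complex.exp (Complex.I * ∑ i, (κ i : ℂ) * (y i : ℂ))

/-- The Fourier coefficient `(2π)^{-d} ∫ g(y) e^{-i⟨κ, y⟩} dy`. -/
noncomputable def torusCoeff {d : ℕ} (g : (Fin d → ℝ) → ℂ) (κ : Fin d → ℤ) : ℂ :=
  ∫ y, g y * torusExp (-κ) y ∂(torusMeasure d)

/-- `∑_i u_i = g` in `L_2(𝕋^d)`, unconditionally. -/
def HasSumInL2 {d : ℕ} {ι : Type*} (u : ι → (Fin d → ℝ) → ℂ) (g : (Fin d → ℝ) → ℂ) : Prop :=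
  Tendsto (fun s : Finset ι => eLpNorm (fun y => g y - ∑ i ∈ s, u i y) 2 (torusMeasure d))
    atTop (𝓝 0)

/-! ### Polysplines on strips -/

/-- Polysplines of order `p` on the strips `(j, j+1) × 𝕋^d`: functions that are `2π`-periodic in
`y`, of class `C^{2p-2}` everywhere, and solve `Δ^p f = 0` classically off the hyperplanes `t = j`,
`j ∈ ℤ`. -/
structure IsStripPolyspline (p : ℕ) {d : ℕ} (f : EuclideanSpace ℝ (Fin (d + 1)) → ℂ) : Prop where
  periodic : IsPeriodicInY f
  contDiff : ContDiff ℝ (2 * p - 2 : ℕ) f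
  contDiffOn : ContDiffOn ℝ (2 * p : ℕ) f {x | ∀ j : ℤ, x 0 ≠ j}
  polyharmonic : ∀ x : EuclideanSpace ℝ (Fin (d + 1)), (∀ j : ℤ, x 0 ≠ j) →
    ((fun g : EuclideanSpace ℝ (Fin (d + 1)) → ℂ => Laplacian.laplacian g)^[p] f) x = 0

/-- `PV_0`: the closure in `L_2(ℝ × 𝕋^d)` of the square-integrable polysplines. -/
noncomputable def polysplineSpace (p d : ℕ) : Set (Lp ℂ 2 (stripMeasure d)) :=
  closure {F | ∃ g : EuclideanSpace ℝ (Fin (d + 1)) → ℂ,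
    IsStripPolyspline p g ∧ (F : EuclideanSpace ℝ (Fin (d + 1)) → ℂ) =ᵐ[stripMeasure d] g}

/-! ### The Shannon polyspline distribution

`S_0(t, y, y') = ∑_κ S_0^{(κ)}(t) e^{-i⟨κ, y⟩} e^{i⟨κ, y'⟩}`. -/

/-- The coefficient of `e^{-i⟨κ, y⟩}` in the distribution `y ↦ S_0(t, y, y')`. -/
noncomputable def shannonKernelCoeff (p : ℕ) {d : ℕ} (t : ℝ) (y' : Fin d → ℝ) (κ : Fin d → ℤ) : ℂ :=
  stripShannon p κ t * torusExp κ y'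

/-- The terms, indexed by `κ`, of the distributional integral
`∫ S_0(t, y, y') g(y) dy = ∑_κ S_0^{(κ)}(t) e^{i⟨κ, y'⟩} ∫ e^{-i⟨κ, y⟩} g(y) dy`
(`dy` normalized). -/
noncomputable def shannonPairingTerm (p : ℕ) {d : ℕ} (t : ℝ) (g : (Fin d → ℝ) → ℂ)
    (κ : Fin d → ℤ) (y' : Fin d → ℝ) : ℂ :=
  shannonKernelCoeff p t y' κ * torusCoeff g κ

/-!
The formula separates into one-dimensional sampling formulas, one for every Fourier mode in `y`.

Taking Fourier coefficients in `y` turns `Δ` into `d²/dt² - k²` with `k = |κ|`, so the `κ`-th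
coefficient of a polyspline of order `n + 1` is a cardinal exponential spline in `t`
(`IsStripPolyspline.isExpSpline`). The notion `IsExpSpline k n v` records the chain
`v'' = k² v + v₁, v₁'' = k² v₁ + v₂, …`, whose last member solves the homogeneous equation between
consecutive integers. Variation of constants (`SolvesOn.centralDiff_eq`) identifies the `n`-th
exponential central difference of `v` with an `n`-fold average of that last member, hence with a
series of translates of a `B`-spline (`IsExpSpline.hasSum_centralDiff`).

The centred `B`-spline has the nonnegative Fourier transform `hatFourier k w ^ (n + 1)`, whose
periodization `splineSymbol` is, by Poisson summation, the symbol `φ^*` up to a phase. It has no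
zeros, so the Shannon–Walter spline `S` is well defined, takes the value `1` at `0` and vanishes at
the other integers (`shannonWalter_int`), and satisfies `|S| ≤ 1` for every `k`
(`norm_shannonWalter_le`). The reciprocal of the symbol has an absolutely convergent Fourier series
(`exists_inv_splineSymbol_series`), so `S` is a series of `B`-splines. Keeping track of `k` in this
series gives `∑_j |S(t - j)| ≤ C (1 + k)^{6(n+1)} e^{-kδ}`, where `δ` is the distance of `t` from
`ℤ` (`exists_tsum_norm_shannonWalter_le`).

Conversely, `B`-splines are finite combinations of translates of `S`, so `S` reproduces the `n`-th
difference of a bounded spline. For a spline `v` that vanishes at infinity this lifts to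
`v(t) = ∑_j v(j) S(t - j)`: the two sides have the same differences, and a solution of
`x_{j+1} - 2 cosh(k) x_j + x_{j-1} = 0` that tends to zero at both ends is zero
(`eq_zero_of_recurrence`). Square-integrable splines do vanish at infinity, because the sup norm of
a spline on a unit interval is at most `C (1 + k)` times its `L_1` norm
(`exists_norm_le_integral`). The same bound shows that `L_2` convergence of polysplines is uniform
convergence of each Fourier coefficient. The one-dimensional formulas therefore pass to the closure
`PV_0`, with coefficients that are `O(1 + |κ|)` uniformly in `t`
(`exists_stripCoeff_bound_and_hasSum`).

For `t ∉ ℤ` the factor `e^{-kδ}` makes the double series over `κ` and `j` absolutely convergent,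
uniformly in `y'`, and summing first over `j` leaves the Fourier series of `f(t, ·)`. For `t ∈ ℤ`
only the term `j = t` is present, and the formula is the `L_2` convergence of the Fourier series
of `f(t, ·)`.
-/


/-! ### The kernel of `d²/dt² - k²` and central differences -/

/-- The solution `H` of `H'' = k² H` with `H 0 = 0` and `H' 0 = 1`. -/
noncomputable def sinhKernel (k s : ℝ) : ℝ :=
  if k = 0 then s else Real.sinh (k * s) / k

lemma sinhKernel_zero (k : ℝ) : sinhKernel k 0 = 0 := by
  unfold sinhKernel; split_ifs <;> simp

lemma mul_sinhKernel (k s : ℝ) : k * sinhKernel k s = Real.sinh (k * s) := by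
  unfold sinhKernel; split_ifs with h
  · simp [h]
  · field_simp

lemma hasDerivAt_sinhKernel (k s : ℝ) :
    HasDerivAt (sinhKernel k) (Real.cosh (k * s)) s := by
  by_cases h : k = 0
  · have : sinhKernel k = fun s => s := by ext; simp [sinhKernel, h]
    rw [this]; simpa [h] using hasDerivAt_id' s
  · have : sinhKernel k = fun s => Real.sinh (k * s) / k := by ext; simp [sinhKernel, h]
    rw [this]
    have h1 := (((hasDerivAt_id' s).const_mul k).sinh).div_const k
    convert! h1 using 1
    field_simp

lemma hasDerivAt_cosh_mul (k s : ℝ) :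
    HasDerivAt (fun s => Real.cosh (k * s)) (k ^ 2 * sinhKernel k s) s := by
  have h1 := ((hasDerivAt_id' s).const_mul k).cosh
  convert! h1 using 1
  rw [← mul_sinhKernel]; ring

lemma continuous_sinhKernel (k : ℝ) : Continuous (sinhKernel k) :=
  continuous_iff_continuousAt.2 fun s => (hasDerivAt_sinhKernel k s).continuousAt

lemma sinhKernel_pos {k s : ℝ} (hk : 0 ≤ k) (hs : 0 < s) : 0 < sinhKernel k s := by
  unfold sinhKernel; split_ifs with h
  · exact hs
  · have : 0 < k := lt_of_le_of_ne hk (Ne.symm h)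
    exact div_pos (Real.sinh_pos_iff.2 (by positivity)) this

lemma sinhKernel_nonneg {k s : ℝ} (hk : 0 ≤ k) (hs : 0 ≤ s) : 0 ≤ sinhKernel k s := by
  rcases hs.eq_or_lt with rfl | h
  · rw [sinhKernel_zero]
  · exact (sinhKernel_pos hk h).le

lemma sinhKernel_le {k : ℝ} (hk : 0 ≤ k) (s : ℝ) :
    sinhKernel k s ≤ s * Real.exp (k * s) := by
  unfold sinhKernel; split_ifs with h
  · simp [h]
  · have hk' : 0 < k := lt_of_le_of_ne hk (Ne.symm h)
    rw [div_le_iff₀ hk', Real.sinh_eq]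
    have h1 := Real.add_one_le_exp (-(2 * (k * s)))
    have h2 : Real.exp (-(k * s)) = Real.exp (k * s) * Real.exp (-(2 * (k * s))) := by
      rw [← Real.exp_add]; ring_nf
    rw [h2]
    nlinarith [Real.exp_pos (k * s)]

lemma sinhKernel_add (k a b t : ℝ) :
    Real.cosh (k * (b - t)) * sinhKernel k (t - a) + Real.cosh (k * (t - a)) * sinhKernel k (b - t)
      = sinhKernel k (b - a) := by
  unfold sinhKernel; split_ifs with h
  · simp [h]
  · have : k * (b - a) = k * (b - t) + k * (t - a) := by ring
    rw [this, Real.sinh_add]; field_simp; ring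

/-- The second order operator `f ↦ ∫₀^η H(η - s) (f(t + s) + f(t - s)) ds`, convolution with the
hat-shaped kernel `H(η - |s|)` on `[-η, η]`. -/
noncomputable def kernelAvg (k η : ℝ) (f : ℝ → ℂ) (t : ℝ) : ℂ :=
  ∫ s in (0 : ℝ)..η, (sinhKernel k (η - s) : ℂ) * (f (t + s) + f (t - s))

/-- The exponential central difference of step `η`; it annihilates `e^{kt}` and `e^{-kt}`. -/
noncomputable def centralDiff (k η : ℝ) (v : ℝ → ℂ) (t : ℝ) : ℂ :=
  v (t + η) - 2 * (Real.cosh (k * η) : ℂ) * v t + v (t - η)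

/-- `v'' = k² v + w` on `O`. -/
def SolvesOn (k : ℝ) (v w : ℝ → ℂ) (O : Set ℝ) : Prop :=
  ∃ v' : ℝ → ℂ, ∀ t ∈ O, HasDerivAt v (v' t) t ∧ HasDerivAt v' (k ^ 2 * v t + w t) t

lemma SolvesOn.mono {k : ℝ} {v w : ℝ → ℂ} {O O' : Set ℝ} (h : SolvesOn k v w O) (hO : O' ⊆ O) :
    SolvesOn k v w O' := by
  obtain ⟨v', h⟩ := h
  exact ⟨v', fun t ht => h t (hO ht)⟩

lemma SolvesOn.sub {k : ℝ} {v w v₂ w₂ : ℝ → ℂ} {O : Set ℝ} (h : SolvesOn k v w O)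
    (h₂ : SolvesOn k v₂ w₂ O) : SolvesOn k (v - v₂) (w - w₂) O := by
  obtain ⟨v', h⟩ := h
  obtain ⟨v₂', h₂⟩ := h₂
  refine ⟨v' - v₂', fun t ht => ⟨(h t ht).1.sub (h₂ t ht).1, ?_⟩⟩
  convert! (h t ht).2.sub (h₂ t ht).2 using 1
  simp only [Pi.sub_apply]; ring

/-- Variation of constants for the even part of `v` about `t`. -/
lemma SolvesOn.centralDiff_eq {k : ℝ} {v w : ℝ → ℂ} {t η : ℝ}
    (h : SolvesOn k v w (Set.uIcc (t - η) (t + η)))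
    (hw : ContinuousOn w (Set.uIcc (t - η) (t + η))) :
    centralDiff k η v t = kernelAvg k η w t := by
  obtain ⟨v', h⟩ := h
  have hp : ∀ s ∈ Set.uIcc 0 η, t + s ∈ Set.uIcc (t - η) (t + η) := by
    intro s hs
    rw [Set.mem_uIcc] at *
    rcases hs with hs | hs
    · left; constructor <;> linarith [hs.1, hs.2]
    · right; constructor <;> linarith [hs.1, hs.2]
  have hm : ∀ s ∈ Set.uIcc 0 η, t - s ∈ Set.uIcc (t - η) (t + η) := by
    intro s hs
    rw [Set.mem_uIcc] at *
    rcases hs with hs | hs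
    · left; constructor <;> linarith [hs.1, hs.2]
    · right; constructor <;> linarith [hs.1, hs.2]
  -- a primitive of the integrand that defines `kernelAvg k η w t`
  set G : ℝ → ℂ := fun s => (sinhKernel k (η - s) : ℂ) * (v' (t + s) - v' (t - s)) +
    (Real.cosh (k * (η - s)) : ℂ) * (v (t + s) + v (t - s)) with hG
  have hGd : ∀ s ∈ Set.uIcc 0 η,
      HasDerivAt G ((sinhKernel k (η - s) : ℂ) * (w (t + s) + w (t - s))) s := by
    intro s hs
    have h1 : HasDerivAt (fun s : ℝ => (sinhKernel k (η - s) : ℂ))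
        (-(Real.cosh (k * (η - s)) : ℂ)) s := by
      have := ((hasDerivAt_sinhKernel k (η - s)).comp_const_sub η s).ofReal_comp
      simpa using this
    have h2 : HasDerivAt (fun s : ℝ => (Real.cosh (k * (η - s)) : ℂ))
        (-((k : ℂ) ^ 2 * (sinhKernel k (η - s) : ℂ))) s := by
      have := ((hasDerivAt_cosh_mul k (η - s)).comp_const_sub η s).ofReal_comp
      simpa using this
    have h3 := ((h _ (hp s hs)).1.comp_const_add t s).add ((h _ (hm s hs)).1.comp_const_sub t s)
    have h4 := ((h _ (hp s hs)).2.comp_const_add t s).sub ((h _ (hm s hs)).2.comp_const_sub t s)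
    have h5 := (h1.mul h4).add (h2.mul h3)
    convert! h5 using 1
    simp only [Pi.add_apply, Pi.sub_apply]
    ring
  have hint : IntervalIntegrable
      (fun s => (sinhKernel k (η - s) : ℂ) * (w (t + s) + w (t - s))) volume 0 η := by
    apply ContinuousOn.intervalIntegrable
    refine ContinuousOn.mul ?_ (ContinuousOn.add ?_ ?_)
    · exact (Complex.continuous_ofReal.comp
        ((continuous_sinhKernel k).comp (by fun_prop))).continuousOn
    · exact hw.comp (by fun_prop) hp
    · exact hw.comp (by fun_prop) hm
  rw [kernelAvg, intervalIntegral.integral_eq_sub_of_hasDerivAt hGd hint, hG]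
  simp [sinhKernel_zero, centralDiff]
  ring

/-! ### Iterates of the averaging and difference operators -/

section Iterates

variable {k η : ℝ} {f g : ℝ → ℂ}

lemma continuous_kernelAvg (hf : Continuous f) : Continuous (kernelAvg k η f) := by
  unfold kernelAvg
  apply intervalIntegral.continuous_parametric_intervalIntegral_of_continuous'
  have := continuous_sinhKernel k
  fun_prop

lemma continuous_centralDiff (hf : Continuous f) : Continuous (centralDiff k η f) := by
  unfold centralDiff; fun_prop

lemma continuous_kernelAvg_iterate (hf : Continuous f) (n : ℕ) :
    Continuous ((kernelAvg k η)^[n] f) := by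
  induction n generalizing f with
  | zero => exact hf
  | succ n ih => exact ih (continuous_kernelAvg hf)

lemma intervalIntegrable_kernelAvg (hf : Continuous f) (t : ℝ) : IntervalIntegrable
    (fun s => (sinhKernel k (η - s) : ℂ) * (f (t + s) + f (t - s))) volume 0 η := by
  have := continuous_sinhKernel k
  apply Continuous.intervalIntegrable
  fun_prop

lemma kernelAvg_add (hf : Continuous f) (hg : Continuous g) :
    kernelAvg k η (f + g) = kernelAvg k η f + kernelAvg k η g := by
  ext t
  simp only [kernelAvg, Pi.add_apply]
  rw [← intervalIntegral.integral_add (intervalIntegrable_kernelAvg hf t)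
    (intervalIntegrable_kernelAvg hg t)]
  congr 1; ext s; ring

lemma kernelAvg_const_mul (c : ℂ) (f : ℝ → ℂ) :
    kernelAvg k η (fun t => c * f t) = fun t => c * kernelAvg k η f t := by
  ext t
  simp only [kernelAvg]
  rw [← intervalIntegral.integral_const_mul]
  congr 1; ext s; ring

lemma kernelAvg_translate (a : ℝ) (f : ℝ → ℂ) :
    kernelAvg k η (fun t => f (t + a)) = fun t => kernelAvg k η f (t + a) := by
  ext t
  simp only [kernelAvg]
  congr 1; ext s
  rw [show t + s + a = t + a + s by ring, show t - s + a = t + a - s by ring]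

lemma kernelAvg_sum {ι : Type*} (s : Finset ι) (F : ι → ℝ → ℂ) (hF : ∀ i ∈ s, Continuous (F i)) :
    kernelAvg k η (fun t => ∑ i ∈ s, F i t) = fun t => ∑ i ∈ s, kernelAvg k η (F i) t := by
  classical
  induction s using Finset.induction_on with
  | empty => ext t; simp [kernelAvg]
  | insert a s ha ih =>
    have h1 : (fun t => ∑ i ∈ insert a s, F i t) = F a + fun t => ∑ i ∈ s, F i t := by
      ext t; simp [Finset.sum_insert ha]
    have hc : Continuous fun t => ∑ i ∈ s, F i t :=
      continuous_finsetSum _ fun i hi => hF i (Finset.mem_insert_of_mem hi)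
    rw [h1, kernelAvg_add (hF a (Finset.mem_insert_self a s)) hc,
      ih fun i hi => hF i (Finset.mem_insert_of_mem hi)]
    ext t; simp [Finset.sum_insert ha]

lemma kernelAvg_centralDiff (hf : Continuous f) :
    kernelAvg k η (centralDiff k η f) = centralDiff k η (kernelAvg k η f) := by
  have h : centralDiff k η f = (fun t => f (t + η)) +
      ((fun t => -(2 * (Real.cosh (k * η) : ℂ)) * f t) + fun t => f (t + -η)) := by
    ext t; simp only [centralDiff, Pi.add_apply, sub_eq_add_neg]; ring
  rw [h, kernelAvg_add (by fun_prop) (by fun_prop), kernelAvg_add (by fun_prop) (by fun_prop),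
    kernelAvg_const_mul, kernelAvg_translate, kernelAvg_translate]
  ext t; simp only [centralDiff, Pi.add_apply, sub_eq_add_neg]; ring

lemma centralDiff_kernelAvg_iterate (hf : Continuous f) (n : ℕ) :
    centralDiff k η ((kernelAvg k η)^[n] f) = (kernelAvg k η)^[n] (centralDiff k η f) := by
  induction n generalizing f with
  | zero => rfl
  | succ n ih =>
    rw [Function.iterate_succ_apply, Function.iterate_succ_apply, ih (continuous_kernelAvg hf),
      kernelAvg_centralDiff hf]

lemma centralDiff_iterate_kernelAvg (hf : Continuous f) (n : ℕ) :
    (centralDiff k η)^[n] (kernelAvg k η f) = kernelAvg k η ((centralDiff k η)^[n] f) := by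
  induction n generalizing f with
  | zero => rfl
  | succ n ih =>
    rw [Function.iterate_succ_apply, Function.iterate_succ_apply, ← kernelAvg_centralDiff hf,
      ih (continuous_centralDiff hf)]

lemma kernelAvg_congr {t : ℝ} (h : ∀ x ∈ Set.Icc (t - |η|) (t + |η|), f x = g x) :
    kernelAvg k η f t = kernelAvg k η g t := by
  unfold kernelAvg
  apply intervalIntegral.integral_congr
  intro s hs
  have hs' : |s| ≤ |η| := by
    rcases Set.mem_uIcc.1 hs with hs | hs
    · rw [abs_of_nonneg hs.1, abs_of_nonneg (hs.1.trans hs.2)]; exact hs.2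
    · rw [abs_of_nonpos hs.2, abs_of_nonpos (hs.1.trans hs.2)]; linarith [hs.1]
  have := abs_le.1 hs'
  simp only
  rw [h (t + s) ⟨by linarith, by linarith⟩, h (t - s) ⟨by linarith, by linarith⟩]

lemma kernelAvg_iterate_congr (n : ℕ) {t : ℝ}
    (h : ∀ x ∈ Set.Icc (t - n * |η|) (t + n * |η|), f x = g x) :
    (kernelAvg k η)^[n] f t = (kernelAvg k η)^[n] g t := by
  induction n generalizing t with
  | zero => exact h t (by simp)
  | succ n ih =>
    rw [Function.iterate_succ_apply', Function.iterate_succ_apply']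
    apply kernelAvg_congr
    intro x hx
    apply ih
    intro y hy
    apply h
    push_cast
    constructor <;> nlinarith [hx.1, hx.2, hy.1, hy.2]

lemma kernelAvg_iterate_zero (n : ℕ) : (kernelAvg k η)^[n] 0 = 0 := by
  induction n with
  | zero => rfl
  | succ n ih => rw [Function.iterate_succ_apply', ih]; ext t; simp [kernelAvg]

lemma kernelAvg_iterate_const_mul (n : ℕ) (c : ℂ) (f : ℝ → ℂ) :
    (kernelAvg k η)^[n] (fun t => c * f t) = fun t => c * (kernelAvg k η)^[n] f t := by
  induction n generalizing f with
  | zero => rfl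
  | succ n ih => rw [Function.iterate_succ_apply, kernelAvg_const_mul, ih]; rfl

lemma kernelAvg_iterate_translate (n : ℕ) (a : ℝ) (f : ℝ → ℂ) :
    (kernelAvg k η)^[n] (fun t => f (t + a)) = fun t => (kernelAvg k η)^[n] f (t + a) := by
  induction n generalizing f with
  | zero => rfl
  | succ n ih => rw [Function.iterate_succ_apply, kernelAvg_translate, ih]; rfl

lemma kernelAvg_iterate_sum {ι : Type*} (n : ℕ) (s : Finset ι) (F : ι → ℝ → ℂ)
    (hF : ∀ i ∈ s, Continuous (F i)) :
    (kernelAvg k η)^[n] (fun t => ∑ i ∈ s, F i t) =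
      fun t => ∑ i ∈ s, (kernelAvg k η)^[n] (F i) t := by
  induction n generalizing F with
  | zero => rfl
  | succ n ih =>
    rw [Function.iterate_succ_apply, kernelAvg_sum s F hF,
      ih (fun i => kernelAvg k η (F i)) fun i hi => continuous_kernelAvg (hF i hi)]
    rfl

lemma norm_centralDiff_iterate_le {M : ℝ} (n : ℕ) (h : ∀ t, ‖f t‖ ≤ M) (t : ℝ) :
    ‖(centralDiff k η)^[n] f t‖ ≤ (2 + 2 * Real.cosh (k * η)) ^ n * M := by
  induction n generalizing t with
  | zero => simpa using h t
  | succ n ih =>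
    rw [Function.iterate_succ_apply', centralDiff]
    set F := (centralDiff k η)^[n] f
    have hc : ‖(2 : ℂ) * (Real.cosh (k * η) : ℂ) * F t‖ = 2 * Real.cosh (k * η) * ‖F t‖ := by
      rw [norm_mul, norm_mul, Complex.norm_real, Real.norm_of_nonneg (Real.cosh_pos _).le]; simp
    calc _ ≤ ‖F (t + η)‖ + 2 * Real.cosh (k * η) * ‖F t‖ + ‖F (t - η)‖ := by
          refine (norm_add_le _ _).trans (add_le_add ((norm_sub_le _ _).trans ?_) le_rfl)
          rw [hc]
      _ ≤ _ := by
          have := Real.cosh_pos (k * η)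
          rw [pow_succ]
          nlinarith [ih (t + η), ih t, ih (t - η)]

end Iterates

/-! ### Cardinal exponential splines -/

/-- Cardinal splines of order `n + 1` for `(d²/dt² - k²)^{n+1}`, described by the chain
`v, v'' - k² v, …` of functions obtained by applying the operator: all but the last
are classically differentiable twice on `ℝ`, and the last one is continuous and solves
`u'' = k² u` off the integers. -/
def IsExpSpline (k : ℝ) : ℕ → (ℝ → ℂ) → Prop
  | 0, v => Continuous v ∧ SolvesOn k v 0 {t | ∀ j : ℤ, t ≠ j}
  | n + 1, v => ∃ w, IsExpSpline k n w ∧ SolvesOn k v w Set.univ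

section Spline

variable {k : ℝ} {n : ℕ} {v u : ℝ → ℂ}

lemma IsExpSpline.continuous (h : IsExpSpline k n v) : Continuous v := by
  cases n with
  | zero => exact h.1
  | succ n =>
    obtain ⟨w, -, v', h⟩ := h
    exact continuous_iff_continuousAt.2 fun t => (h t trivial).1.continuousAt

lemma IsExpSpline.sub {v₂ : ℝ → ℂ} (h : IsExpSpline k n v) (h₂ : IsExpSpline k n v₂) :
    IsExpSpline k n (v - v₂) := by
  induction n generalizing v v₂ with
  | zero =>
    refine ⟨h.1.sub h₂.1, ?_⟩
    have := h.2.sub h₂.2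
    simpa using this
  | succ n ih =>
    obtain ⟨w, hw, h⟩ := h
    obtain ⟨w₂, hw₂, h₂⟩ := h₂
    exact ⟨w - w₂, ih hw hw₂, h.sub h₂⟩

/-- All differences of a spline are averages of the last function `u` of its chain. -/
lemma IsExpSpline.exists_core (h : IsExpSpline k n v) :
    ∃ u, IsExpSpline k 0 u ∧ ∀ η, (centralDiff k η)^[n] v = (kernelAvg k η)^[n] u := by
  induction n generalizing v with
  | zero => exact ⟨v, h, fun η => rfl⟩
  | succ n ih =>
    obtain ⟨w, hw, h⟩ := h
    obtain ⟨u, hu, huw⟩ := ih hw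
    refine ⟨u, hu, fun η => ?_⟩
    have h1 : centralDiff k η v = kernelAvg k η w := by
      ext t
      exact (h.mono (Set.subset_univ _)).centralDiff_eq hw.continuous.continuousOn
    rw [Function.iterate_succ_apply, h1, centralDiff_iterate_kernelAvg hw.continuous, huw,
      Function.iterate_succ_apply']

lemma ne_int_of_mem_Ioo {j : ℤ} {t : ℝ} (ht : t ∈ Set.Ioo (j : ℝ) (j + 1)) (i : ℤ) : t ≠ i := by
  rintro rfl
  have h1 : j < i := by exact_mod_cast ht.1
  have h2 : i < j + 1 := by exact_mod_cast ht.2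
  omega

lemma IsExpSpline.centralDiff_core_eq_zero (hu : IsExpSpline k 0 u) {j : ℤ} {t η : ℝ}
    (h1 : j < t - |η|) (h2 : t + |η| < j + 1) : centralDiff k η u t = 0 := by
  have hsub : Set.uIcc (t - η) (t + η) ⊆ Set.Ioo (j : ℝ) (j + 1) := by
    intro x hx
    have := neg_abs_le η
    have := le_abs_self η
    rcases Set.mem_uIcc.1 hx with hx | hx <;> constructor <;> linarith [hx.1, hx.2]
  rw [(hu.2.mono fun x hx => ne_int_of_mem_Ioo (hsub hx)).centralDiff_eq continuousOn_const]
  simp [kernelAvg]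

lemma IsExpSpline.centralDiff_iterate_eq_zero (h : IsExpSpline k n v) {j : ℤ} {t η : ℝ}
    (h1 : j < t - (n + 1) * |η|) (h2 : t + (n + 1) * |η| < j + 1) :
    (centralDiff k η)^[n + 1] v t = 0 := by
  obtain ⟨u, hu, huv⟩ := h.exists_core
  rw [Function.iterate_succ_apply', huv, centralDiff_kernelAvg_iterate hu.continuous,
    kernelAvg_iterate_congr (g := 0), kernelAvg_iterate_zero]
  · rfl
  · intro x hx
    apply hu.centralDiff_core_eq_zero (j := j) <;> nlinarith [hx.1, hx.2]

/-- The difference relation of order `n`, solved for the value at the left end of its stencil. -/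
lemma exists_norm_le_centralDiff (n : ℕ) : ∃ K : ℝ, 0 ≤ K ∧ ∀ (k η : ℝ) (v : ℝ → ℂ) (x : ℝ),
    Real.cosh (k * η) ≤ 2 → ‖v x‖ ≤ ‖(centralDiff k η)^[n] v (x + n * η)‖ +
      K * ∑ l ∈ Finset.range (2 * n), ‖v (x + (l + 1) * η)‖ := by
  induction n with
  | zero => exact ⟨0, le_rfl, fun k η v x _ => by simp⟩
  | succ n ih =>
    obtain ⟨K, hK, ih⟩ := ih
    refine ⟨12 * n * K + 5, by positivity, fun k η v x hc => ?_⟩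
    have hδ : ∀ y, ‖centralDiff k η v y‖ ≤ ‖v (y + η)‖ + 4 * ‖v y‖ + ‖v (y - η)‖ := by
      intro y
      have hcn : ‖(2 : ℂ) * (Real.cosh (k * η) : ℂ) * v y‖ ≤ 4 * ‖v y‖ := by
        rw [norm_mul, norm_mul, Complex.norm_real, Real.norm_of_nonneg (Real.cosh_pos _).le]
        simp only [Complex.norm_ofNat]
        nlinarith [norm_nonneg (v y)]
      exact (norm_add_le _ _).trans (add_le_add ((norm_sub_le _ _).trans (by gcongr)) le_rfl)
    set S := ∑ l ∈ Finset.range (2 * (n + 1)), ‖v (x + (l + 1) * η)‖ with hS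
    have hterm : ∀ l < 2 * (n + 1), ‖v (x + (l + 1) * η)‖ ≤ S := fun l hl =>
      Finset.single_le_sum (f := fun l : ℕ => ‖v (x + (l + 1) * η)‖)
        (fun _ _ => norm_nonneg _) (Finset.mem_range.2 hl)
    have h0 : ‖v x‖ ≤ ‖centralDiff k η v (x + η)‖ + 5 * S := by
      have e : v x = centralDiff k η v (x + η) - v (x + η + η) +
          2 * (Real.cosh (k * η) : ℂ) * v (x + η) := by
        rw [centralDiff, add_sub_cancel_right]; ring
      have hcn : ‖(2 : ℂ) * (Real.cosh (k * η) : ℂ) * v (x + η)‖ ≤ 4 * ‖v (x + η)‖ := by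
        rw [norm_mul, norm_mul, Complex.norm_real, Real.norm_of_nonneg (Real.cosh_pos _).le]
        simp only [Complex.norm_ofNat]
        nlinarith [norm_nonneg (v (x + η))]
      have e1 := hterm 0 (by omega)
      have e2 := hterm 1 (by omega)
      simp only [Nat.cast_zero, zero_add, one_mul] at e1
      rw [show x + (((1 : ℕ) : ℝ) + 1) * η = x + η + η by push_cast; ring] at e2
      have e3 := norm_add_le (centralDiff k η v (x + η) - v (x + η + η))
        (2 * (Real.cosh (k * η) : ℂ) * v (x + η))
      have e4 := norm_sub_le (centralDiff k η v (x + η)) (v (x + η + η))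
      rw [← e] at e3
      linarith
    have h1 := ih k η (centralDiff k η v) (x + η) hc
    have h2 : ∑ l ∈ Finset.range (2 * n), ‖centralDiff k η v (x + η + (l + 1) * η)‖ ≤
        2 * n * (6 * S) := by
      have : ∀ l ∈ Finset.range (2 * n), ‖centralDiff k η v (x + η + (l + 1) * η)‖ ≤ 6 * S := by
        intro l hl
        have hl := Finset.mem_range.1 hl
        have e0 := hterm l (by omega)
        have e1 := hterm (l + 1) (by omega)
        have e2 := hterm (l + 2) (by omega)
        have e3 := hδ (x + η + (l + 1) * η)
        rw [show x + η + (l + 1) * η + η = x + ((l + 2 : ℕ) + 1) * η by push_cast; ring,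
          show x + η + (l + 1) * η - η = x + (l + 1) * η by ring,
          show x + η + (l + 1) * η = x + ((l + 1 : ℕ) + 1) * η by push_cast; ring] at e3
        rw [show x + η + (l + 1) * η = x + ((l + 1 : ℕ) + 1) * η by push_cast; ring]
        linarith
      simpa using Finset.sum_le_card_nsmul _ _ _ this
    rw [Function.iterate_succ_apply,
      show x + ((n + 1 : ℕ) : ℝ) * η = x + η + n * η by push_cast; ring]
    nlinarith [mul_le_mul_of_nonneg_left h2 hK]

/-- An affine substitution `s ↦ x + a s` with `|a| ≥ 1` does not increase the integral of a
nonnegative function. -/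
lemma integral_comp_add_mul_le {g : ℝ → ℝ} (hg : Continuous g) (hg0 : ∀ x, 0 ≤ g x)
    {a x η c d : ℝ} (ha : 1 ≤ |a|) (hx : x ∈ Set.Icc c d) (hxa : x + a * η ∈ Set.Icc c d) :
    ∫ s in (0 : ℝ)..η, g (x + a * s) ≤ ∫ s in c..d, g s := by
  have ha0 : a ≠ 0 := by rintro rfl; simp at ha; linarith
  rw [intervalIntegral.integral_comp_add_mul _ ha0, mul_zero, add_zero, smul_eq_mul]
  have hcd : c ≤ d := hx.1.trans hx.2
  have hle : |∫ s in x..x + a * η, g s| ≤ ∫ s in c..d, g s := by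
    have h1 := intervalIntegral.abs_integral_mono_interval (f := g) (μ := volume)
      (a := x) (b := x + a * η) (c := c) (d := d) ?_ (ae_of_all _ hg0)
      (hg.intervalIntegrable _ _)
    · rwa [abs_of_nonneg (intervalIntegral.integral_nonneg hcd fun s _ => hg0 s)] at h1
    · rw [Set.uIoc_of_le hcd]
      intro y hy
      rcases Set.mem_uIoc.1 hy with h | h
      · exact ⟨by linarith [hx.1, h.1], by linarith [hxa.2, h.2]⟩
      · exact ⟨by linarith [hxa.1, h.1], by linarith [hx.2, h.2]⟩
  calc a⁻¹ * ∫ s in x..x + a * η, g s ≤ |a⁻¹ * ∫ s in x..x + a * η, g s| := le_abs_self _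
    _ = |a|⁻¹ * |∫ s in x..x + a * η, g s| := by rw [abs_mul, abs_inv]
    _ ≤ 1 * |∫ s in x..x + a * η, g s| := by
      gcongr
      exact inv_le_one_of_one_le₀ ha
    _ ≤ _ := by rwa [one_mul]

/-- On each unit interval, the sup norm of a spline is at most a multiple of its `L¹` norm, and the
constant grows at most linearly in `k`. -/
lemma exists_norm_le_integral (n : ℕ) : ∃ C : ℝ, 0 < C ∧ ∀ (k : ℝ) (v : ℝ → ℂ), 0 ≤ k →
    IsExpSpline k n v → ∀ (j : ℤ) (x : ℝ), x ∈ Set.Icc (j : ℝ) (j + 1) →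
      ‖v x‖ ≤ C * (1 + k) * ∫ s in (j : ℝ)..(j + 1), ‖v s‖ := by
  obtain ⟨K, hK, hKv⟩ := exists_norm_le_centralDiff (n + 1)
  refine ⟨(K + 1) * (2 * (n + 1)) * (8 * (n + 1)), by positivity, fun k v hk hv j => ?_⟩
  have hvc := hv.continuous
  set I := ∫ s in (j : ℝ)..(j + 1), ‖v s‖ with hI
  have hI0 : 0 ≤ I := intervalIntegral.integral_nonneg (by linarith) fun s _ => norm_nonneg _
  have key : ∀ x ∈ Set.Ioo (j : ℝ) (j + 1),
      ‖v x‖ ≤ (K + 1) * (2 * (n + 1)) * (8 * (n + 1)) * (1 + k) * I := by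
    intro x hx
    -- the stencil points away from the nearer end of the interval
    obtain ⟨σ, hσ, hσx⟩ : ∃ σ : ℝ, |σ| = 1 ∧ ∀ r, 0 ≤ r → r ≤ 1 / 4 →
        x + σ * r ∈ Set.Ioo (j : ℝ) (j + 1) := by
      by_cases h : x ≤ j + 1 / 2
      · exact ⟨1, by simp, fun r h1 h2 => ⟨by linarith [hx.1], by linarith⟩⟩
      · exact ⟨-1, by simp, fun r h1 h2 => ⟨by linarith, by linarith [hx.2]⟩⟩
    -- steps so small that `cosh (k η) ≤ 2` and the stencil stays inside the interval
    set η₀ : ℝ := 1 / (8 * (n + 1) * (1 + k)) with hη₀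
    have hη₀pos : 0 < η₀ := by positivity
    have hη₀k : k * η₀ ≤ 1 / 8 := by
      rw [hη₀, mul_one_div, div_le_div_iff₀ (by positivity) (by norm_num)]
      nlinarith [(Nat.cast_nonneg n : (0 : ℝ) ≤ n)]
    have hη₀n : 2 * (n + 1) * η₀ ≤ 1 / 4 := by
      rw [hη₀, mul_one_div, div_le_div_iff₀ (by positivity) (by norm_num)]
      nlinarith [(Nat.cast_nonneg n : (0 : ℝ) ≤ n), mul_nonneg (Nat.cast_nonneg n : (0 : ℝ) ≤ n) hk]
    have hpt : ∀ η ∈ Set.Icc 0 η₀, ‖v x‖ ≤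
        K * ∑ l ∈ Finset.range (2 * (n + 1)), ‖v (x + (l + 1) * σ * η)‖ := by
      intro η hη
      have hc : Real.cosh (k * (σ * η)) ≤ 2 := by
        have h1 : |k * (σ * η)| ≤ 1 := by
          rw [abs_mul, abs_mul, hσ, abs_of_nonneg hk, abs_of_nonneg hη.1]
          nlinarith [hη.2]
        calc _ ≤ Real.cosh 1 := by rw [Real.cosh_le_cosh]; simpa using h1
          _ ≤ 2 := by
            rw [Real.cosh_eq]
            have := Real.exp_one_lt_d9
            have : Real.exp (-1) ≤ 1 := Real.exp_le_one_iff.2 (by norm_num)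
            linarith
      have h1 := hKv k (σ * η) v x hc
      have hr := mul_le_mul_of_nonneg_left hη.2 (show (0 : ℝ) ≤ 2 * (n + 1) by positivity)
      have hr0 : 0 ≤ (n + 1) * η := mul_nonneg (by positivity) hη.1
      have hz := hv.centralDiff_iterate_eq_zero (j := j) (t := x + ((n + 1 : ℕ) : ℝ) * (σ * η))
        (η := σ * η) ?_ ?_
      · rw [hz, norm_zero, zero_add] at h1
        simpa only [mul_assoc] using h1
      all_goals
        rw [abs_mul, hσ, abs_of_nonneg hη.1]
        have e2 := hσx (2 * (n + 1) * η) (by nlinarith) (by linarith)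
        rcases abs_eq (zero_le_one' ℝ) |>.1 hσ with rfl | rfl
        · push_cast
          linarith [hx.1, hx.2, e2.1, e2.2]
        · push_cast
          linarith [hx.1, hx.2, e2.1, e2.2]
    -- average the pointwise bound over `η ∈ [0, η₀]`
    have hint : η₀ * ‖v x‖ ≤ K * (2 * (n + 1)) * I := by
      have h1 : ∫ η in (0 : ℝ)..η₀, ‖v x‖ ≤
          ∫ η in (0 : ℝ)..η₀, K * ∑ l ∈ Finset.range (2 * (n + 1)), ‖v (x + (l + 1) * σ * η)‖ :=
        intervalIntegral.integral_mono_on hη₀pos.le (by simp)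
          (Continuous.intervalIntegrable (by fun_prop) _ _) hpt
      rw [intervalIntegral.integral_const, intervalIntegral.integral_const_mul,
        intervalIntegral.integral_finsetSum
          (fun l _ => Continuous.intervalIntegrable (by fun_prop) _ _)] at h1
      have h2 : ∑ l ∈ Finset.range (2 * (n + 1)),
          ∫ η in (0 : ℝ)..η₀, ‖v (x + (l + 1) * σ * η)‖ ≤ 2 * (n + 1) * I := by
        have : ∀ l ∈ Finset.range (2 * (n + 1)),
            ∫ η in (0 : ℝ)..η₀, ‖v (x + (l + 1) * σ * η)‖ ≤ I := by
          intro l hl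
          have hl : ((l + 1 : ℕ) : ℝ) ≤ ((2 * (n + 1) : ℕ) : ℝ) := by
            exact_mod_cast Finset.mem_range.1 hl
          push_cast at hl
          apply integral_comp_add_mul_le (g := fun s => ‖v s‖) (by fun_prop)
            (fun s => norm_nonneg _)
          · rw [abs_mul, hσ, mul_one, abs_of_nonneg (by positivity)]
            linarith [(Nat.cast_nonneg l : (0 : ℝ) ≤ l)]
          · exact Set.Ioo_subset_Icc_self hx
          · apply Set.Ioo_subset_Icc_self
            have := hσx ((l + 1) * η₀) (by positivity) (by nlinarith)
            convert this using 1; ring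
        simpa using Finset.sum_le_card_nsmul _ _ _ this
      simp only [sub_zero, smul_eq_mul] at h1
      nlinarith [mul_le_mul_of_nonneg_left h2 hK]
    have hη₀i : 8 * (n + 1) * (1 + k) * η₀ = 1 := by rw [hη₀]; field_simp
    calc ‖v x‖ = 8 * (n + 1) * (1 + k) * (η₀ * ‖v x‖) := by rw [← mul_assoc, hη₀i, one_mul]
      _ ≤ 8 * (n + 1) * (1 + k) * (K * (2 * (n + 1)) * I) := by gcongr
      _ ≤ 8 * (n + 1) * (1 + k) * ((K + 1) * (2 * (n + 1)) * I) := by gcongr; linarith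
      _ = _ := by ring
  intro x hx
  have hcl : IsClosed {x | ‖v x‖ ≤ (K + 1) * (2 * (n + 1)) * (8 * (n + 1)) * (1 + k) * I} :=
    isClosed_le (by fun_prop) continuous_const
  have := hcl.closure_subset_iff.2 key
  rw [closure_Ioo (by linarith)] at this
  exact this hx

/-! ### Interpolation by hats -/

/-- A solution of `u'' = k² u` is determined between two points by its values there. -/
lemma IsExpSpline.interpolate (hu : IsExpSpline k 0 u) {j : ℤ} {a b t : ℝ} (hja : j ≤ a)
    (hat : a ≤ t) (htb : t ≤ b) (hbj : b ≤ j + 1) :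
    u t * sinhKernel k (b - a) = u a * sinhKernel k (b - t) + u b * sinhKernel k (t - a) := by
  have key : ∀ a t b : ℝ, j < a → a ≤ t → t ≤ b → b < j + 1 →
      u t * sinhKernel k (b - a) = u a * sinhKernel k (b - t) + u b * sinhKernel k (t - a) := by
    intro a t b hja hat htb hbj
    obtain ⟨-, u', h⟩ := hu
    have h' : ∀ s ∈ Set.Icc a b, HasDerivAt u (u' s) s ∧ HasDerivAt u' (k ^ 2 * u s) s := by
      intro s hs
      have := h s (fun i => ne_int_of_mem_Ioo (j := j)
        ⟨lt_of_lt_of_le hja hs.1, lt_of_le_of_lt hs.2 hbj⟩ i)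
      simpa using this
    have hconst : ∀ p : ℝ → ℂ, (∀ s ∈ Set.Icc a b, HasDerivAt p 0 s) →
        ∀ s ∈ Set.Icc a b, p s = p a := fun p hp =>
      constant_of_has_deriv_right_zero (fun s hs => (hp s hs).continuousAt.continuousWithinAt)
        fun s hs => (hp s (Set.Ico_subset_Icc_self hs)).hasDerivWithinAt
    have hp := hconst (fun s => u' s * (sinhKernel k (b - s) : ℂ) +
        u s * (Real.cosh (k * (b - s)) : ℂ)) ?_
    have hq := hconst (fun s => u s * (Real.cosh (k * (s - a)) : ℂ) -
        u' s * (sinhKernel k (s - a) : ℂ)) ?_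
    · have p1 := hp t ⟨hat, htb⟩
      have p2 := hp b ⟨hat.trans htb, le_rfl⟩
      have q1 := hq t ⟨hat, htb⟩
      simp only [sub_self, mul_zero, sinhKernel_zero, Real.cosh_zero, Complex.ofReal_zero,
        Complex.ofReal_one, mul_one, zero_add, sub_zero] at p1 p2 q1
      have hadd := congrArg (fun x : ℝ => (x : ℂ)) (sinhKernel_add k a b t)
      simp only [Complex.ofReal_add, Complex.ofReal_mul] at hadd
      rw [← hadd, ← q1, p2, ← p1]
      ring
    · intro s hs
      have h1 := ((hasDerivAt_cosh_mul k (s - a)).comp_sub_const s a).ofReal_comp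
      have h2 := ((hasDerivAt_sinhKernel k (s - a)).comp_sub_const s a).ofReal_comp
      have := ((h' s hs).1.mul h1).sub ((h' s hs).2.mul h2)
      convert! this using 1
      push_cast; ring
    · intro s hs
      have h1 := ((hasDerivAt_cosh_mul k (b - s)).comp_const_sub b s).ofReal_comp
      have h2 := ((hasDerivAt_sinhKernel k (b - s)).comp_const_sub b s).ofReal_comp
      have := ((h' s hs).2.mul h2).add ((h' s hs).1.mul h1)
      convert! this using 1
      push_cast; ring
  -- contract `a`, `t`, `b` towards the midpoint of the interval and pass to the limit
  have huc := hu.continuous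
  have hsc := continuous_sinhKernel k
  set q : ℝ → ℝ → ℝ := fun ε x => (1 - ε) * x + ε * (j + 1 / 2) with hq
  have hcl : IsClosed {ε : ℝ | u (q ε t) * sinhKernel k (q ε b - q ε a) =
      u (q ε a) * sinhKernel k (q ε b - q ε t) + u (q ε b) * sinhKernel k (q ε t - q ε a)} :=
    isClosed_eq (by fun_prop) (by fun_prop)
  have h0 := hcl.closure_subset_iff (s := Set.Ioo 0 1) |>.2 ?_
  · rw [closure_Ioo (by norm_num)] at h0
    have := h0 (Set.left_mem_Icc.2 zero_le_one)
    simpa [hq] using this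
  · intro ε hε
    apply key <;> simp only [hq] <;> nlinarith [hε.1, hε.2]

/-- The hat function of `d²/dt² - k²`: `H(1 - |s|)` on `[-1, 1]`, zero elsewhere. -/
noncomputable def expHat (k s : ℝ) : ℂ := (sinhKernel k (max 0 (1 - |s|)) : ℝ)

lemma continuous_expHat (k : ℝ) : Continuous (expHat k) := by
  have := continuous_sinhKernel k
  unfold expHat; fun_prop

lemma expHat_eq_zero {s : ℝ} (hs : 1 ≤ |s|) : expHat k s = 0 := by
  rw [expHat, max_eq_left (by linarith), sinhKernel_zero]; simp

/-- A spline of the lowest order is the combination of hats given by its values at the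
integers. -/
lemma IsExpSpline.core_eq_sum (hk : 0 ≤ k) (hu : IsExpSpline k 0 u) {t : ℝ} (s : Finset ℤ)
    (hs : ∀ i : ℤ, |t - i| < 1 → i ∈ s) :
    u t = ∑ i ∈ s, u i / sinhKernel k 1 * expHat k (t - i) := by
  have hH : (sinhKernel k 1 : ℂ) ≠ 0 := by
    exact_mod_cast (sinhKernel_pos hk one_pos).ne'
  have h1 : HasSum (fun i : ℤ => u i / sinhKernel k 1 * expHat k (t - i))
      (∑ i ∈ s, u i / sinhKernel k 1 * expHat k (t - i)) := by
    apply hasSum_sum_of_ne_finset_zero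
    intro i hi
    rw [expHat_eq_zero (not_lt.1 fun h => hi (hs i h)), mul_zero]
  have hf := Int.floor_le t
  have hf' := Int.lt_floor_add_one t
  have h2 : HasSum (fun i : ℤ => u i / sinhKernel k 1 * expHat k (t - i))
      (∑ i ∈ {⌊t⌋, ⌊t⌋ + 1}, u i / sinhKernel k 1 * expHat k (t - i)) := by
    apply hasSum_sum_of_ne_finset_zero
    intro i hi
    rw [expHat_eq_zero, mul_zero]
    simp only [Finset.mem_insert, Finset.mem_singleton, not_or] at hi
    rcases lt_or_gt_of_ne hi.1 with h | h
    · have : (i : ℝ) + 1 ≤ ⌊t⌋ := by exact_mod_cast h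
      exact le_abs.2 (Or.inl (by linarith))
    · have : (⌊t⌋ : ℝ) + 2 ≤ i := by
        have : ⌊t⌋ + 2 ≤ i := by omega
        exact_mod_cast this
      exact le_abs.2 (Or.inr (by linarith))
  rw [h1.unique h2, Finset.sum_pair (by omega)]
  have h3 := hu.interpolate (j := ⌊t⌋) le_rfl hf hf'.le le_rfl
  rw [add_sub_cancel_left] at h3
  have e1 : expHat k (t - ⌊t⌋) = sinhKernel k (⌊t⌋ + 1 - t) := by
    rw [expHat, abs_of_nonneg (by linarith), max_eq_right (by linarith)]
    congr 2; ring
  have e2 : expHat k (t - (⌊t⌋ + 1 : ℤ)) = sinhKernel k (t - ⌊t⌋) := by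
    push_cast
    rw [expHat, abs_of_nonpos (by linarith), max_eq_right (by linarith)]
    congr 2; ring
  rw [e1, e2]
  push_cast
  field_simp
  linear_combination h3

/-- The centred `B`-spline of order `n + 1` for `(d²/dt² - k²)^{n+1}`, supported in
`[-(n + 1), n + 1]`. -/
noncomputable def expBSpline (k : ℝ) (n : ℕ) : ℝ → ℂ := (kernelAvg k 1)^[n] (expHat k)

lemma continuous_expBSpline (k : ℝ) (n : ℕ) : Continuous (expBSpline k n) :=
  continuous_kernelAvg_iterate (continuous_expHat k) n

lemma expBSpline_succ (k : ℝ) (n : ℕ) :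
    expBSpline k (n + 1) = kernelAvg k 1 (expBSpline k n) :=
  Function.iterate_succ_apply' _ _ _

lemma expBSpline_eq_zero {t : ℝ} (ht : n + 1 ≤ |t|) : expBSpline k n t = 0 := by
  rw [expBSpline, kernelAvg_iterate_congr (g := 0), kernelAvg_iterate_zero]
  · rfl
  · intro x hx
    rw [abs_one, mul_one] at hx
    apply expHat_eq_zero
    rcases le_abs.1 ht with h | h
    · exact le_abs.2 (Or.inl (by linarith [hx.1]))
    · exact le_abs.2 (Or.inr (by linarith [hx.2]))

/-- Off the origin the `B`-spline decays like `e^{-k|t|}` relative to its peak; this is what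
makes the Shannon–Walter splines small off the integers when `k` is large. -/
lemma norm_expBSpline_le (hk : 0 ≤ k) (n : ℕ) (t : ℝ) :
    ‖expBSpline k n t‖ ≤ 2 ^ n * Real.exp (k * (n + 1 - |t|)) := by
  induction n generalizing t with
  | zero =>
    simp only [expBSpline, Function.iterate_zero, id_eq, pow_zero, one_mul, CharP.cast_eq_zero,
      zero_add]
    by_cases ht : 1 ≤ |t|
    · rw [expHat_eq_zero ht, norm_zero]; positivity
    · push Not at ht
      rw [expHat, max_eq_right (by linarith), Complex.norm_real,
        Real.norm_of_nonneg (sinhKernel_nonneg hk (by linarith))]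
      refine (sinhKernel_le hk _).trans ?_
      nlinarith [abs_nonneg t, Real.exp_pos (k * (1 - |t|))]
  | succ n ih =>
    rw [expBSpline_succ, kernelAvg]
    have : ∀ s ∈ Set.uIoc (0 : ℝ) 1, ‖(sinhKernel k (1 - s) : ℂ) *
        (expBSpline k n (t + s) + expBSpline k n (t - s))‖ ≤
        2 ^ (n + 1) * Real.exp (k * ((n + 1 : ℕ) + 1 - |t|)) := by
      intro s hs
      rw [Set.uIoc_of_le zero_le_one] at hs
      rw [norm_mul, Complex.norm_real, Real.norm_of_nonneg (sinhKernel_nonneg hk (by linarith [hs.2]))]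
      have h1 : sinhKernel k (1 - s) ≤ Real.exp (k * (1 - s)) := by
        refine (sinhKernel_le hk _).trans ?_
        nlinarith [Real.exp_pos (k * (1 - s)), hs.1]
      have h2 : ∀ x, |t| - s ≤ |x| →
          ‖expBSpline k n x‖ ≤ 2 ^ n * Real.exp (k * (n + 1 - (|t| - s))) := fun x hx =>
        (ih x).trans (by gcongr)
      have h3 := h2 (t + s) (by
        have := abs_sub_abs_le_abs_sub t (-s)
        rw [abs_neg, abs_of_pos hs.1, sub_neg_eq_add] at this; exact this)
      have h4 := h2 (t - s) (by
        have := abs_sub_abs_le_abs_sub t s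
        rwa [abs_of_pos hs.1] at this)
      have h5 : Real.exp (k * ((n + 1 : ℕ) + 1 - |t|)) =
          Real.exp (k * (1 - s)) * Real.exp (k * (n + 1 - (|t| - s))) := by
        rw [← Real.exp_add]; push_cast; ring_nf
      calc _ ≤ Real.exp (k * (1 - s)) * (2 ^ n * Real.exp (k * (n + 1 - (|t| - s))) +
              2 ^ n * Real.exp (k * (n + 1 - (|t| - s)))) := by
            gcongr
            exact (norm_add_le _ _).trans (add_le_add h3 h4)
        _ = _ := by rw [h5]; ring
    simpa using intervalIntegral.norm_integral_le_of_norm_le_const this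

/-- The `n`-th difference of a spline is a combination of `B`-splines. -/
lemma IsExpSpline.hasSum_centralDiff (hk : 0 ≤ k) (hu : IsExpSpline k 0 u) (t : ℝ) :
    HasSum (fun i : ℤ => u i / sinhKernel k 1 * expBSpline k n (t - i))
      ((kernelAvg k 1)^[n] u t) := by
  set s : Finset ℤ := Finset.Icc ⌊t - (n + 1)⌋ ⌈t + (n + 1)⌉ with hs
  have hmem : ∀ i : ℤ, |t - i| < n + 1 → i ∈ s := by
    intro i hi
    have := abs_lt.1 hi
    rw [hs, Finset.mem_Icc]
    constructor
    · have : (⌊t - (n + 1)⌋ : ℝ) ≤ i := (Int.floor_le _).trans (by linarith)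
      exact_mod_cast this
    · have : (i : ℝ) ≤ ⌈t + (n + 1)⌉ := le_trans (by linarith) (Int.le_ceil _)
      exact_mod_cast this
  have h1 : (kernelAvg k 1)^[n] u t =
      ∑ i ∈ s, u i / sinhKernel k 1 * expBSpline k n (t - i) := by
    rw [kernelAvg_iterate_congr
      (g := fun x => ∑ i ∈ s, u i / sinhKernel k 1 * expHat k (x - i))]
    · rw [kernelAvg_iterate_sum]
      · refine Finset.sum_congr rfl fun i _ => ?_
        rw [kernelAvg_iterate_const_mul]
        have := congrFun (kernelAvg_iterate_translate (k := k) (η := 1) n (-(i : ℝ)) (expHat k)) t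
        simp only [← sub_eq_add_neg] at this
        beta_reduce
        rw [this]; rfl
      · intro i _
        have := continuous_expHat k
        fun_prop
    · intro x hx
      rw [abs_one, mul_one] at hx
      apply hu.core_eq_sum hk
      intro i hi
      apply hmem
      have := abs_lt.1 hi
      rw [abs_lt]
      constructor <;> linarith [hx.1, hx.2]
  rw [h1]
  apply hasSum_sum_of_ne_finset_zero
  intro i hi
  rw [expBSpline_eq_zero (not_lt.1 fun h => hi (hmem i h)), mul_zero]

/-- The last function in the chain of a bounded spline is bounded at the integers: well inside a
unit interval it is a multiple of an `n`-th difference of the spline, by the mean value property of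
the solutions of `u'' = k² u`. -/
lemma IsExpSpline.exists_norm_core_le (hk : 0 ≤ k) (hu : IsExpSpline k 0 u)
    (huv : ∀ η, (centralDiff k η)^[n] v = (kernelAvg k η)^[n] u) {M : ℝ} (hM : ∀ t, ‖v t‖ ≤ M) :
    ∃ M', ∀ j : ℤ, ‖u j‖ ≤ M' := by
  set η : ℝ := 1 / (8 * (n + 1)) with hη
  have hη0 : 0 < η := by positivity
  have hηn : (n + 1) * η ≤ 1 / 8 := by rw [hη]; field_simp; norm_num
  set m : ℝ := ∫ s in (0 : ℝ)..η, sinhKernel k (η - s) * (2 * Real.cosh (k * s)) with hm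
  have hmpos : 0 < m := by
    apply intervalIntegral.intervalIntegral_pos_of_pos_on _ _ hη0
    · have := continuous_sinhKernel k
      exact Continuous.intervalIntegrable (by fun_prop) _ _
    · intro s hs
      exact mul_pos (sinhKernel_pos hk (by linarith [hs.2])) (by positivity)
  -- the mean value property: averages over windows free of integers only rescale `u`
  have hmean : ∀ (j : ℤ) (z : ℝ), j < z - η → z + η < j + 1 → kernelAvg k η u z = m * u z := by
    intro j z h1 h2
    rw [kernelAvg, hm, ← intervalIntegral.integral_ofReal, ← intervalIntegral.integral_mul_const]
    apply intervalIntegral.integral_congr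
    intro s hs
    rw [Set.uIcc_of_le hη0.le] at hs
    have := hu.centralDiff_core_eq_zero (j := j) (t := z) (η := s)
      (by rw [abs_of_nonneg hs.1]; linarith [hs.2]) (by rw [abs_of_nonneg hs.1]; linarith [hs.2])
    rw [centralDiff] at this
    push_cast at this ⊢
    linear_combination (sinhKernel k (η - s) : ℂ) * this
  have hiter : ∀ (l : ℕ) (j : ℤ) (c : ℝ), j < c - l * η → c + l * η < j + 1 →
      (kernelAvg k η)^[l] u c = m ^ l * u c := by
    intro l
    induction l with
    | zero => intro j c _ _; simp
    | succ l ih =>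
      intro j c h1 h2
      push_cast at h1 h2
      rw [Function.iterate_succ_apply, kernelAvg_iterate_congr (g := fun x => m * u x),
        kernelAvg_iterate_const_mul]
      · beta_reduce
        rw [ih j c (by linarith) (by linarith)]
        ring
      · intro x hx
        rw [abs_of_pos hη0] at hx
        exact hmean j x (by linarith [hx.1]) (by linarith [hx.2])
  set B := (2 + 2 * Real.cosh (k * η)) ^ n * M / m ^ n with hB
  have hin : ∀ (j : ℤ) (c : ℝ), j + 1 / 4 ≤ c → c ≤ j + 3 / 4 → ‖u c‖ ≤ B := by
    intro j c h1 h2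
    have e := hiter n j c (by linarith) (by linarith)
    rw [← huv] at e
    have := norm_centralDiff_iterate_le (k := k) (η := η) n hM c
    rw [e, norm_mul, norm_pow, Complex.norm_real, Real.norm_of_nonneg hmpos.le] at this
    rw [hB, le_div_iff₀ (by positivity)]
    linarith
  have hH : 0 < sinhKernel k (1 / 4) := sinhKernel_pos hk (by norm_num)
  have hH2 : 0 < sinhKernel k (1 / 2) := sinhKernel_pos hk (by norm_num)
  refine ⟨(B * sinhKernel k (1 / 2) + B * sinhKernel k (1 / 4)) / sinhKernel k (1 / 4),
    fun j => ?_⟩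
  -- extrapolate from `j + 1/4` and `j + 1/2` to the integer `j`
  have h := hu.interpolate (j := j) (a := j) (t := j + 1 / 4) (b := j + 1 / 2) le_rfl
    (by linarith) (by linarith) (by linarith)
  rw [show (j : ℝ) + 1 / 2 - j = 1 / 2 by ring, show (j : ℝ) + 1 / 4 - j = 1 / 4 by ring,
    show (j : ℝ) + 1 / 2 - (j + 1 / 4) = 1 / 4 by ring] at h
  rw [le_div_iff₀ hH]
  have e : ‖u j‖ * sinhKernel k (1 / 4) = ‖u j * (sinhKernel k (1 / 4) : ℂ)‖ := by
    rw [norm_mul, Complex.norm_real, Real.norm_of_nonneg hH.le]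
  rw [e, ← sub_eq_of_eq_add h]
  refine (norm_sub_le _ _).trans ?_
  rw [norm_mul, norm_mul, Complex.norm_real, Complex.norm_real, Real.norm_of_nonneg hH.le,
    Real.norm_of_nonneg hH2.le]
  gcongr
  · exact hin j _ (by linarith) (by linarith)
  · exact hin j _ (by linarith) (by linarith)

end Spline

/-! ### Fourier transforms of the `B`-splines -/

section Fourier

open scoped FourierTransform

variable {k : ℝ} {n : ℕ}

/-- The Fourier transform of the hat function at frequency `w`, in the normalization
`e^{-2πiwt}`. Away from `k = w = 0` it is `(2 cosh k - 2 cos 2πw) / ((2πw)² + k²)`. -/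
noncomputable def hatFourier (k w : ℝ) : ℝ :=
  ∫ s in (0 : ℝ)..1, sinhKernel k (1 - s) * (2 * Real.cos (2 * Real.pi * w * s))

lemma continuous_hatFourier (k : ℝ) : Continuous (hatFourier k) := by
  unfold hatFourier
  apply intervalIntegral.continuous_parametric_intervalIntegral_of_continuous'
  have := continuous_sinhKernel k
  fun_prop

lemma kernelAvg_exp (k w : ℝ) :
    kernelAvg k 1 (fun t : ℝ => Complex.exp (-(2 * Real.pi * w * t * Complex.I))) 0
      = hatFourier k w := by
  rw [kernelAvg, hatFourier, ← intervalIntegral.integral_ofReal]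
  congr 1; ext s
  push_cast
  rw [Complex.cos]
  simp only [zero_add, zero_sub]
  rw [show -(2 * (Real.pi : ℂ) * w * s * Complex.I) = -(2 * Real.pi * w * s) * Complex.I by ring,
    show -(2 * (Real.pi : ℂ) * w * -s * Complex.I) = 2 * Real.pi * w * s * Complex.I by ring]
  ring

/-- The central difference of an exponential is an average of it, as the exponential is an
eigenfunction of `d²/dt² - k²`. -/
lemma mul_hatFourier (k w : ℝ) : ((2 * Real.pi * w) ^ 2 + k ^ 2) * hatFourier k w =
    2 * Real.cosh k - 2 * Real.cos (2 * Real.pi * w) := by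
  set a : ℂ := -(2 * Real.pi * w * Complex.I) with ha
  set e : ℝ → ℂ := fun t => Complex.exp (a * t) with he
  have hd : ∀ t : ℝ, HasDerivAt e (a * e t) t := by
    intro t
    have := ((hasDerivAt_id (t : ℂ)).const_mul a).cexp.comp_ofReal
    convert! this using 1
    simp [he, mul_comm]
  have hs : SolvesOn k e (fun t => (a ^ 2 - k ^ 2) * e t) Set.univ := by
    refine ⟨fun t => a * e t, fun t _ => ⟨hd t, ?_⟩⟩
    convert! (hd t).const_mul a using 1
    ring
  have h1 := (hs.mono (Set.subset_univ (Set.uIcc (0 - 1) (0 + 1)))).centralDiff_eq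
    (by rw [he]; fun_prop)
  rw [kernelAvg_const_mul] at h1
  have h2 : kernelAvg k 1 e 0 = hatFourier k w := by
    rw [← kernelAvg_exp, he, ha]; ring_nf
  beta_reduce at h1
  rw [h2, centralDiff] at h1
  simp only [he, ha] at h1
  have h3 : (Real.cos (2 * Real.pi * w) : ℂ) = (Complex.exp (2 * Real.pi * w * Complex.I) +
      Complex.exp (-(2 * Real.pi * w) * Complex.I)) / 2 := by
    push_cast; rw [Complex.cos]
  have h4 : (-(2 * (Real.pi : ℂ) * w * Complex.I)) ^ 2 = -(2 * Real.pi * w) ^ 2 := by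
    rw [neg_sq, mul_pow, Complex.I_sq]; ring
  rw [h4] at h1
  have e1 : -(2 * (Real.pi : ℂ) * w * Complex.I) * ((0 + 1 : ℝ) : ℂ) =
    -(2 * Real.pi * w) * Complex.I := by push_cast; ring
  have e2 : -(2 * (Real.pi : ℂ) * w * Complex.I) * ((0 - 1 : ℝ) : ℂ) =
    2 * Real.pi * w * Complex.I := by push_cast; ring
  rw [e1, e2] at h1
  simp only [mul_one, Complex.ofReal_zero, mul_zero, Complex.exp_zero] at h1
  have : (((2 * Real.pi * w) ^ 2 + k ^ 2 : ℝ) : ℂ) * hatFourier k w =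
      (2 * Real.cosh k - 2 * Real.cos (2 * Real.pi * w) : ℝ) := by
    rw [Complex.ofReal_sub, Complex.ofReal_mul, Complex.ofReal_mul, h3]
    push_cast at h1 ⊢
    linear_combination h1
  exact_mod_cast this

lemma hatFourier_zero_zero : hatFourier 0 0 = 1 := by
  have : ∀ s : ℝ, sinhKernel 0 (1 - s) * (2 * Real.cos (2 * Real.pi * 0 * s)) = 2 - 2 * s := by
    intro s; simp [sinhKernel]; ring
  simp only [hatFourier, this]
  rw [intervalIntegral.integral_sub (by simp) (Continuous.intervalIntegrable (by fun_prop) _ _),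
    intervalIntegral.integral_const_mul, integral_id]
  norm_num

lemma denominator_pos {w : ℝ} (h : ¬(k = 0 ∧ w = 0)) : 0 < (2 * Real.pi * w) ^ 2 + k ^ 2 := by
  by_cases hk : k = 0
  · have hw : w ≠ 0 := fun hw => h ⟨hk, hw⟩
    have := Real.pi_pos
    positivity
  · positivity

lemma hatFourier_nonneg (k w : ℝ) : 0 ≤ hatFourier k w := by
  by_cases h : k = 0 ∧ w = 0
  · rw [h.1, h.2, hatFourier_zero_zero]; norm_num
  · have h1 := denominator_pos h
    have h2 := mul_hatFourier k w
    have h3 := Real.one_le_cosh k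
    have h4 := Real.cos_le_one (2 * Real.pi * w)
    by_contra hneg
    nlinarith

lemma hatFourier_le (hk : 0 ≤ k) (w : ℝ) :
    hatFourier k w ≤ (2 * Real.exp k + 2 * Real.cosh k + 2) * (1 + w ^ 2)⁻¹ := by
  have h1 : hatFourier k w ≤ 2 * Real.exp k := by
    have : ∀ s ∈ Set.uIoc (0 : ℝ) 1,
        ‖sinhKernel k (1 - s) * (2 * Real.cos (2 * Real.pi * w * s))‖ ≤ Real.exp k * 2 := by
      intro s hs
      rw [Set.uIoc_of_le zero_le_one] at hs
      rw [norm_mul, norm_mul, Real.norm_of_nonneg (sinhKernel_nonneg hk (by linarith [hs.2]))]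
      gcongr
      · refine (sinhKernel_le hk _).trans ?_
        have : Real.exp (k * (1 - s)) ≤ Real.exp k := Real.exp_le_exp.2 (by nlinarith [hs.1])
        nlinarith [Real.exp_pos (k * (1 - s)), hs.1]
      · simpa using Real.abs_cos_le_one _
    have := intervalIntegral.norm_integral_le_of_norm_le_const this
    rw [← hatFourier] at this
    refine (Real.le_norm_self _).trans (this.trans ?_)
    simp [mul_comm]
  rw [← div_eq_mul_inv, le_div_iff₀ (by positivity)]
  have h2 := mul_hatFourier k w
  have h3 := Real.neg_one_le_cos (2 * Real.pi * w)
  have h4 := hatFourier_nonneg k w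
  have h5 : w ^ 2 ≤ (2 * Real.pi * w) ^ 2 := by
    rw [mul_pow]
    nlinarith [Real.pi_gt_three, sq_nonneg w, sq_nonneg (2 * Real.pi - 1)]
  nlinarith [sq_nonneg k, mul_le_mul_of_nonneg_right h5 h4, mul_nonneg (sq_nonneg k) h4]

/-- A lower bound for `hatFourier` on a period. Only the values `k = 0` and `k ≥ 1` occur as
lengths of integer vectors. -/
lemma le_hatFourier (hk : k = 0 ∨ 1 ≤ k) {w : ℝ} (hw : |w| ≤ 1 / 2) :
    Real.exp k / (40 * (1 + k) ^ 2) ≤ hatFourier k w := by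
  have hpi := Real.pi_gt_three
  have hpi' := Real.pi_lt_d2
  have h2 := mul_hatFourier k w
  have hw2 : (2 * Real.pi * w) ^ 2 ≤ Real.pi ^ 2 := by
    rw [mul_pow, ← sq_abs w]
    have : |w| ^ 2 ≤ (1 / 2) ^ 2 := by gcongr
    nlinarith [sq_nonneg Real.pi]
  rcases hk with rfl | hk
  · simp only [Real.exp_zero, add_zero, one_pow, mul_one]
    by_cases h0 : w = 0
    · rw [h0, hatFourier_zero_zero]; norm_num
    · have hpos := denominator_pos (k := 0) (w := w) (by tauto)
      have h3 : (2 * Real.pi * w) ^ 2 * (1 / 10) ≤ 2 - 2 * Real.cos (2 * Real.pi * w) := by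
        have e : Real.cos (2 * Real.pi * w) = 1 - 2 * Real.sin (Real.pi * w) ^ 2 := by
          rw [show 2 * Real.pi * w = 2 * (Real.pi * w) by ring, Real.cos_two_mul, Real.cos_sq']
          ring
        have h5 := Real.mul_abs_le_abs_sin (x := Real.pi * w) (by
          rw [abs_mul, abs_of_pos Real.pi_pos]; nlinarith)
        rw [abs_mul, abs_of_pos Real.pi_pos] at h5
        have h6 : 2 / Real.pi * (Real.pi * |w|) = 2 * |w| := by field_simp
        rw [h6] at h5
        have h7 : (2 * |w|) ^ 2 ≤ Real.sin (Real.pi * w) ^ 2 := by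
          rw [← sq_abs (Real.sin _)]; gcongr
        rw [mul_pow, sq_abs] at h7
        rw [e]
        have : Real.pi ^ 2 ≤ 10 := by nlinarith
        nlinarith [sq_nonneg w]
      simp only [Real.cosh_zero, mul_one] at h2
      rw [← h2] at h3
      have h8 : (2 * Real.pi * w) ^ 2 * (1 / 10) ≤ (2 * Real.pi * w) ^ 2 * hatFourier 0 w := by
        simpa using h3
      have h9 := le_of_mul_le_mul_left h8 (by simpa using hpos)
      linarith
  · have hpos := denominator_pos (k := k) (w := w) (by rintro ⟨rfl, -⟩; linarith)
    have h3 := Real.cos_le_one (2 * Real.pi * w)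
    have h4 : Real.exp k / 4 ≤ 2 * Real.cosh k - 2 := by
      rw [Real.cosh_eq]
      have h5 : Real.exp 1 ≤ Real.exp k := Real.exp_le_exp.2 hk
      have h6 := Real.exp_one_gt_d9
      have h7 := Real.exp_pos (-k)
      linarith
    have h5 : (2 * Real.pi * w) ^ 2 + k ^ 2 ≤ 10 * (1 + k) ^ 2 := by nlinarith
    rw [div_le_iff₀ (by positivity)]
    have h6 := hatFourier_nonneg k w
    nlinarith [mul_le_mul_of_nonneg_right h5 h6]

lemma expHat_neg (k s : ℝ) : expHat k (-s) = expHat k s := by simp [expHat]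

lemma kernelAvg_eq_integral {f : ℝ → ℂ} (hf : Continuous f) (t : ℝ) :
    kernelAvg k 1 f t = ∫ s, expHat k s * f (t - s) := by
  have hc := continuous_expHat k
  have hsupp : Function.support (fun s => expHat k s * f (t - s)) ⊆ Set.Ioc (-1) 1 := by
    intro s hs
    by_contra h
    apply hs
    simp only
    rw [expHat_eq_zero, zero_mul]
    rw [Set.mem_Ioc, not_and_or, not_lt, not_le] at h
    rcases h with h | h
    · exact le_abs.2 (Or.inr (by linarith))
    · exact le_abs.2 (Or.inl h.le)
  have hi : ∀ a b : ℝ, IntervalIntegrable (fun s => expHat k s * f (t - s)) volume a b :=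
    fun a b => Continuous.intervalIntegrable (by fun_prop) _ _
  have hi' : ∀ a b : ℝ, IntervalIntegrable (fun s => expHat k s * f (t + s)) volume a b :=
    fun a b => Continuous.intervalIntegrable (by fun_prop) _ _
  rw [← intervalIntegral.integral_eq_integral_of_support_subset hsupp,
    ← intervalIntegral.integral_add_adjacent_intervals (hi (-1) 0) (hi 0 1)]
  have h1 : ∫ s in (-1 : ℝ)..0, expHat k s * f (t - s) =
      ∫ s in (0 : ℝ)..1, expHat k s * f (t + s) := by
    have := intervalIntegral.integral_comp_neg (a := 0) (b := 1)
      (fun s => expHat k s * f (t - s))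
    rw [neg_zero] at this
    rw [← this]
    congr 1; ext s; rw [expHat_neg, sub_neg_eq_add]
  rw [h1, ← intervalIntegral.integral_add (hi' 0 1) (hi 0 1), kernelAvg]
  apply intervalIntegral.integral_congr
  intro s hs
  rw [Set.uIcc_of_le zero_le_one] at hs
  simp only [expHat]
  rw [abs_of_nonneg hs.1, max_eq_right (by linarith [hs.2])]
  ring

lemma hasCompactSupport_expBSpline (k : ℝ) (n : ℕ) : HasCompactSupport (expBSpline k n) := by
  apply HasCompactSupport.of_support_subset_isCompact (K := Set.Icc (-(n + 1 : ℝ)) (n + 1))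
    isCompact_Icc
  intro x hx
  rw [Set.mem_Icc, ← abs_le]
  by_contra h
  exact hx (expBSpline_eq_zero (not_le.1 h).le)

lemma integrable_expBSpline (k : ℝ) (n : ℕ) : Integrable (expBSpline k n) :=
  (continuous_expBSpline k n).integrable_of_hasCompactSupport (hasCompactSupport_expBSpline k n)

lemma fourier_expHat (k w : ℝ) : 𝓕 (expHat k) w = hatFourier k w := by
  rw [← kernelAvg_exp, kernelAvg_eq_integral (by fun_prop), Real.fourier_real_eq_integral_exp_smul,
    ← integral_neg_eq_self]
  congr 1; ext s
  rw [expHat_neg, smul_eq_mul, mul_comm]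
  congr 2
  push_cast; ring

lemma fourier_expBSpline (k : ℝ) (n : ℕ) (w : ℝ) :
    𝓕 (expBSpline k n) w = ((hatFourier k w ^ (n + 1) : ℝ) : ℂ) := by
  induction n with
  | zero => rw [zero_add, pow_one]; exact fourier_expHat k w
  | succ n ih =>
    have h : expBSpline k (n + 1) =
        convolution (expHat k) (expBSpline k n) (ContinuousLinearMap.mul ℂ ℂ) volume := by
      ext t
      rw [expBSpline_succ, kernelAvg_eq_integral (continuous_expBSpline k n)]
      rfl
    rw [h, Real.fourier_mul_convolution_eq (f₁ := expHat k) (integrable_expBSpline k 0)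
      (integrable_expBSpline k n), ih, fourier_expHat]
    push_cast; ring

lemma hatFourier_pow_le (hk : 0 ≤ k) (n : ℕ) (w : ℝ) : hatFourier k w ^ (n + 1) ≤
    (2 * Real.exp k + 2 * Real.cosh k + 2) ^ (n + 1) * (1 + w ^ 2)⁻¹ := by
  have h := pow_le_pow_left₀ (hatFourier_nonneg k w) (hatFourier_le hk w) (n + 1)
  refine h.trans ?_
  rw [mul_pow]
  gcongr
  exact pow_le_of_le_one (by positivity) (inv_le_one_of_one_le₀ (by nlinarith [sq_nonneg w]))
    (by omega)

lemma integrable_hatFourier_pow (hk : 0 ≤ k) (n : ℕ) :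
    Integrable fun w => hatFourier k w ^ (n + 1) := by
  refine (integrable_inv_one_add_sq.const_mul
    ((2 * Real.exp k + 2 * Real.cosh k + 2) ^ (n + 1))).mono'
    ((continuous_hatFourier k).pow _).aestronglyMeasurable (ae_of_all _ fun w => ?_)
  rw [Real.norm_of_nonneg (pow_nonneg (hatFourier_nonneg k w) _)]
  exact hatFourier_pow_le hk n w

/-- Fourier inversion for the `B`-spline. -/
lemma expBSpline_eq_integral (hk : 0 ≤ k) (n : ℕ) (t : ℝ) : expBSpline k n t =
    ∫ w : ℝ, Complex.exp (2 * Real.pi * w * t * Complex.I) *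
      ((hatFourier k w ^ (n + 1) : ℝ) : ℂ) := by
  have h1 : 𝓕 (expBSpline k n) = fun w => ((hatFourier k w ^ (n + 1) : ℝ) : ℂ) :=
    funext fun w => fourier_expBSpline k n w
  have h2 : Integrable (𝓕 (expBSpline k n)) := by
    rw [h1]; exact (integrable_hatFourier_pow hk n).ofReal
  rw [← (integrable_expBSpline k n).fourierInv_fourier_eq h2
    (continuous_expBSpline k n).continuousAt, h1, Real.fourierInv_eq']
  congr 1; ext w
  rw [smul_eq_mul]
  congr 2
  simp [mul_comm, mul_assoc]

/-- The periodization of the Fourier transform of the `B`-spline. -/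
noncomputable def splineSymbol (k : ℝ) (n : ℕ) (w : ℝ) : ℝ :=
  ∑' m : ℤ, hatFourier k (w + m) ^ (n + 1)

lemma summable_inv_one_add_sq_int (w : ℝ) : Summable fun m : ℤ => (1 + (w + m) ^ 2)⁻¹ := by
  have h1 : Summable fun m : ℤ => (2 + 2 * w ^ 2) * (1 + (m : ℝ) ^ 2)⁻¹ := by
    apply Summable.mul_left
    have h2 : Summable fun m : ℤ => ((m : ℝ) ^ 2)⁻¹ := by
      simpa using Real.summable_one_div_int_pow.2 one_lt_two
    refine h2.of_norm_bounded_eventually ?_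
    rw [Filter.eventually_cofinite]
    refine (Set.finite_singleton 0).subset fun m hm => ?_
    by_contra hm0
    apply hm
    have : (m : ℝ) ≠ 0 := by exact_mod_cast hm0
    rw [Real.norm_of_nonneg (by positivity)]
    exact inv_anti₀ (by positivity) (by linarith)
  refine h1.of_nonneg_of_le (fun m => by positivity) fun m => ?_
  rw [← div_eq_mul_inv, inv_eq_one_div, div_le_div_iff₀ (by positivity) (by positivity)]
  nlinarith [sq_nonneg (m + 2 * w), sq_nonneg (w * (w + m)), sq_nonneg w]

lemma summable_hatFourier_pow (hk : 0 ≤ k) (n : ℕ) (w : ℝ) :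
    Summable fun m : ℤ => hatFourier k (w + m) ^ (n + 1) :=
  ((summable_inv_one_add_sq_int w).mul_left
    ((2 * Real.exp k + 2 * Real.cosh k + 2) ^ (n + 1))).of_nonneg_of_le
    (fun _ => pow_nonneg (hatFourier_nonneg k _) _) fun _ => hatFourier_pow_le hk n _

lemma splineSymbol_add_int (k : ℝ) (n : ℕ) (w : ℝ) (j : ℤ) :
    splineSymbol k n (w + j) = splineSymbol k n w := by
  unfold splineSymbol
  rw [← (Equiv.addLeft j).tsum_eq (fun m : ℤ => hatFourier k (w + m) ^ (n + 1))]
  congr 1; ext m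
  simp [add_assoc]

/-- The symbol has no zeros: all terms of the periodization are nonnegative, and one of them is at
least the minimum of the Fourier transform over a period. -/
lemma le_splineSymbol (hk : k = 0 ∨ 1 ≤ k) (n : ℕ) (w : ℝ) :
    (Real.exp k / (40 * (1 + k) ^ 2)) ^ (n + 1) ≤ splineSymbol k n w := by
  have hk0 : 0 ≤ k := by rcases hk with h | h <;> linarith
  -- the translate of `w` that is closest to zero
  set j : ℤ := -round w
  have hj : |w + j| ≤ 1 / 2 := by
    have := abs_sub_round w
    simpa [j, sub_eq_add_neg] using this
  refine (pow_le_pow_left₀ (by positivity) (le_hatFourier hk hj) _).trans ?_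
  exact (summable_hatFourier_pow hk0 n w).le_tsum j
    fun _ _ => pow_nonneg (hatFourier_nonneg k _) _

lemma splineSymbol_pos (hk : k = 0 ∨ 1 ≤ k) (n : ℕ) (w : ℝ) : 0 < splineSymbol k n w := by
  have hk0 : 0 ≤ k := by rcases hk with h | h <;> linarith
  exact lt_of_lt_of_le (by positivity) (le_splineSymbol hk n w)

lemma finite_support_expBSpline_int (k : ℝ) (n : ℕ) (F : ℤ → ℂ) :
    (Function.support fun j : ℤ => expBSpline k n j * F j).Finite := by
  refine (Set.finite_Icc (-(n + 1 : ℤ)) (n + 1)).subset fun j hj => ?_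
  by_contra h
  apply hj
  simp only
  rw [expBSpline_eq_zero, zero_mul]
  have : ((n : ℤ) + 1) ≤ |j| := by
    rw [Set.mem_Icc, ← abs_le] at h
    exact (not_le.1 h).le
  exact_mod_cast this

/-- Poisson summation: the symbol is the trigonometric polynomial of the values of the `B`-spline at
the integers. -/
lemma hasSum_splineSymbol (hk : 0 ≤ k) (n : ℕ) (w : ℝ) :
    HasSum (fun j : ℤ => expBSpline k n j * Complex.exp (-(2 * Real.pi * w * j * Complex.I)))
      (splineSymbol k n w) := by
  have hsum : Summable fun j : ℤ =>
      expBSpline k n j * Complex.exp (-(2 * Real.pi * w * j * Complex.I)) :=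
    summable_of_hasFiniteSupport
      (finite_support_expBSpline_int k n _)
  refine hsum.hasSum_iff.2 ?_
  set f : ℝ → ℂ := fun w => ((hatFourier k w ^ (n + 1) : ℝ) : ℂ) with hf
  have hfc : Continuous f := by
    have := continuous_hatFourier k
    rw [hf]; fun_prop
  have hF : ∀ x : ℝ, 𝓕 f x = expBSpline k n (-x) := by
    intro x
    rw [expBSpline_eq_integral hk, Real.fourier_real_eq_integral_exp_smul]
    congr 1; ext w
    rw [smul_eq_mul]
    congr 2
    push_cast; ring
  have hdecay : f =O[cocompact ℝ] fun x : ℝ => |x| ^ (-2 : ℝ) := by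
    apply Asymptotics.IsBigO.of_bound ((2 * Real.exp k + 2 * Real.cosh k + 2) ^ (n + 1))
    have h0 : ∀ᶠ x : ℝ in cocompact ℝ, x ∈ ({0} : Set ℝ)ᶜ := isCompact_singleton.compl_mem_cocompact
    filter_upwards [h0] with x hx
    have hx : x ≠ 0 := by simpa using hx
    rw [hf]
    simp only [Complex.norm_real]
    rw [Real.norm_of_nonneg (pow_nonneg (hatFourier_nonneg k _) _), Real.norm_of_nonneg (by positivity)]
    refine (hatFourier_pow_le hk n x).trans ?_
    gcongr
    rw [Real.rpow_neg (abs_nonneg _), show (2 : ℝ) = (2 : ℕ) by norm_num, Real.rpow_natCast, sq_abs]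
    exact inv_anti₀ (by positivity) (by linarith)
  have hFs : Summable fun j : ℤ => 𝓕 f j := by
    simp only [hF]
    have : Summable fun j : ℤ => expBSpline k n j * (1 : ℤ → ℂ) j :=
      summable_of_hasFiniteSupport (finite_support_expBSpline_int k n 1)
    have h2 := (Equiv.neg ℤ).summable_iff.2 this
    simpa [Function.comp_def] using h2
  have hP := Real.tsum_eq_tsum_fourier_of_rpow_decay_of_summable hfc one_lt_two hdecay hFs w
  rw [splineSymbol, Complex.ofReal_tsum, hP, ← (Equiv.neg ℤ).tsum_eq]
  congr 1; ext j
  rw [hF, fourier_coe_apply]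
  simp only [Equiv.neg_apply, Int.cast_neg, Complex.ofReal_one, div_one]
  congr 2
  ring

/-! ### Identification with the splines of the statement -/

/-- Pairing the frequencies `k` and `-k` turns the product into a power of the transform of the hat
function; the exponential factor comes from the support `[0, 2n + 2]` of the uncentred spline. -/
lemma tbSplineHat_stripFrequencies (k : ℝ) (n : ℕ) {w : ℝ} (hw : w ≠ 0) :
    tbSplineHat (stripFrequencies (n + 1) k) (2 * Real.pi * w : ℝ) =
      Complex.exp (-(2 * Real.pi * w * (n + 1 : ℕ) * Complex.I)) *
        ((hatFourier k w ^ (n + 1) : ℝ) : ℂ) := by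
  have h1 := mul_hatFourier k w
  have hpos := denominator_pos (k := k) (w := w) (by tauto)
  set x : ℝ := 2 * Real.pi * w with hx
  have hx0 : x ≠ 0 := by have := Real.pi_pos; positivity
  set z := Complex.exp (-(Complex.I * x)) with hz
  have hz0 : z ≠ 0 := Complex.exp_ne_zero _
  have hzi : Complex.exp (x * Complex.I) * z = 1 := by
    rw [hz, ← Complex.exp_add, mul_comm, add_neg_cancel, Complex.exp_zero]
  have hek : Complex.exp k * Complex.exp (-k) = 1 := by
    rw [← Complex.exp_add, add_neg_cancel, Complex.exp_zero]
  have hfac : (Complex.exp (-((-k : ℝ) : ℂ)) - z) / (Complex.I * x - ((-k : ℝ) : ℂ)) *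
      ((Complex.exp (-(k : ℂ)) - z) / (Complex.I * x - (k : ℂ))) = z * (hatFourier k w : ℂ) := by
    have hden : (Complex.I * x - ((-k : ℝ) : ℂ)) * (Complex.I * x - (k : ℂ)) =
        -((x ^ 2 + k ^ 2 : ℝ) : ℂ) := by
      push_cast
      linear_combination (x : ℂ) ^ 2 * Complex.I_sq
    rw [div_mul_div_comm, hden, div_eq_iff (neg_ne_zero.2 (by exact_mod_cast hpos.ne'))]
    have h1' := congrArg (fun r : ℝ => (r : ℂ)) h1
    simp only [Complex.ofReal_mul, Complex.ofReal_sub] at h1'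
    have hcos : (Real.cos x : ℂ) = (Complex.exp (x * Complex.I) + z) / 2 := by
      rw [Complex.ofReal_cos, Complex.cos, hz]
      congr 3; ring
    have hcosh : (Real.cosh k : ℂ) = (Complex.exp k + Complex.exp (-k)) / 2 := by
      rw [Complex.ofReal_cosh, Complex.cosh]
    rw [hcos, hcosh] at h1'
    push_cast at h1' ⊢
    rw [neg_neg]
    linear_combination z * h1' + hek - hzi
  rw [tbSplineHat, stripFrequencies, Multiset.map_add, Multiset.prod_add, Multiset.map_replicate,
    Multiset.map_replicate, Multiset.prod_replicate, Multiset.prod_replicate, ← mul_pow]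
  rw [hfac, mul_pow, Complex.ofReal_pow]
  congr 1
  rw [hz, ← Complex.exp_nat_mul]
  congr 1
  rw [hx]; push_cast; ring

lemma integral_two_pi_mul (F : ℝ → ℂ) :
    (2 * (Real.pi : ℂ))⁻¹ * ∫ ξ : ℝ, F ξ = ∫ w : ℝ, F (2 * Real.pi * w) := by
  rw [Measure.integral_comp_mul_left F (2 * Real.pi), abs_of_pos (by positivity), Complex.real_smul]
  push_cast; rfl

lemma ae_ne_zero : ∀ᵐ w : ℝ, w ≠ 0 := by
  rw [ae_iff]; simp

lemma tbSpline_stripFrequencies (hk : 0 ≤ k) (n : ℕ) (t : ℝ) :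
    tbSpline (stripFrequencies (n + 1) k) t = expBSpline k n (t - (n + 1 : ℕ)) := by
  rw [tbSpline, integral_two_pi_mul
    (fun ξ => Complex.exp (Complex.I * ξ * t) * tbSplineHat (stripFrequencies (n + 1) k) ξ),
    expBSpline_eq_integral hk]
  apply integral_congr_ae
  filter_upwards [ae_ne_zero] with w hw
  rw [tbSplineHat_stripFrequencies k n hw, ← mul_assoc, ← Complex.exp_add]
  congr 2
  push_cast; ring

lemma tbSymbol_stripFrequencies (hk : 0 ≤ k) (n : ℕ) (w : ℝ) :
    tbSymbol (stripFrequencies (n + 1) k) (2 * Real.pi * w : ℝ) =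
      Complex.exp (-(2 * Real.pi * w * (n + 1 : ℕ) * Complex.I)) * (splineSymbol k n w : ℂ) := by
  rw [tbSymbol, ← (hasSum_splineSymbol hk n w).tsum_eq, ← tsum_mul_left,
    ← (Equiv.addRight ((n + 1 : ℕ) : ℤ)).tsum_eq]
  congr 1; ext j
  rw [tbSpline_stripFrequencies hk]
  simp only [Equiv.coe_addRight, Int.cast_add, Int.cast_natCast, add_sub_cancel_right]
  rw [mul_left_comm, ← Complex.exp_add]
  congr 2
  push_cast; ring

/-- The Shannon–Walter spline as an inverse Fourier transform. -/
lemma shannonWalter_eq_integral (hk : 0 ≤ k) (n : ℕ) (t : ℝ) :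
    shannonWalter (stripFrequencies (n + 1) k) t =
      ∫ w : ℝ, Complex.exp (2 * Real.pi * w * t * Complex.I) *
        ((hatFourier k w ^ (n + 1) / splineSymbol k n w : ℝ) : ℂ) := by
  rw [shannonWalter, integral_two_pi_mul (fun ξ => Complex.exp (Complex.I * ξ * t) *
    (tbSplineHat (stripFrequencies (n + 1) k) ξ / tbSymbol (stripFrequencies (n + 1) k) ξ))]
  apply integral_congr_ae
  filter_upwards [ae_ne_zero] with w hw
  rw [tbSplineHat_stripFrequencies k n hw, tbSymbol_stripFrequencies hk,
    mul_div_mul_left _ _ (Complex.exp_ne_zero _), Complex.ofReal_div]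
  congr 2
  push_cast; ring

end Fourier

/-! ### The Shannon–Walter splines -/

/-- Integration by parts for Fourier coefficients. -/
lemma integral_exp_mul_deriv {f f' : ℝ → ℂ} (hf : ∀ w, HasDerivAt f (f' w) w)
    (hc : Continuous f') (h01 : f 1 = f 0) (m : ℤ) :
    ∫ w in (0 : ℝ)..1, Complex.exp (-(2 * Real.pi * Complex.I * m) * w) * f' w =
      2 * Real.pi * Complex.I * m *
        ∫ w in (0 : ℝ)..1, Complex.exp (-(2 * Real.pi * Complex.I * m) * w) * f w := by
  set a : ℂ := 2 * Real.pi * Complex.I * m with ha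
  have hfc : Continuous f := continuous_iff_continuousAt.2 fun w => (hf w).continuousAt
  have hd : ∀ w : ℝ, HasDerivAt (fun w : ℝ => Complex.exp (-a * w)) (-a * Complex.exp (-a * w)) w := by
    intro w
    have := ((hasDerivAt_id (w : ℂ)).const_mul (-a)).cexp.comp_ofReal
    convert! this using 1
    simp [mul_comm]
  have h1 := intervalIntegral.integral_eq_sub_of_hasDerivAt (a := 0) (b := 1)
    (fun w _ => (hd w).mul (hf w)) (Continuous.intervalIntegrable (by fun_prop) _ _)
  have he : Complex.exp (-a * (1 : ℝ)) = 1 := by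
    rw [Complex.exp_eq_one_iff]
    exact ⟨-m, by rw [ha]; push_cast; ring⟩
  simp only [Pi.mul_apply] at h1
  rw [he, h01, Complex.ofReal_zero, mul_zero, Complex.exp_zero, sub_self,
    intervalIntegral.integral_add (Continuous.intervalIntegrable (by fun_prop) _ _)
      (Continuous.intervalIntegrable (by fun_prop) _ _)] at h1
  rw [← intervalIntegral.integral_const_mul]
  have h2 : ∀ w : ℝ, -a * Complex.exp (-a * w) * f w = -(a * (Complex.exp (-a * w) * f w)) := by
    intro w; ring
  simp only [h2, intervalIntegral.integral_neg] at h1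
  linear_combination h1

/-- A twice continuously differentiable periodic function is the sum of its Fourier series, and its
coefficients decay quadratically. -/
lemma exists_fourier_series {B B' B'' : ℝ → ℂ} {M : ℝ} (hper : ∀ w, B (w + 1) = B w)
    (hB : ∀ w, HasDerivAt B (B' w) w) (hB' : ∀ w, HasDerivAt B' (B'' w) w) (hc : Continuous B'')
    (h0 : ∀ w, ‖B w‖ ≤ M) (h2 : ∀ w, ‖B'' w‖ ≤ M) :
    ∃ β : ℤ → ℂ, (∀ m, ‖β m‖ ≤ 2 * M * (1 + (m : ℝ) ^ 2)⁻¹) ∧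
      ∀ w : ℝ, HasSum (fun m => β m * Complex.exp (2 * Real.pi * Complex.I * m * w)) (B w) := by
  have hBc : Continuous B := continuous_iff_continuousAt.2 fun w => (hB w).continuousAt
  have hB'c : Continuous B' := continuous_iff_continuousAt.2 fun w => (hB' w).continuousAt
  have hper' : ∀ w, B' (w + 1) = B' w := by
    intro w
    have h1 := (hB (w + 1)).comp_add_const w 1
    have e : (fun x => B (x + 1)) = B := funext hper
    rw [e] at h1
    exact h1.unique (hB w)
  have hM : 0 ≤ M := (norm_nonneg _).trans (h0 0)
  set F : C(UnitAddCircle, ℂ) :=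
    ⟨Function.Periodic.lift (f := B) (c := 1) hper, continuous_coinduced_dom.mpr hBc⟩ with hF
  have hFB : ∀ w : ℝ, F (w : UnitAddCircle) = B w := fun w => rfl
  have hcoef : ∀ m : ℤ, fourierCoeff F m =
      ∫ w in (0 : ℝ)..1, Complex.exp (-(2 * Real.pi * Complex.I * m) * w) * B w := by
    intro m
    rw [fourierCoeff_eq_intervalIntegral F m 0]
    simp only [div_one, one_smul, zero_add]
    congr 1; ext w
    rw [hFB, fourier_coe_apply, smul_eq_mul]
    congr 2
    push_cast; ring
  have hbound : ∀ (f : ℝ → ℂ) (m : ℤ), (∀ w, ‖f w‖ ≤ M) →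
      ‖∫ w in (0 : ℝ)..1, Complex.exp (-(2 * Real.pi * Complex.I * m) * w) * f w‖ ≤ M := by
    intro f m hf
    have : ∀ w ∈ Set.uIoc (0 : ℝ) 1,
        ‖Complex.exp (-(2 * Real.pi * Complex.I * m) * w) * f w‖ ≤ M := by
      intro w _
      rw [norm_mul, show -(2 * Real.pi * Complex.I * m) * w =
        ((-(2 * Real.pi * m * w) : ℝ) : ℂ) * Complex.I by push_cast; ring,
        Complex.norm_exp_ofReal_mul_I, one_mul]
      exact hf w
    simpa using intervalIntegral.norm_integral_le_of_norm_le_const this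
  have hdecay : ∀ m : ℤ, ‖fourierCoeff F m‖ ≤ 2 * M * (1 + (m : ℝ) ^ 2)⁻¹ := by
    intro m
    by_cases hm : m = 0
    · subst hm
      refine (hcoef 0 ▸ hbound B 0 h0).trans ?_
      simp; linarith
    · have h3 := integral_exp_mul_deriv hB' hc (by simpa using hper' 0) m
      rw [integral_exp_mul_deriv hB hB'c (by simpa using hper 0) m, ← hcoef] at h3
      have h4 := hbound B'' m h2
      rw [h3, norm_mul, norm_mul _ (fourierCoeff F m)] at h4
      have hm1 : (1 : ℝ) ≤ (m : ℝ) ^ 2 := by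
        have : (1 : ℤ) ≤ m ^ 2 := by have := sq_nonneg m; have := pow_ne_zero 2 hm; omega
        exact_mod_cast this
      have h5 : ‖(2 * Real.pi * Complex.I * m : ℂ)‖ = 2 * Real.pi * |(m : ℝ)| := by
        simp [abs_of_pos Real.pi_pos]
      rw [h5] at h4
      rw [← div_eq_mul_inv, le_div_iff₀ (by positivity)]
      have h6 : (1 + (m : ℝ) ^ 2) ≤ 2 * ((2 * Real.pi * |(m : ℝ)|) * (2 * Real.pi * |(m : ℝ)|)) := by
        rw [show (2 * Real.pi * |(m : ℝ)|) * (2 * Real.pi * |(m : ℝ)|) =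
          (2 * Real.pi) ^ 2 * |(m : ℝ)| ^ 2 by ring, sq_abs]
        have : (1 : ℝ) ≤ (2 * Real.pi) ^ 2 := by nlinarith [Real.pi_gt_three]
        nlinarith
      nlinarith [mul_le_mul_of_nonneg_right h6 (norm_nonneg (fourierCoeff F m))]
  refine ⟨fourierCoeff F, hdecay, fun w => ?_⟩
  have hs : Summable (fourierCoeff F) := by
    refine Summable.of_norm_bounded ((summable_inv_one_add_sq_int 0).mul_left (2 * M)) ?_
    simpa using hdecay
  have := has_pointwise_sum_fourier_series_of_summable hs (w : UnitAddCircle)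
  rw [hFB] at this
  convert! this using 1
  ext m
  rw [fourier_coe_apply, smul_eq_mul]
  congr 2
  push_cast; ring

section Shannon

variable {k : ℝ} {n : ℕ}

/-- The symbol as a finite sum. -/
lemma splineSymbol_eq_sum (hk : 0 ≤ k) (n : ℕ) (w : ℝ) : (splineSymbol k n w : ℂ) =
    ∑ j ∈ Finset.Icc (-(n + 1 : ℤ)) (n + 1),
      expBSpline k n j * Complex.exp (-(2 * Real.pi * j * Complex.I) * w) := by
  have h1 := hasSum_splineSymbol hk n w
  refine h1.unique ?_
  have h2 : ∀ j : ℤ, expBSpline k n j * Complex.exp (-(2 * Real.pi * w * j * Complex.I)) =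
      expBSpline k n j * Complex.exp (-(2 * Real.pi * j * Complex.I) * w) := by
    intro j; congr 2; ring
  simp only [h2]
  apply hasSum_sum_of_ne_finset_zero
  intro j hj
  rw [expBSpline_eq_zero, zero_mul]
  rw [Finset.mem_Icc, ← abs_le] at hj
  exact_mod_cast (not_le.1 hj).le

/-- The reciprocal of the symbol has an absolutely convergent Fourier series, with explicit dependence
of the coefficients on `k`. -/
lemma exists_inv_splineSymbol_series (n : ℕ) : ∃ C : ℝ, 0 ≤ C ∧ ∀ k : ℝ, (k = 0 ∨ 1 ≤ k) →
    ∃ β : ℤ → ℂ, (∀ m, ‖β m‖ ≤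
        C * (1 + k) ^ (6 * (n + 1)) * Real.exp (-(k * (n + 1))) * (1 + (m : ℝ) ^ 2)⁻¹) ∧
      ∀ w : ℝ, HasSum (fun m => β m * Complex.exp (2 * Real.pi * Complex.I * m * w))
        ((splineSymbol k n w : ℂ)⁻¹) := by
  set s : Finset ℤ := Finset.Icc (-(n + 1 : ℤ)) (n + 1) with hs
  set D : ℝ := s.card * (2 * Real.pi * (n + 1)) ^ 2 with hD
  have hD0 : 0 ≤ D := by positivity
  set C : ℝ := 1 + D * 2 ^ n + 2 * (D * 2 ^ n) ^ 2 with hC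
  refine ⟨2 * (C * 40 ^ (3 * (n + 1))), by positivity, fun k hk => ?_⟩
  have hk0 : 0 ≤ k := by rcases hk with h | h <;> linarith
  set a : ℤ → ℂ := fun j => -(2 * Real.pi * j * Complex.I) with ha
  -- `P i` is the `i`-th derivative of the symbol
  set P : ℕ → ℝ → ℂ := fun i w =>
    ∑ j ∈ s, expBSpline k n j * a j ^ i * Complex.exp (a j * w) with hP
  have hP0 : ∀ w, (splineSymbol k n w : ℂ) = P 0 w := by
    intro w
    rw [splineSymbol_eq_sum hk0]
    simp [hP, ha, hs]
  have hPd : ∀ i w, HasDerivAt (P i) (P (i + 1) w) w := by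
    intro i w
    simp only [hP]
    apply HasDerivAt.fun_sum
    intro j _
    have := (((hasDerivAt_id (w : ℂ)).const_mul (a j)).cexp.comp_ofReal).const_mul
      (expBSpline k n j * a j ^ i)
    convert! this using 1
    simp only [id_eq]
    ring
  have hPc : ∀ i, Continuous (P i) := fun i =>
    continuous_iff_continuousAt.2 fun w => (hPd i w).continuousAt
  set X := Real.exp (k * (n + 1)) with hX
  have hX0 : 0 < X := Real.exp_pos _
  have hPb : ∀ i, 1 ≤ i → i ≤ 2 → ∀ w, ‖P i w‖ ≤ D * 2 ^ n * X := by
    intro i hi1 hi2 w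
    have hterm : ∀ j ∈ s, ‖expBSpline k n j * a j ^ i * Complex.exp (a j * w)‖ ≤
        2 ^ n * X * (2 * Real.pi * (n + 1)) ^ 2 := by
      intro j hj
      have e1 : ‖Complex.exp (a j * w)‖ = 1 := by
        rw [show a j * w = ((-(2 * Real.pi * j * w) : ℝ) : ℂ) * Complex.I by
          simp only [ha]; push_cast; ring, Complex.norm_exp_ofReal_mul_I]
      have e2 : ‖a j‖ ≤ 2 * Real.pi * (n + 1) := by
        have : ‖a j‖ = 2 * Real.pi * |(j : ℝ)| := by
          simp [ha, abs_of_pos Real.pi_pos]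
        rw [this]
        have hj' : |j| ≤ (n : ℤ) + 1 := by
          rw [hs, Finset.mem_Icc, ← abs_le] at hj; exact hj
        have : |(j : ℝ)| ≤ n + 1 := by exact_mod_cast hj'
        have := Real.pi_pos
        gcongr
      have e3 : ‖a j‖ ^ i ≤ (2 * Real.pi * (n + 1)) ^ 2 := by
        refine (pow_le_pow_left₀ (norm_nonneg _) e2 i).trans (pow_le_pow_right₀ ?_ hi2)
        nlinarith [Real.pi_gt_three, (Nat.cast_nonneg n : (0 : ℝ) ≤ n)]
      rw [norm_mul, norm_mul, norm_pow, e1, mul_one]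
      refine mul_le_mul ?_ e3 (by positivity) (by positivity)
      refine (norm_expBSpline_le hk0 n j).trans ?_
      rw [hX]
      gcongr
      linarith [abs_nonneg (j : ℝ)]
    refine (norm_sum_le_of_le _ hterm).trans ?_
    rw [Finset.sum_const, nsmul_eq_mul, hD]
    apply le_of_eq; ring
  set Λ : ℝ := (40 * (1 + k) ^ 2) ^ (n + 1) with hΛ
  have hΛ1 : 1 ≤ Λ := one_le_pow₀ (by nlinarith)
  -- the symbol and its derivatives are all of size `e^{k(n+1)}` up to powers of `1 + k`
  have hlow : ∀ w, X / Λ ≤ ‖P 0 w‖ := by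
    intro w
    rw [← hP0, Complex.norm_real]
    refine le_trans ?_ (Real.le_norm_self _)
    refine le_trans (le_of_eq ?_) (le_splineSymbol hk n w)
    rw [div_pow, ← Real.exp_nat_mul, hX, hΛ]
    congr 2
    push_cast; ring
  have hne : ∀ w, P 0 w ≠ 0 := fun w h => by
    have := hlow w
    rw [h, norm_zero] at this
    have : 0 < X / Λ := by positivity
    linarith
  have hinv : ∀ w, ‖P 0 w‖⁻¹ ≤ Λ / X := by
    intro w
    rw [← inv_div]
    exact inv_anti₀ (by positivity) (hlow w)
  have hB : ∀ w, HasDerivAt (fun w => (P 0 w)⁻¹) (-P 1 w / P 0 w ^ 2) w := fun w =>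
    (hPd 0 w).fun_inv (hne w)
  have hB' : ∀ w, HasDerivAt (fun w => -P 1 w / P 0 w ^ 2)
      (-P 2 w * (P 0 w)⁻¹ ^ 2 + 2 * P 1 w ^ 2 * (P 0 w)⁻¹ ^ 3) w := by
    intro w
    have := (hPd 1 w).fun_neg.fun_div ((hPd 0 w).fun_pow 2) (pow_ne_zero 2 (hne w))
    convert! this using 1
    have := hne w
    field_simp
    push_cast
    ring
  have hper : ∀ w, (P 0 (w + 1))⁻¹ = (P 0 w)⁻¹ := by
    intro w
    rw [← hP0, ← hP0]
    have := splineSymbol_add_int k n w 1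
    push_cast at this
    rw [this]
  have hC1 : 1 ≤ C := by rw [hC]; nlinarith [sq_nonneg (D * 2 ^ n), mul_nonneg hD0 (show (0 : ℝ) ≤ 2 ^ n by positivity)]
  obtain ⟨β, hβ, hsum⟩ := exists_fourier_series (M := C * Λ ^ 3 / X) hper hB hB' (by
      have h0 := hPc 0
      have h1 := hPc 1
      have h2 := hPc 2
      have h3 : Continuous fun w => (P 0 w)⁻¹ := h0.inv₀ hne
      fun_prop) (by
      intro w
      rw [norm_inv]
      refine (hinv w).trans ?_
      gcongr
      calc Λ = 1 * Λ ^ 1 := by ring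
        _ ≤ C * Λ ^ 3 := by
          gcongr
          norm_num) (by
      intro w
      have hD2 : 0 ≤ D * 2 ^ n := by positivity
      calc _ ≤ D * 2 ^ n * X * (Λ / X) ^ 2 + 2 * (D * 2 ^ n * X) ^ 2 * (Λ / X) ^ 3 := by
            refine (norm_add_le _ _).trans (add_le_add ?_ ?_)
            · rw [norm_mul, norm_neg, norm_pow, norm_inv]
              gcongr
              · exact hPb 2 (by norm_num) le_rfl w
              · exact hinv w
            · rw [norm_mul, norm_mul, norm_pow, norm_pow, norm_inv]
              simp only [Complex.norm_ofNat]
              gcongr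
              · exact hPb 1 le_rfl (by norm_num) w
              · exact hinv w
        _ = (D * 2 ^ n * Λ ^ 2 + 2 * (D * 2 ^ n) ^ 2 * Λ ^ 3) / X := by
            field_simp
        _ ≤ _ := by
            gcongr
            rw [hC]
            have : Λ ^ 2 ≤ Λ ^ 3 := pow_le_pow_right₀ hΛ1 (by norm_num)
            have h3 : 0 ≤ Λ ^ 3 := by positivity
            nlinarith [mul_le_mul_of_nonneg_left this hD2])
  refine ⟨β, fun m => (hβ m).trans (le_of_eq ?_), fun w => ?_⟩
  · rw [Real.exp_neg, ← hX, hΛ]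
    rw [mul_pow, ← pow_mul, mul_pow, ← pow_mul, ← pow_mul]
    ring_nf
  · rw [hP0]; exact hsum w

lemma norm_exp_two_pi (w t : ℝ) : ‖Complex.exp (2 * Real.pi * w * t * Complex.I)‖ = 1 := by
  rw [show (2 * Real.pi * w * t * Complex.I : ℂ) = ((2 * Real.pi * w * t : ℝ) : ℂ) * Complex.I by
    push_cast; ring, Complex.norm_exp_ofReal_mul_I]

lemma continuous_splineSymbol (hk : 0 ≤ k) (n : ℕ) : Continuous (splineSymbol k n) := by
  have : Continuous fun w => (splineSymbol k n w : ℂ) := by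
    simp only [splineSymbol_eq_sum hk]
    fun_prop
  exact (Complex.continuous_re.comp this).congr fun w => by simp

lemma integrable_hatFourier_pow_div (hk : k = 0 ∨ 1 ≤ k) (n : ℕ) :
    Integrable fun w => hatFourier k w ^ (n + 1) / splineSymbol k n w := by
  have hk0 : 0 ≤ k := by rcases hk with h | h <;> linarith
  refine ((integrable_hatFourier_pow hk0 n).const_mul
    ((Real.exp k / (40 * (1 + k) ^ 2)) ^ (n + 1))⁻¹).mono'
    (((continuous_hatFourier k).pow _).div (continuous_splineSymbol hk0 n)
      fun w => (splineSymbol_pos hk n w).ne').aestronglyMeasurable (ae_of_all _ fun w => ?_)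
  have h1 := le_splineSymbol hk n w
  have h2 := splineSymbol_pos hk n w
  have h3 := hatFourier_nonneg k w
  rw [Real.norm_of_nonneg (by positivity), div_eq_mul_inv, mul_comm]
  gcongr

/-- At the integers, the integral defining the Shannon–Walter spline folds to an integral over one
period. -/
lemma shannonWalter_int (hk : k = 0 ∨ 1 ≤ k) (n : ℕ) (j : ℤ) :
    shannonWalter (stripFrequencies (n + 1) k) j = if j = 0 then 1 else 0 := by
  have hk0 : 0 ≤ k := by rcases hk with h | h <;> linarith
  rw [shannonWalter_eq_integral hk0]
  set G : ℝ → ℂ := fun w => Complex.exp (2 * Real.pi * w * (j : ℝ) * Complex.I) *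
    ((hatFourier k w ^ (n + 1) / splineSymbol k n w : ℝ) : ℂ) with hG
  have hGn : ∀ w, ‖G w‖ = hatFourier k w ^ (n + 1) / splineSymbol k n w := by
    intro w
    rw [hG]
    simp only
    rw [norm_mul, norm_exp_two_pi, one_mul, Complex.norm_real, Real.norm_of_nonneg]
    exact div_nonneg (pow_nonneg (hatFourier_nonneg k w) _) (splineSymbol_pos hk n w).le
  have hGc : Continuous G := by
    have h1 := continuous_hatFourier k
    have h2 : Continuous fun w => hatFourier k w ^ (n + 1) / splineSymbol k n w :=
      (h1.pow _).div (continuous_splineSymbol hk0 n) fun w => (splineSymbol_pos hk n w).ne'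
    rw [hG]; fun_prop
  have hGi : Integrable G := by
    refine (integrable_hatFourier_pow_div hk n).mono' hGc.aestronglyMeasurable
      (ae_of_all _ fun w => (hGn w).le)
  have h1 := hGi.hasSum_intervalIntegral_comp_add_int
  have hnorm := hGi.norm.hasSum_intervalIntegral_comp_add_int
  -- the translates of `G` add up to the exponential alone
  have hpt : ∀ x : ℝ, HasSum (fun m : ℤ => G (x + m))
      (Complex.exp (2 * Real.pi * x * j * Complex.I)) := by
    intro x
    have h2 := ((summable_hatFourier_pow hk0 n x).hasSum.div_const
      (splineSymbol k n x)).mapL Complex.ofRealCLM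
    have h3 := h2.mul_left (Complex.exp (2 * Real.pi * x * j * Complex.I))
    rw [← splineSymbol, div_self (splineSymbol_pos hk n x).ne'] at h3
    convert! h3 using 1
    · ext m
      rw [hG]
      simp only [Complex.ofRealCLM_apply]
      rw [splineSymbol_add_int]
      congr 1
      rw [Complex.exp_eq_exp_iff_exists_int]
      exact ⟨m * j, by push_cast; ring⟩
    · simp
  have h2 : HasSum (fun m : ℤ => ∫ x in (0 : ℝ)..1, G (x + m))
      (∫ x in (0 : ℝ)..1, Complex.exp (2 * Real.pi * x * j * Complex.I)) := by
    simp only [intervalIntegral.integral_of_le zero_le_one] at hnorm ⊢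
    have h3 := hasSum_integral_of_summable_integral_norm (μ := volume.restrict (Set.Ioc (0 : ℝ) 1))
      (F := fun (m : ℤ) x => G (x + m)) ?_ hnorm.summable
    · convert! h3 using 1
      congr 1; ext x
      exact (hpt x).tsum_eq.symm
    · intro m
      exact (hGi.comp_add_right (m : ℝ)).restrict
  rw [h1.unique h2]
  split_ifs with hj
  · simp [hj]
  · have hc : (2 * Real.pi * j * Complex.I : ℂ) ≠ 0 := by
      have := Real.pi_ne_zero
      simp [hj, this]
    have e : ∀ x : ℝ, (2 * Real.pi * x * j * Complex.I : ℂ) = (2 * Real.pi * j * Complex.I) * x := by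
      intro x; ring
    simp only [e]
    rw [integral_exp_mul_complex hc]
    have h4 : Complex.exp (2 * Real.pi * j * Complex.I * (1 : ℝ)) = 1 := by
      rw [Complex.exp_eq_one_iff]
      exact ⟨j, by push_cast; ring⟩
    rw [h4]; simp

/-- The Fourier transform is nonnegative, so the value `1` at the origin is the maximum. -/
lemma norm_shannonWalter_le (hk : k = 0 ∨ 1 ≤ k) (n : ℕ) (t : ℝ) :
    ‖shannonWalter (stripFrequencies (n + 1) k) t‖ ≤ 1 := by
  have hk0 : 0 ≤ k := by rcases hk with h | h <;> linarith
  have h0 := shannonWalter_int hk n 0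
  rw [shannonWalter_eq_integral hk0] at h0 ⊢
  simp only [Int.cast_zero, Complex.ofReal_zero, mul_zero, zero_mul, Complex.exp_zero, one_mul,
    if_true] at h0
  rw [integral_complex_ofReal] at h0
  have h1 : ∫ w, hatFourier k w ^ (n + 1) / splineSymbol k n w = 1 := by exact_mod_cast h0
  refine (norm_integral_le_integral_norm _).trans (le_of_eq ?_)
  rw [← h1]
  congr 1; ext w
  rw [norm_mul, norm_exp_two_pi, one_mul, Complex.norm_real, Real.norm_of_nonneg]
  exact div_nonneg (pow_nonneg (hatFourier_nonneg k w) _) (splineSymbol_pos hk n w).le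

/-- The `B`-spline in terms of the Shannon–Walter spline. -/
lemma expBSpline_eq_sum_shannonWalter (hk : k = 0 ∨ 1 ≤ k) (n : ℕ) (t : ℝ) :
    expBSpline k n t = ∑ l ∈ Finset.Icc (-(n + 1 : ℤ)) (n + 1),
      expBSpline k n l * shannonWalter (stripFrequencies (n + 1) k) (t - l) := by
  have hk0 : 0 ≤ k := by rcases hk with h | h <;> linarith
  simp only [shannonWalter_eq_integral hk0, ← integral_const_mul]
  rw [expBSpline_eq_integral hk0, ← integral_finsetSum]
  · congr 1; ext w
    have h1 := splineSymbol_eq_sum hk0 n w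
    have h2 : (splineSymbol k n w : ℂ) ≠ 0 := by exact_mod_cast (splineSymbol_pos hk n w).ne'
    rw [Complex.ofReal_div]
    calc _ = Complex.exp (2 * Real.pi * w * t * Complex.I) * (splineSymbol k n w *
          (((hatFourier k w ^ (n + 1) : ℝ) : ℂ) / splineSymbol k n w)) := by
          rw [mul_div_cancel₀ _ h2]
      _ = _ := by
          nth_rewrite 1 [h1]
          rw [Finset.sum_mul, Finset.mul_sum]
          refine Finset.sum_congr rfl fun l _ => ?_
          have : Complex.exp (2 * Real.pi * w * (t - l : ℝ) * Complex.I) =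
              Complex.exp (2 * Real.pi * w * t * Complex.I) *
                Complex.exp (-(2 * Real.pi * l * Complex.I) * w) := by
            rw [← Complex.exp_add]; congr 1; push_cast; ring
          rw [this]; ring
  · intro l _
    apply Integrable.const_mul
    refine (integrable_hatFourier_pow_div hk n).ofReal.bdd_mul (c := 1)
      (Continuous.aestronglyMeasurable (by fun_prop)) (ae_of_all _ fun w => ?_)
    rw [norm_exp_two_pi]

/-- The sum of the absolute values of the translates of a `B`-spline at a point at distance at least
`δ` from the integers. -/
lemma summable_norm_expBSpline (hk : 0 ≤ k) (n : ℕ) {t δ : ℝ} (hδ : ∀ j : ℤ, δ ≤ |t - j|) :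
    Summable (fun j : ℤ => ‖expBSpline k n (t - j)‖) ∧
      ∑' j : ℤ, ‖expBSpline k n (t - j)‖ ≤ (2 * n + 4) * 2 ^ n * Real.exp (k * (n + 1 - δ)) := by
  set s : Finset ℤ := Finset.Icc (⌊t⌋ - (n + 1)) (⌊t⌋ + (n + 2)) with hs
  have hf := Int.floor_le t
  have hf' := Int.lt_floor_add_one t
  have hout : ∀ j ∉ s, ‖expBSpline k n (t - j)‖ = 0 := by
    intro j hj
    rw [expBSpline_eq_zero, norm_zero]
    rw [hs, Finset.mem_Icc, not_and_or, not_le, not_le] at hj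
    rcases hj with h | h
    · have : (j : ℝ) + 1 ≤ ⌊t⌋ - (n + 1) := by exact_mod_cast h
      exact le_abs.2 (Or.inl (by linarith))
    · have : (⌊t⌋ : ℝ) + (n + 2) + 1 ≤ j := by exact_mod_cast h
      exact le_abs.2 (Or.inr (by linarith))
  have hsum : HasSum (fun j : ℤ => ‖expBSpline k n (t - j)‖) _ :=
    hasSum_sum_of_ne_finset_zero hout
  refine ⟨hsum.summable, ?_⟩
  rw [hsum.tsum_eq]
  have hle : ∀ j ∈ s, ‖expBSpline k n (t - j)‖ ≤ 2 ^ n * Real.exp (k * (n + 1 - δ)) := fun j _ =>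
    (norm_expBSpline_le hk n _).trans (by gcongr; exact hδ j)
  refine (Finset.sum_le_card_nsmul _ _ _ hle).trans (le_of_eq ?_)
  rw [nsmul_eq_mul, hs, Int.card_Icc, ← mul_assoc]
  congr 2
  have : (⌊t⌋ + ((n : ℤ) + 2) + 1 - (⌊t⌋ - (n + 1))).toNat = 2 * n + 4 := by omega
  rw [this]; push_cast; ring

/-- The `ℓ¹` norm of a convolution-like combination of sequences with bounded `ℓ¹` norms. -/
lemma tsum_norm_le_of_hasSum_mul {β S : ℤ → ℂ} {q : ℤ → ℤ → ℂ} {A : ℝ}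
    (hβ : Summable fun m => ‖β m‖)
    (hq : ∀ m, Summable (fun j => ‖q m j‖) ∧ ∑' j, ‖q m j‖ ≤ A)
    (hS : ∀ j, HasSum (fun m => β m * q m j) (S j)) :
    Summable (fun j => ‖S j‖) ∧ ∑' j, ‖S j‖ ≤ (∑' m, ‖β m‖) * A := by
  set f : ℤ → ℤ → ℝ := fun m j => ‖β m * q m j‖ with hf
  have hf0 : ∀ m j, 0 ≤ f m j := fun m j => norm_nonneg _
  have hfm : ∀ m, Summable (f m) ∧ ∑' j, f m j ≤ ‖β m‖ * A := by
    intro m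
    have e : f m = fun j => ‖β m‖ * ‖q m j‖ := by ext j; exact norm_mul _ _
    rw [e]
    refine ⟨(hq m).1.mul_left _, ?_⟩
    rw [tsum_mul_left]
    exact mul_le_mul_of_nonneg_left (hq m).2 (norm_nonneg _)
  have hfs : Summable (Function.uncurry f) := by
    refine (summable_prod_of_nonneg (f := Function.uncurry f) fun x => hf0 x.1 x.2).2
      ⟨fun m => (hfm m).1, (hβ.mul_right A).of_nonneg_of_le (fun m => tsum_nonneg (hf0 m)) fun m => (hfm m).2⟩
  have hfs' : Summable (Function.uncurry fun j m => f m j) := hfs.prod_symm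
  have hle : ∀ j : ℤ, ‖S j‖ ≤ ∑' m : ℤ, f m j := by
    intro j
    rw [← (hS j).tsum_eq]
    exact norm_tsum_le_tsum_norm (hfs'.prod_factor j)
  have hJ : Summable fun j : ℤ => ∑' m : ℤ, f m j := hfs'.prod
  have hsum : Summable fun j : ℤ => ‖S j‖ := hJ.of_nonneg_of_le (fun _ => norm_nonneg _) hle
  refine ⟨hsum, ?_⟩
  calc ∑' j : ℤ, ‖S j‖ ≤ ∑' (j : ℤ) (m : ℤ), f m j := hsum.tsum_le_tsum hle hJ
    _ = ∑' (m : ℤ) (j : ℤ), f m j := hfs.tsum_comm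
    _ ≤ ∑' m : ℤ, ‖β m‖ * A := hfs.prod.tsum_le_tsum (fun m => (hfm m).2) (hβ.mul_right A)
    _ = _ := tsum_mul_right

/-- The Shannon–Walter spline as a series of `B`-splines. -/
lemma hasSum_shannonWalter (hk : 0 ≤ k) (n : ℕ) {β : ℤ → ℂ} (hβ : Summable fun m => ‖β m‖)
    (hβs : ∀ w : ℝ, HasSum (fun m => β m * Complex.exp (2 * Real.pi * Complex.I * m * w))
      ((splineSymbol k n w : ℂ)⁻¹)) (t : ℝ) :
    HasSum (fun m : ℤ => β m * expBSpline k n (t + m))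
      (shannonWalter (stripFrequencies (n + 1) k) t) := by
  have hFn : ∀ (m : ℤ) (w : ℝ), ‖β m * (Complex.exp (2 * Real.pi * w * (t + m : ℝ) * Complex.I) *
      ((hatFourier k w ^ (n + 1) : ℝ) : ℂ))‖ = ‖β m‖ * hatFourier k w ^ (n + 1) := by
    intro m w
    rw [norm_mul, norm_mul, norm_exp_two_pi, one_mul, Complex.norm_real,
      Real.norm_of_nonneg (pow_nonneg (hatFourier_nonneg k w) _)]
  have hFi : ∀ m : ℤ, Integrable fun w : ℝ => β m *
      (Complex.exp (2 * Real.pi * w * (t + m : ℝ) * Complex.I) *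
        ((hatFourier k w ^ (n + 1) : ℝ) : ℂ)) := by
    intro m
    refine ((integrable_hatFourier_pow hk n).const_mul ‖β m‖).mono' ?_
      (ae_of_all _ fun w => (hFn m w).le)
    have := continuous_hatFourier k
    exact Continuous.aestronglyMeasurable (by fun_prop)
  have h1 := hasSum_integral_of_summable_integral_norm hFi (by
    simp only [hFn, integral_const_mul]
    exact hβ.mul_right _)
  convert! h1 using 1
  · ext m
    rw [expBSpline_eq_integral hk, ← integral_const_mul]
  · rw [shannonWalter_eq_integral hk]
    congr 1; ext w
    have h2 := (hβs w).mul_left (Complex.exp (2 * Real.pi * w * t * Complex.I) *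
      ((hatFourier k w ^ (n + 1) : ℝ) : ℂ))
    rw [Complex.ofReal_div, div_eq_mul_inv, ← mul_assoc, ← h2.tsum_eq]
    congr 1; ext m
    have : Complex.exp (2 * Real.pi * w * (t + m : ℝ) * Complex.I) =
        Complex.exp (2 * Real.pi * w * t * Complex.I) *
          Complex.exp (2 * Real.pi * Complex.I * m * w) := by
      rw [← Complex.exp_add]; congr 1; push_cast; ring
    rw [this]; ring

/-- The sum of the absolute values of the translates of the Shannon–Walter spline is finite, and off
the integers it decays exponentially in `k`. -/
lemma exists_tsum_norm_shannonWalter_le (n : ℕ) : ∃ C : ℝ, 0 ≤ C ∧ ∀ k : ℝ, (k = 0 ∨ 1 ≤ k) →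
    ∀ t δ : ℝ, (∀ j : ℤ, δ ≤ |t - j|) →
      Summable (fun j : ℤ => ‖shannonWalter (stripFrequencies (n + 1) k) (t - j)‖) ∧
      ∑' j : ℤ, ‖shannonWalter (stripFrequencies (n + 1) k) (t - j)‖ ≤
        C * (1 + k) ^ (6 * (n + 1)) * Real.exp (-(k * δ)) := by
  obtain ⟨C, hC, hβ⟩ := exists_inv_splineSymbol_series n
  have hs0 : Summable fun m : ℤ => (1 + (m : ℝ) ^ 2)⁻¹ := by
    simpa using summable_inv_one_add_sq_int 0
  have hc0 : 0 ≤ ∑' m : ℤ, (1 + (m : ℝ) ^ 2)⁻¹ := tsum_nonneg fun m => by positivity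
  refine ⟨C * ((2 * n + 4) * 2 ^ n) * ∑' m : ℤ, (1 + (m : ℝ) ^ 2)⁻¹, by positivity,
    fun k hk t δ hδ => ?_⟩
  have hk0 : 0 ≤ k := by rcases hk with h | h <;> linarith
  obtain ⟨β, hβn, hβs⟩ := hβ k hk
  have hβsum : Summable fun m => ‖β m‖ :=
    (hs0.mul_left _).of_nonneg_of_le (fun _ => norm_nonneg _) hβn
  have h := tsum_norm_le_of_hasSum_mul (q := fun m j => expBSpline k n (t - j + m)) hβsum
    (fun m => by
      have := summable_norm_expBSpline hk0 n (t := t + m) (δ := δ) (fun j => by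
        have := hδ (j - m)
        rwa [Int.cast_sub, ← sub_add, sub_add_eq_add_sub] at this)
      simpa only [sub_add_eq_add_sub] using this)
    (fun j => hasSum_shannonWalter hk0 n hβsum hβs (t - j))
  refine ⟨h.1, h.2.trans ?_⟩
  have h1 := hβsum.tsum_le_tsum hβn (hs0.mul_left _)
  rw [tsum_mul_left] at h1
  refine (mul_le_mul_of_nonneg_right h1 (by positivity)).trans (le_of_eq ?_)
  have : Real.exp (k * (n + 1 - δ)) = Real.exp (k * (n + 1)) * Real.exp (-(k * δ)) := by
    rw [← Real.exp_add]; ring_nf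
  rw [this, Real.exp_neg (k * (n + 1))]
  have := (Real.exp_pos (k * (n + 1))).ne'
  field_simp

end Shannon

/-! ### Reproduction of square-integrable splines -/

/-- A bounded solution of the three-term recurrence with coefficient `2c`, `c ≥ 1`, that vanishes at
both ends is zero: its absolute value is convex. -/
lemma eq_zero_of_recurrence {c : ℝ} (hc : 1 ≤ c) {x : ℤ → ℂ}
    (hrec : ∀ j, x (j + 1) - 2 * (c : ℂ) * x j + x (j - 1) = 0) (h0 : Tendsto x cofinite (𝓝 0)) :
    x 0 = 0 := by
  set a : ℤ → ℝ := fun j => ‖x j‖ with ha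
  have hconv : ∀ j, 2 * a j ≤ a (j + 1) + a (j - 1) := by
    intro j
    have e : 2 * (c : ℂ) * x j = x (j + 1) + x (j - 1) := by linear_combination -hrec j
    have h1 : ‖2 * (c : ℂ) * x j‖ = 2 * c * a j := by
      rw [norm_mul, norm_mul, Complex.norm_real, Real.norm_of_nonneg (by linarith)]; simp [ha]
    have h2 := norm_add_le (x (j + 1)) (x (j - 1))
    rw [← e, h1] at h2
    have : 0 ≤ a j := norm_nonneg _
    nlinarith
  have ha0 : Tendsto a cofinite (𝓝 0) := by simpa using h0.norm
  rw [Int.cofinite_eq, tendsto_sup] at ha0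
  set d : ℤ → ℝ := fun j => a (j + 1) - a j with hd
  have hmono : Monotone d := by
    apply monotone_int_of_le_succ
    intro j
    have := hconv (j + 1)
    rw [add_sub_cancel_right] at this
    simp only [hd]; linarith
  have htop : Tendsto d atTop (𝓝 0) := by
    have := (ha0.2.comp (tendsto_atTop_add_const_right atTop (1 : ℤ) tendsto_id)).sub ha0.2
    simpa [hd, Function.comp_def] using this
  have hbot : Tendsto d atBot (𝓝 0) := by
    have := (ha0.1.comp (tendsto_atBot_add_const_right atBot (1 : ℤ) tendsto_id)).sub ha0.1
    simpa [hd, Function.comp_def] using this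
  have hd0 : ∀ j, d j = 0 := fun j =>
    le_antisymm (hmono.ge_of_tendsto htop j) (hmono.le_of_tendsto hbot j)
  have hconst : ∀ j : ℕ, a j = a 0 := by
    intro j
    induction j with
    | zero => rfl
    | succ j ih =>
      have := hd0 j
      simp only [hd] at this
      push_cast
      linarith
  have h2 : Tendsto (fun j : ℕ => a j) atTop (𝓝 0) := ha0.2.comp tendsto_natCast_atTop_atTop
  simp only [hconst] at h2
  have h3 := tendsto_nhds_unique h2 tendsto_const_nhds
  exact norm_eq_zero.1 h3.symm

section Reproduce

variable {k : ℝ} {n : ℕ} {v : ℝ → ℂ} {M : ℝ}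

lemma summable_norm_shannonWalter (hk : k = 0 ∨ 1 ≤ k) (n : ℕ) (t : ℝ) :
    Summable fun j : ℤ => ‖shannonWalter (stripFrequencies (n + 1) k) (t - j)‖ := by
  obtain ⟨C, -, h⟩ := exists_tsum_norm_shannonWalter_le n
  exact (h k hk t 0 fun j => abs_nonneg _).1

lemma summable_mul_shannonWalter (hk : k = 0 ∨ 1 ≤ k) (n : ℕ) {x : ℤ → ℂ}
    (hx : ∀ j, ‖x j‖ ≤ M) (t : ℝ) :
    Summable fun j : ℤ => x j * shannonWalter (stripFrequencies (n + 1) k) (t - j) := by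
  refine Summable.of_norm_bounded ((summable_norm_shannonWalter hk n t).mul_left M) fun j => ?_
  rw [norm_mul]
  gcongr
  exact hx j

/-- The `n`-th difference of a bounded spline is reproduced by the Shannon–Walter spline. -/
lemma IsExpSpline.hasSum_centralDiff_shannonWalter (hk : k = 0 ∨ 1 ≤ k) (hv : IsExpSpline k n v)
    (hM : ∀ t, ‖v t‖ ≤ M) (t : ℝ) :
    HasSum (fun m : ℤ => (centralDiff k 1)^[n] v m *
      shannonWalter (stripFrequencies (n + 1) k) (t - m)) ((centralDiff k 1)^[n] v t) := by
  have hk0 : 0 ≤ k := by rcases hk with h | h <;> linarith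
  obtain ⟨u, hu, huv⟩ := hv.exists_core
  obtain ⟨M', hM'⟩ := hu.exists_norm_core_le hk0 huv hM
  set S := shannonWalter (stripFrequencies (n + 1) k) with hS
  set c : ℤ → ℂ := fun j => u j / sinhKernel k 1 with hc
  have hcM : ∀ j, ‖c j‖ ≤ M' / ‖(sinhKernel k 1 : ℂ)‖ := by
    intro j
    rw [hc]; simp only [norm_div]
    gcongr
    exact hM' j
  have hU : ∀ x, HasSum (fun j : ℤ => c j * expBSpline k n (x - j)) ((centralDiff k 1)^[n] v x) := by
    intro x
    rw [huv]
    exact hu.hasSum_centralDiff hk0 x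
  set s : Finset ℤ := Finset.Icc (-(n + 1 : ℤ)) (n + 1) with hs
  have hUint : ∀ m : ℤ, (centralDiff k 1)^[n] v m = ∑ l ∈ s, c (m - l) * expBSpline k n l := by
    intro m
    refine (hU m).unique ?_
    rw [← (Equiv.subLeft m).hasSum_iff]
    have : (fun j : ℤ => c j * expBSpline k n (m - j)) ∘ ⇑(Equiv.subLeft m) =
        fun l : ℤ => c (m - l) * expBSpline k n l := by
      ext l; simp
    rw [this]
    apply hasSum_sum_of_ne_finset_zero
    intro l hl
    rw [expBSpline_eq_zero, mul_zero]
    rw [hs, Finset.mem_Icc, ← abs_le] at hl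
    exact_mod_cast (not_le.1 hl).le
  have h1 : HasSum (fun m : ℤ => ∑ l ∈ s, c (m - l) * expBSpline k n l * S (t - m))
      (∑ l ∈ s, ∑' j : ℤ, c j * expBSpline k n l * S (t - l - j)) := by
    apply hasSum_sum
    intro l _
    rw [← (Equiv.addRight l).hasSum_iff]
    have h2 : Summable fun j : ℤ => c j * expBSpline k n l * S (t - l - j) := by
      have := (summable_mul_shannonWalter hk n hcM (t - l)).mul_left (expBSpline k n l)
      convert! this using 1
      ext j; rw [hS]; ring
    convert! h2.hasSum using 1
    ext j
    simp only [Function.comp_apply, Equiv.coe_addRight, add_sub_cancel_right]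
    congr 2; push_cast; ring
  -- expand each `B`-spline of the series at `t` in translates of `S`
  have h3 : (centralDiff k 1)^[n] v t = ∑ l ∈ s, ∑' j : ℤ, c j * expBSpline k n l * S (t - l - j) := by
    have h4 : HasSum (fun j : ℤ => ∑ l ∈ s, c j * expBSpline k n l * S (t - l - j))
        (∑ l ∈ s, ∑' j : ℤ, c j * expBSpline k n l * S (t - l - j)) := by
      apply hasSum_sum
      intro l _
      have := (summable_mul_shannonWalter hk n hcM (t - l)).mul_left (expBSpline k n l)
      convert! this.hasSum using 1
      · ext j; ring
      · congr 1; ext j; ring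
    refine (hU t).unique ?_
    convert! h4 using 1
    ext j
    rw [expBSpline_eq_sum_shannonWalter hk n (t - j), Finset.mul_sum]
    refine Finset.sum_congr rfl fun l _ => ?_
    rw [sub_right_comm, mul_assoc]
  rw [h3]
  convert! h1 using 1
  ext m
  rw [hUint, Finset.sum_mul]

/-- If the difference of a bounded function vanishing at infinity is reproduced by the Shannon–Walter
spline, then so is the function. -/
lemma hasSum_shannonWalter_of_centralDiff (hk : k = 0 ∨ 1 ≤ k) (n : ℕ) (hM : ∀ t, ‖v t‖ ≤ M)
    (h0 : ∀ t, Tendsto (fun j : ℤ => v (t + j)) cofinite (𝓝 0))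
    (hδ : ∀ t, HasSum (fun m : ℤ => centralDiff k 1 v m *
      shannonWalter (stripFrequencies (n + 1) k) (t - m)) (centralDiff k 1 v t)) (t : ℝ) :
    HasSum (fun m : ℤ => v m * shannonWalter (stripFrequencies (n + 1) k) (t - m)) (v t) := by
  set S := shannonWalter (stripFrequencies (n + 1) k) with hS
  set J : ℝ → ℂ := fun t => ∑' m : ℤ, v m * S (t - m) with hJ
  have hsum : ∀ t (a : ℝ), Summable fun m : ℤ => v (m + a) * S (t - m) := fun t a =>
    summable_mul_shannonWalter hk n (x := fun m : ℤ => v (m + a)) (fun j => hM _) t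
  have hJs : ∀ (t : ℝ) (i : ℤ), J (t + i) = ∑' m : ℤ, v (m + i) * S (t - m) := by
    intro t i
    rw [hJ]
    simp only
    rw [← (Equiv.addRight i).tsum_eq]
    congr 1; ext m
    simp only [Equiv.coe_addRight]
    push_cast
    congr 2; ring
  -- the series `J` and the function have the same difference, and both vanish at infinity
  have hδJ : ∀ t, centralDiff k 1 J t = centralDiff k 1 v t := by
    intro t
    have h1 := (hsum t 1).hasSum
    have h2 := (hsum t (-1)).hasSum
    have h3 := (hsum t 0).hasSum
    have e1 := hJs t 1
    have e2 := hJs t (-1)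
    have e3 := hJs t 0
    push_cast at e1 e2 e3
    rw [← e1] at h1
    rw [← e2] at h2
    rw [← e3] at h3
    have h4 := (h1.sub (h3.mul_left (2 * (Real.cosh (k * 1) : ℂ)))).add h2
    rw [add_zero] at h4
    refine HasSum.unique ?_ (hδ t)
    convert! h4 using 1
    ext m
    simp only [centralDiff, sub_eq_add_neg, add_zero]
    ring
  set R : ℝ → ℂ := fun t => v t - J t with hR
  have hRδ : ∀ t, R (t + 1) - 2 * (Real.cosh k : ℂ) * R t + R (t - 1) = 0 := by
    intro t
    have := hδJ t
    simp only [centralDiff, mul_one] at this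
    simp only [hR]
    linear_combination -this
  have hJ0 : Tendsto (fun j : ℤ => J (t + j)) cofinite (𝓝 0) := by
    simp only [hJs]
    have := tendsto_tsum_of_dominated_convergence (𝓕 := cofinite)
      (f := fun (j : ℤ) (m : ℤ) => v (m + j) * S (t - m)) (g := fun _ => 0)
      ((summable_norm_shannonWalter hk n t).mul_left M)
      (fun m => by simpa using (h0 m).mul_const (S (t - m)))
      (Eventually.of_forall fun j m => by
        rw [norm_mul]
        gcongr
        exact hM _)
    simpa using this
  have hR0 : R t = 0 := by
    have := eq_zero_of_recurrence (Real.one_le_cosh k) (x := fun j : ℤ => R (t + j)) (fun j => by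
      have := hRδ (t + j)
      rw [Int.cast_add, Int.cast_sub, Int.cast_one, ← add_assoc, ← add_sub_assoc t]
      exact this) (by simpa [hR] using (h0 t).sub hJ0)
    simpa using this
  have hs : Summable fun m : ℤ => v m * S (t - m) := by simpa using hsum t 0
  have hvJ : v t = J t := sub_eq_zero.1 hR0
  rw [hvJ]
  exact hs.hasSum

/-- A bounded spline vanishing at infinity is reproduced by the Shannon–Walter spline. -/
lemma IsExpSpline.hasSum_shannonWalter (hk : k = 0 ∨ 1 ≤ k) (hv : IsExpSpline k n v)
    (hM : ∀ t, ‖v t‖ ≤ M) (h0 : ∀ t, Tendsto (fun j : ℤ => v (t + j)) cofinite (𝓝 0)) (t : ℝ) :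
    HasSum (fun m : ℤ => v m * shannonWalter (stripFrequencies (n + 1) k) (t - m)) (v t) := by
  have key : ∀ (l : ℕ) (f : ℝ → ℂ) (M : ℝ), (∀ t, ‖f t‖ ≤ M) →
      (∀ t, Tendsto (fun j : ℤ => f (t + j)) cofinite (𝓝 0)) →
      (∀ t, HasSum (fun m : ℤ => (centralDiff k 1)^[l] f m *
        shannonWalter (stripFrequencies (n + 1) k) (t - m)) ((centralDiff k 1)^[l] f t)) →
      ∀ t, HasSum (fun m : ℤ => f m * shannonWalter (stripFrequencies (n + 1) k) (t - m)) (f t) := by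
    intro l
    induction l with
    | zero => intro f M _ _ h; exact h
    | succ l ih =>
      intro f M hM h0 h
      apply hasSum_shannonWalter_of_centralDiff hk n hM h0
      refine ih (centralDiff k 1 f) _ (fun t => norm_centralDiff_iterate_le 1 hM t) (fun t => ?_) h
      have := ((h0 (t + 1)).sub ((h0 t).const_mul (2 * (Real.cosh (k * 1) : ℂ)))).add (h0 (t - 1))
      simp only [mul_zero, sub_zero, add_zero] at this
      convert! this using 1
      ext j
      simp only [centralDiff]
      rw [add_right_comm, add_sub_right_comm]
  exact key n v M hM h0 (fun t => hv.hasSum_centralDiff_shannonWalter hk hM t) t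

lemma sq_intervalIntegral_norm_le (hv : Continuous v) (a : ℝ) :
    (∫ s in a..(a + 1), ‖v s‖) ^ 2 ≤ ∫ s in a..(a + 1), ‖v s‖ ^ 2 := by
  set I := ∫ s in a..(a + 1), ‖v s‖ with hI
  have h1 : 0 ≤ ∫ s in a..(a + 1), (‖v s‖ - I) ^ 2 :=
    intervalIntegral.integral_nonneg (by linarith) fun s _ => sq_nonneg _
  have h2 : ∀ s, (‖v s‖ - I) ^ 2 = ‖v s‖ ^ 2 - 2 * I * ‖v s‖ + I ^ 2 := by intro s; ring
  simp only [h2] at h1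
  rw [intervalIntegral.integral_add (Continuous.intervalIntegrable (by fun_prop) _ _) (by simp),
    intervalIntegral.integral_sub (Continuous.intervalIntegrable (by fun_prop) _ _)
      (Continuous.intervalIntegrable (by fun_prop) _ _), intervalIntegral.integral_const_mul,
    ← hI] at h1
  simp at h1
  nlinarith

/-- A square-integrable spline is bounded by its `L²` norm, with a constant growing linearly in `k`,
and tends to zero at infinity. -/
lemma exists_norm_le_of_integrable_sq (n : ℕ) : ∃ C : ℝ, 0 < C ∧ ∀ (k : ℝ) (v : ℝ → ℂ), 0 ≤ k →
    IsExpSpline k n v → Integrable (fun t => ‖v t‖ ^ 2) →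
      (∀ t, ‖v t‖ ≤ C * (1 + k) * Real.sqrt (∫ t, ‖v t‖ ^ 2)) ∧
      ∀ t, Tendsto (fun j : ℤ => v (t + j)) cofinite (𝓝 0) := by
  obtain ⟨C, hC, h⟩ := exists_norm_le_integral n
  refine ⟨C, hC, fun k v hk hv hint => ?_⟩
  have hvc := hv.continuous
  have hle : ∀ t : ℝ, ‖v t‖ ≤ C * (1 + k) * Real.sqrt (∫ s in (⌊t⌋ : ℝ)..(⌊t⌋ + 1), ‖v s‖ ^ 2) := by
    intro t
    refine (h k v hk hv ⌊t⌋ t ⟨Int.floor_le t, (Int.lt_floor_add_one t).le⟩).trans ?_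
    gcongr
    exact Real.le_sqrt_of_sq_le (sq_intervalIntegral_norm_le hvc _)
  refine ⟨fun t => (hle t).trans ?_, fun t => ?_⟩
  · gcongr
    rw [intervalIntegral.integral_of_le (by linarith)]
    exact setIntegral_le_integral hint (ae_of_all _ fun s => sq_nonneg _)
  · have h1 := (hint.hasSum_intervalIntegral (⌊t⌋ : ℝ)).summable.tendsto_cofinite_zero
    have h2 := ((Real.continuous_sqrt.tendsto 0).comp h1).const_mul (C * (1 + k))
    rw [Real.sqrt_zero, mul_zero] at h2
    refine squeeze_zero_norm (fun j => ?_) h2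
    have := hle (t + j)
    rw [Int.floor_add_intCast, Int.cast_add] at this
    exact this

end Reproduce

/-! ### Fourier coefficients on the torus -/

section Torus

variable {d : ℕ}

lemma volume_box_ne_zero (d : ℕ) :
    volume (Set.Icc (0 : Fin d → ℝ) fun _ => 2 * Real.pi) ≠ 0 := by
  rw [Real.volume_Icc_pi]
  refine Finset.prod_ne_zero_iff.2 fun i _ => ?_
  simp [Real.pi_pos]

lemma volume_box_ne_top (d : ℕ) :
    volume (Set.Icc (0 : Fin d → ℝ) fun _ => 2 * Real.pi) ≠ ⊤ :=
  isCompact_Icc.measure_lt_top.ne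

instance isProbabilityMeasure_torusMeasure (d : ℕ) : IsProbabilityMeasure (torusMeasure d) :=
  ProbabilityTheory.cond_isProbabilityMeasure_of_finite (volume_box_ne_zero d) (volume_box_ne_top d)

lemma ae_mem_box (d : ℕ) : ∀ᵐ y ∂(torusMeasure d), y ∈ Set.Icc (0 : Fin d → ℝ) fun _ => 2 * Real.pi :=
  ProbabilityTheory.ae_cond_mem measurableSet_Icc

lemma integral_torusMeasure (f : (Fin d → ℝ) → ℂ) : ∫ y, f y ∂(torusMeasure d) =
    ((volume (Set.Icc (0 : Fin d → ℝ) fun _ => 2 * Real.pi))⁻¹.toReal : ℂ) *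
      ∫ y in Set.Icc (0 : Fin d → ℝ) fun _ => 2 * Real.pi, f y := by
  rw [torusMeasure, ProbabilityTheory.cond, integral_smul_measure, Complex.real_smul]

lemma integrable_torusMeasure_of_continuous {f : (Fin d → ℝ) → ℂ} (hf : Continuous f) :
    Integrable f (torusMeasure d) := by
  rw [torusMeasure, ProbabilityTheory.cond]
  exact (hf.continuousOn.integrableOn_compact isCompact_Icc).smul_measure
    (ENNReal.inv_ne_top.2 (volume_box_ne_zero d))

lemma continuous_torusExp (κ : Fin d → ℤ) : Continuous (torusExp κ) := by
  unfold torusExp; fun_prop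

lemma norm_torusExp (κ : Fin d → ℤ) (y : Fin d → ℝ) : ‖torusExp κ y‖ = 1 := by
  rw [torusExp, mul_comm]
  have : (∑ i, (κ i : ℂ) * (y i : ℂ)) = ((∑ i, (κ i : ℝ) * y i : ℝ) : ℂ) := by push_cast; rfl
  rw [this, Complex.norm_exp_ofReal_mul_I]

lemma hasFDerivAt_torusExp (κ : Fin d → ℤ) (y : Fin d → ℝ) :
    ∃ L : (Fin d → ℝ) →L[ℝ] ℂ, HasFDerivAt (torusExp κ) L y ∧
      ∀ i, L (Pi.single i 1) = Complex.I * κ i * torusExp κ y := by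
  set l : (Fin d → ℝ) →L[ℝ] ℂ :=
    ∑ i, (Complex.I * κ i) • (Complex.ofRealCLM.comp (ContinuousLinearMap.proj i)) with hl
  have hly : ∀ y, l y = Complex.I * ∑ i, (κ i : ℂ) * (y i : ℂ) := by
    intro y
    simp [hl, Finset.mul_sum, mul_assoc]
  refine ⟨torusExp κ y • l, ?_, fun i => ?_⟩
  · have h := (l.hasFDerivAt (x := y)).cexp
    have e : (fun y => Complex.exp (l y)) = torusExp κ := by ext y; rw [hly]; rfl
    rw [e] at h
    convert! h using 1
    rw [hly]; rfl
  · rw [smul_apply, hly, smul_eq_mul]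
    have : ∑ j, (κ j : ℂ) * ((Pi.single i (1 : ℝ) : Fin d → ℝ) j : ℂ) = κ i := by
      rw [Finset.sum_eq_single i]
      · simp
      · intro j _ hj; simp [Pi.single_eq_of_ne hj]
      · simp
    rw [this]; ring

lemma multiIndexNorm_sq (κ : Fin d → ℤ) : (multiIndexNorm κ) ^ 2 = ∑ i, (κ i : ℝ) ^ 2 :=
  Real.sq_sqrt (Finset.sum_nonneg fun _ _ => sq_nonneg _)

lemma multiIndexNorm_eq_zero_or_one_le (κ : Fin d → ℤ) :
    multiIndexNorm κ = 0 ∨ 1 ≤ multiIndexNorm κ := by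
  have h0 : 0 ≤ ∑ i, (κ i) ^ 2 := Finset.sum_nonneg fun _ _ => sq_nonneg _
  have h1 : ∑ i, (κ i : ℝ) ^ 2 = ((∑ i, (κ i) ^ 2 : ℤ) : ℝ) := by push_cast; rfl
  rcases h0.eq_or_lt with h | h
  · left; rw [multiIndexNorm, h1, ← h]; simp
  · right
    rw [multiIndexNorm, h1, Real.one_le_sqrt]
    exact_mod_cast h

/-- The directional derivative along the `i`-th coordinate. -/
noncomputable def coordDeriv (i : Fin d) (g : (Fin d → ℝ) → ℂ) (y : Fin d → ℝ) : ℂ :=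
  fderiv ℝ g y (Pi.single i 1)

/-- Two integrations by parts on the torus, as one application of the divergence theorem to
the periodic field `(∂_i g + iκ_i g) e^{-i⟨κ,y⟩}`. -/
lemma integral_sum_coordDeriv {g : (Fin d → ℝ) → ℂ} (hg : ContDiff ℝ 2 g)
    (hper : ∀ i y, g (y + Pi.single i (2 * Real.pi)) = g y) (κ : Fin d → ℤ) :
    ∫ y, (∑ i, coordDeriv i (coordDeriv i g) y + (multiIndexNorm κ : ℂ) ^ 2 * g y) *
      torusExp (-κ) y ∂(torusMeasure d) = 0 := by
  have hnorm : (multiIndexNorm κ : ℂ) ^ 2 = ∑ i, (κ i : ℂ) ^ 2 := by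
    exact_mod_cast congrArg (fun x : ℝ => (x : ℂ)) (multiIndexNorm_sq κ)
  rw [hnorm]
  cases d with
  | zero => simp
  | succ m =>
    have hd1 : ∀ i, ContDiff ℝ 1 (coordDeriv i g) := fun i =>
      (hg.fderiv_right (m := 1) (by norm_num)).clm_apply contDiff_const
    have hd2 : ∀ i, Continuous (coordDeriv i (coordDeriv i g)) := fun i =>
      ((hd1 i).continuous_fderiv one_ne_zero).clm_apply continuous_const
    have hperD : ∀ i j y, coordDeriv i g (y + Pi.single j (2 * Real.pi)) = coordDeriv i g y := by
      intro i j y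
      have e : (fun z => g (z + Pi.single j (2 * Real.pi))) = g := funext (hper j)
      have := fderiv_comp_add_right (𝕜 := ℝ) (f := g) (x := y) (Pi.single j (2 * Real.pi))
      rw [e] at this
      rw [coordDeriv, coordDeriv, this]
    have hperE : ∀ j y, torusExp (-κ) (y + Pi.single j (2 * Real.pi)) = torusExp (-κ) y := by
      intro j y
      rw [torusExp, torusExp, Complex.exp_eq_exp_iff_exists_int]
      refine ⟨-κ j, ?_⟩
      have : ∑ i, ((-κ) i : ℂ) * ((y + Pi.single j (2 * Real.pi) : Fin (m + 1) → ℝ) i : ℂ) =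
          ∑ i, ((-κ) i : ℂ) * (y i : ℂ) + ∑ i, ((-κ) i : ℂ) *
            ((Pi.single j (2 * Real.pi) : Fin (m + 1) → ℝ) i : ℂ) := by
        rw [← Finset.sum_add_distrib]
        refine Finset.sum_congr rfl fun i _ => ?_
        rw [Pi.add_apply]; push_cast; ring
      rw [this, Finset.sum_eq_single (a := j) (f := fun i => ((-κ) i : ℂ) *
            ((Pi.single j (2 * Real.pi) : Fin (m + 1) → ℝ) i : ℂ))]
      · simp; ring
      · intro i _ hi; simp [Pi.single_eq_of_ne hi]
      · simp
    set E := torusExp (-κ) with hE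
    have hEc : Continuous E := continuous_torusExp _
    choose L hL hLi using hasFDerivAt_torusExp (-κ)
    have hgd : Differentiable ℝ g := hg.differentiable (by norm_num)
    set F : Fin (m + 1) → (Fin (m + 1) → ℝ) → ℂ :=
      fun i y => (coordDeriv i g y + Complex.I * κ i * g y) * E y with hF
    have hFd : ∀ i y, HasFDerivAt (F i)
        ((coordDeriv i g y + Complex.I * κ i * g y) • L y +
          E y • (fderiv ℝ (coordDeriv i g) y + (Complex.I * κ i) • fderiv ℝ g y)) y := by
      intro i y
      exact ((((hd1 i).differentiable one_ne_zero) y).hasFDerivAt.add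
        ((hgd y).hasFDerivAt.const_mul _)).mul (hL y)
    have hdiv : ∀ y, ∑ i, ((coordDeriv i g y + Complex.I * κ i * g y) • L y +
          E y • (fderiv ℝ (coordDeriv i g) y + (Complex.I * κ i) • fderiv ℝ g y)) (Pi.single i 1) =
        (∑ i, coordDeriv i (coordDeriv i g) y + (∑ i, (κ i : ℂ) ^ 2) * g y) * E y := by
      intro y
      rw [Finset.sum_mul, ← Finset.sum_add_distrib, Finset.sum_mul]
      refine Finset.sum_congr rfl fun i _ => ?_
      simp only [add_apply, smul_apply, smul_eq_mul, hLi]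
      change _ + E y * (coordDeriv i (coordDeriv i g) y + Complex.I * κ i * coordDeriv i g y) = _
      have hI := Complex.I_sq
      simp only [Pi.neg_apply, Int.cast_neg]
      linear_combination (-(κ i : ℂ) ^ 2 * g y * E y) * hI
    have hcF : ∀ i, Continuous (F i) := fun i => by
      have := (hd1 i).continuous
      have := hg.continuous
      fun_prop
    have key := integral_divergence_of_hasFDerivAt_off_countable'
      (0 : Fin (m + 1) → ℝ) (fun _ => 2 * Real.pi) (fun i => Real.two_pi_pos.le) F _ ∅
      Set.countable_empty (fun i => (hcF i).continuousOn) (fun y _ i => hFd i y) (by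
        simp only [hdiv]
        apply ContinuousOn.integrableOn_compact isCompact_Icc
        have := hg.continuous
        apply Continuous.continuousOn
        fun_prop)
    simp only [hdiv] at key
    rw [integral_torusMeasure, key, Finset.sum_eq_zero, mul_zero]
    intro i _
    rw [sub_eq_zero]
    congr 1; ext x
    have : (i.insertNth (2 * Real.pi) x : Fin (m + 1) → ℝ) =
        i.insertNth (0 : ℝ) x + Pi.single i (2 * Real.pi) := by
      rw [Fin.insertNth_eq_iff]
      constructor
      · simp
      · ext j; simp [Fin.removeNth]
    have h0 : ((0 : Fin (m + 1) → ℝ) i) = 0 := rfl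
    rw [h0, this, hF]
    simp only [hperD, hper, hperE]

end Torus

/-! ### From polysplines to exponential splines -/

section Strip

variable {d : ℕ}

/-- The inclusion `y ↦ (0, y)`. -/
noncomputable def stripInclusion (d : ℕ) : (Fin d → ℝ) →L[ℝ] EuclideanSpace ℝ (Fin (d + 1)) :=
  LinearMap.toContinuousLinearMap
    { toFun := fun y => WithLp.toLp 2 (Fin.cons 0 y)
      map_add' := fun x y => by
        ext i; refine Fin.cases ?_ (fun j => ?_) i <;> simp
      map_smul' := fun c y => by
        ext i; refine Fin.cases ?_ (fun j => ?_) i <;> simp }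

lemma stripPoint_eq (t : ℝ) (y : Fin d → ℝ) :
    stripPoint t y = t • EuclideanSpace.single 0 (1 : ℝ) + stripInclusion d y := by
  ext i
  refine Fin.cases ?_ (fun j => ?_) i <;> simp [stripPoint, stripInclusion]

lemma stripInclusion_single (i : Fin d) (c : ℝ) :
    stripInclusion d (Pi.single i c) = EuclideanSpace.single i.succ c := by
  ext j
  refine Fin.cases ?_ (fun j => ?_) j
  · simp [stripInclusion]
  · by_cases h : j = i
    · subst h; simp [stripInclusion]
    · simp [stripInclusion, h]

lemma stripPoint_zero_coord (t : ℝ) (y : Fin d → ℝ) : stripPoint t y 0 = t := by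
  simp [stripPoint]

lemma stripPoint_add_single (t : ℝ) (y : Fin d → ℝ) (i : Fin d) (c : ℝ) :
    stripPoint t (y + Pi.single i c) = stripPoint t y + EuclideanSpace.single i.succ c := by
  rw [stripPoint_eq, stripPoint_eq, map_add, stripInclusion_single, add_assoc]

lemma continuous_stripPoint :
    Continuous fun x : ℝ × (Fin d → ℝ) => stripPoint x.1 x.2 := by
  simp only [stripPoint_eq]; fun_prop

lemma contDiff_stripPoint (t : ℝ) {n : WithTop ℕ∞} :
    ContDiff ℝ n (stripPoint (d := d) t) := by
  have : stripPoint (d := d) t = fun y => t • EuclideanSpace.single 0 (1 : ℝ) + stripInclusion d y :=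
    funext (stripPoint_eq t)
  rw [this]
  exact contDiff_const.add (stripInclusion d).contDiff

lemma hasFDerivAt_stripPoint (t : ℝ) (y : Fin d → ℝ) :
    HasFDerivAt (stripPoint (d := d) t) (stripInclusion d) y := by
  have : stripPoint (d := d) t = fun y => t • EuclideanSpace.single 0 (1 : ℝ) + stripInclusion d y :=
    funext (stripPoint_eq t)
  rw [this]
  exact (stripInclusion d).hasFDerivAt.const_add _

lemma hasDerivAt_stripPoint (t : ℝ) (y : Fin d → ℝ) :
    HasDerivAt (fun t => stripPoint t y) (EuclideanSpace.single 0 (1 : ℝ)) t := by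
  simp only [stripPoint_eq]
  have := ((hasDerivAt_id t).smul_const (EuclideanSpace.single (0 : Fin (d + 1)) (1 : ℝ))).add_const
    (stripInclusion d y)
  simpa using this

/-- The part of `ℝ^{d+1}` over a set of values of the first coordinate. -/
def stripOver (d : ℕ) (O : Set ℝ) : Set (EuclideanSpace ℝ (Fin (d + 1))) := {x | x 0 ∈ O}

lemma isOpen_stripOver {O : Set ℝ} (hO : IsOpen O) : IsOpen (stripOver d O) :=
  hO.preimage (by fun_prop)

lemma stripPoint_mem {O : Set ℝ} {t : ℝ} (ht : t ∈ O) (y : Fin d → ℝ) :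
    stripPoint t y ∈ stripOver d O := by
  rw [stripOver, Set.mem_ofPred_eq, stripPoint_zero_coord]; exact ht

/-- The `κ`-th Fourier coefficient of a function on the strip, as a function of `t`. -/
noncomputable def stripCoeff (u : EuclideanSpace ℝ (Fin (d + 1)) → ℂ) (κ : Fin d → ℤ) (t : ℝ) : ℂ :=
  torusCoeff (fun y => u (stripPoint t y)) κ

lemma continuous_stripCoeff {u : EuclideanSpace ℝ (Fin (d + 1)) → ℂ} (hu : Continuous u)
    (κ : Fin d → ℤ) : Continuous (stripCoeff u κ) := by
  have h := continuous_torusExp (-κ)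
  have h2 := continuous_stripPoint (d := d)
  have e : stripCoeff u κ = fun t =>
      ((volume (Set.Icc (0 : Fin d → ℝ) fun _ => 2 * Real.pi))⁻¹.toReal : ℂ) *
        ∫ y in Set.Icc (0 : Fin d → ℝ) fun _ => 2 * Real.pi,
          u (stripPoint t y) * torusExp (-κ) y := by
    ext t; rw [stripCoeff, torusCoeff, integral_torusMeasure]
  rw [e]
  apply continuous_const.mul
  apply continuous_parametric_integral_of_continuous _ isCompact_Icc
  have h3 : Continuous fun x : ℝ × (Fin d → ℝ) => u (stripPoint x.1 x.2) := hu.comp h2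
  exact h3.mul (h.comp continuous_snd)

/-- Differentiation of a Fourier coefficient in `t`. -/
lemma hasDerivAt_stripCoeff {O : Set ℝ} (hO : IsOpen O)
    {W : EuclideanSpace ℝ (Fin (d + 1)) → ℂ} (hW : ContDiffOn ℝ 1 W (stripOver d O))
    (κ : Fin d → ℤ) {t : ℝ} (ht : t ∈ O) :
    HasDerivAt (stripCoeff W κ)
      (stripCoeff (fun x => fderiv ℝ W x (EuclideanSpace.single 0 1)) κ t) t := by
  have hUo := isOpen_stripOver (d := d) hO
  set D : EuclideanSpace ℝ (Fin (d + 1)) → ℂ :=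
    fun x => fderiv ℝ W x (EuclideanSpace.single 0 1) with hD
  have hDc : ContinuousOn D (stripOver d O) :=
    (hW.continuousOn_fderiv_of_isOpen hUo le_rfl).clm_apply continuousOn_const
  obtain ⟨ε, hε, hball⟩ := Metric.isOpen_iff.1 hO t ht
  set K := Metric.closedBall t (ε / 2) with hK
  have hKO : K ⊆ O := (Metric.closedBall_subset_ball (by linarith)).trans hball
  have hsp := continuous_stripPoint (d := d)
  have hcW : ∀ s ∈ O, Continuous fun y => W (stripPoint s y) := fun s hs =>
    hW.continuousOn.comp_continuous (contDiff_stripPoint s (n := 0)).continuous fun y => stripPoint_mem hs y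
  have hcD : ∀ s ∈ O, Continuous fun y => D (stripPoint s y) := fun s hs =>
    hDc.comp_continuous (contDiff_stripPoint s (n := 0)).continuous fun y => stripPoint_mem hs y
  have hE := continuous_torusExp (-κ)
  -- a bound for the derivative on the compact set of relevant points
  obtain ⟨B, hB⟩ := ((isCompact_closedBall t (ε / 2)).prod
    (isCompact_Icc (a := (0 : Fin d → ℝ)) (b := fun _ => 2 * Real.pi))).exists_bound_of_continuousOn
    (f := fun x : ℝ × (Fin d → ℝ) => D (stripPoint x.1 x.2))
    (hDc.comp hsp.continuousOn fun x hx => stripPoint_mem (hKO hx.1) x.2)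
  have := (hasDerivAt_integral_of_dominated_loc_of_deriv_le (μ := torusMeasure d) (x₀ := t) (s := K)
    (F := fun s y => W (stripPoint s y) * torusExp (-κ) y)
    (F' := fun s y => D (stripPoint s y) * torusExp (-κ) y) (bound := fun _ => B)
    (Metric.closedBall_mem_nhds t (by linarith)) ?_ ?_ ?_ ?_ (integrable_const _) ?_).2
  · exact this
  · filter_upwards [hO.mem_nhds ht] with s hs
    exact ((hcW s hs).mul hE).aestronglyMeasurable
  · exact integrable_torusMeasure_of_continuous ((hcW t ht).mul hE)
  · exact ((hcD t ht).mul hE).aestronglyMeasurable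
  · filter_upwards [ae_mem_box d] with y hy s hs
    rw [norm_mul, norm_torusExp, mul_one]
    exact hB (s, y) ⟨hs, hy⟩
  · refine ae_of_all _ fun y s hs => ?_
    have h1 : DifferentiableAt ℝ W (stripPoint s y) :=
      (hW.differentiableOn one_ne_zero).differentiableAt
        (hUo.mem_nhds (stripPoint_mem (hKO hs) y))
    exact (h1.hasFDerivAt.comp_hasDerivAt s (hasDerivAt_stripPoint s y)).mul_const _

lemma laplacian_apply_eq_sum (u : EuclideanSpace ℝ (Fin (d + 1)) → ℂ)
    (x : EuclideanSpace ℝ (Fin (d + 1))) : Laplacian.laplacian u x =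
      ∑ i, fderiv ℝ (fderiv ℝ u) x (EuclideanSpace.single i 1) (EuclideanSpace.single i 1) := by
  rw [InnerProductSpace.laplacian_eq_iteratedFDeriv_orthonormalBasis u
    (EuclideanSpace.basisFun (Fin (d + 1)) ℝ)]
  simp [iteratedFDeriv_two_apply]

lemma contDiffOn_laplacian {U : Set (EuclideanSpace ℝ (Fin (d + 1)))} (hU : IsOpen U)
    {u : EuclideanSpace ℝ (Fin (d + 1)) → ℂ} {m : ℕ} (hu : ContDiffOn ℝ ((m + 2 : ℕ)) u U) :
    ContDiffOn ℝ m (Laplacian.laplacian u) U := by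
  have h1 : ContDiffOn ℝ ((m + 1 : ℕ)) (fderiv ℝ u) U :=
    hu.fderiv_of_isOpen hU (by norm_cast)
  have h2 : ContDiffOn ℝ m (fderiv ℝ (fderiv ℝ u)) U := h1.fderiv_of_isOpen hU (by norm_cast)
  have h3 : (Laplacian.laplacian u : EuclideanSpace ℝ (Fin (d + 1)) → ℂ) = fun x =>
      ∑ i, fderiv ℝ (fderiv ℝ u) x (EuclideanSpace.single i 1) (EuclideanSpace.single i 1) :=
    funext (laplacian_apply_eq_sum u)
  rw [h3]
  exact ContDiffOn.sum fun i _ => (h2.clm_apply contDiffOn_const).clm_apply contDiffOn_const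

lemma IsPeriodicInY.laplacian {u : EuclideanSpace ℝ (Fin (d + 1)) → ℂ} (hu : IsPeriodicInY u) :
    IsPeriodicInY (Laplacian.laplacian u : EuclideanSpace ℝ (Fin (d + 1)) → ℂ) := by
  intro i x
  have e : (fun z => u (z + EuclideanSpace.single i.succ (2 * Real.pi))) = u := funext (hu i)
  rw [InnerProductSpace.laplacian_eq_iteratedFDeriv_stdOrthonormalBasis]
  refine Finset.sum_congr rfl fun j _ => ?_
  rw [← iteratedFDeriv_comp_add_right, e]

/-- On Fourier coefficients the Laplacian acts as `d²/dt² - |κ|²`. -/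
lemma solvesOn_stripCoeff {O : Set ℝ} (hO : IsOpen O) {u : EuclideanSpace ℝ (Fin (d + 1)) → ℂ}
    (hu : ContDiffOn ℝ 2 u (stripOver d O)) (hper : IsPeriodicInY u) (κ : Fin d → ℤ) :
    SolvesOn (multiIndexNorm κ) (stripCoeff u κ) (stripCoeff (Laplacian.laplacian u) κ) O := by
  have hUo := isOpen_stripOver (d := d) hO
  have hfd : ContDiffOn ℝ 1 (fderiv ℝ u) (stripOver d O) := hu.fderiv_of_isOpen hUo (by norm_num)
  have hfd2 : ContinuousOn (fderiv ℝ (fderiv ℝ u)) (stripOver d O) :=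
    hfd.continuousOn_fderiv_of_isOpen hUo le_rfl
  refine ⟨stripCoeff (fun x => fderiv ℝ u x (EuclideanSpace.single 0 1)) κ, fun t ht =>
    ⟨hasDerivAt_stripCoeff hO (hu.of_le (by norm_num)) κ ht, ?_⟩⟩
  have h1 := hasDerivAt_stripCoeff hO (hfd.clm_apply contDiffOn_const
    (g := fun _ => EuclideanSpace.single 0 (1 : ℝ))) κ ht
  convert! h1 using 1
  -- the slice at height `t`
  set g : (Fin d → ℝ) → ℂ := fun y => u (stripPoint t y) with hg
  have hgc : ContDiff ℝ 2 g := hu.comp_contDiff (contDiff_stripPoint t) fun y => stripPoint_mem ht y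
  have hgper : ∀ i y, g (y + Pi.single i (2 * Real.pi)) = g y := by
    intro i y
    rw [hg]; simp only
    rw [stripPoint_add_single, hper]
  have hdiff : ∀ {F : Type} [NormedAddCommGroup F] [NormedSpace ℝ F]
      {f : EuclideanSpace ℝ (Fin (d + 1)) → F} (y : Fin d → ℝ),
      ContDiffOn ℝ 1 f (stripOver d O) → DifferentiableAt ℝ f (stripPoint t y) := by
    intro F _ _ f y hf
    exact (hf.differentiableOn one_ne_zero).differentiableAt (hUo.mem_nhds (stripPoint_mem ht y))
  have hg1 : ∀ i, coordDeriv i g =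
      fun y => fderiv ℝ u (stripPoint t y) (EuclideanSpace.single i.succ 1) := by
    intro i; ext y
    have := ((hdiff y (hu.of_le (by norm_num))).hasFDerivAt.comp y (hasFDerivAt_stripPoint t y)).fderiv
    rw [coordDeriv]
    change fderiv ℝ (u ∘ stripPoint t) y _ = _
    rw [this, ContinuousLinearMap.comp_apply, stripInclusion_single]
  have hg2 : ∀ i y, coordDeriv i (coordDeriv i g) y = fderiv ℝ (fderiv ℝ u) (stripPoint t y)
      (EuclideanSpace.single i.succ 1) (EuclideanSpace.single i.succ 1) := by
    intro i y
    rw [hg1, coordDeriv]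
    have h2 := ((hdiff y hfd).hasFDerivAt.comp y (hasFDerivAt_stripPoint t y)).clm_apply
      (hasFDerivAt_const (EuclideanSpace.single i.succ (1 : ℝ)) y)
    have h3 := h2.fderiv
    simp only [Function.comp_apply] at h3
    rw [h3]
    simp [stripInclusion_single]
  have h0 : ∀ y, fderiv ℝ (fun x => fderiv ℝ u x (EuclideanSpace.single 0 1)) (stripPoint t y)
      (EuclideanSpace.single 0 1) = fderiv ℝ (fderiv ℝ u) (stripPoint t y)
        (EuclideanSpace.single 0 1) (EuclideanSpace.single 0 1) := by
    intro y
    have := ((hdiff y hfd).hasFDerivAt.clm_apply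
      (hasFDerivAt_const (EuclideanSpace.single (0 : Fin (d + 1)) (1 : ℝ)) (stripPoint t y))).fderiv
    rw [this]; simp
  have hpart := integral_sum_coordDeriv hgc hgper κ
  have hE := continuous_torusExp (-κ)
  have hc2 : ∀ e e' : EuclideanSpace ℝ (Fin (d + 1)), Continuous fun y : Fin d → ℝ =>
      fderiv ℝ (fderiv ℝ u) (stripPoint t y) e e' := by
    intro e e'
    have : Continuous fun y : Fin d → ℝ => fderiv ℝ (fderiv ℝ u) (stripPoint t y) :=
      hfd2.comp_continuous (contDiff_stripPoint t (n := 0)).continuous fun y => stripPoint_mem ht y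
    exact (this.clm_apply continuous_const).clm_apply continuous_const
  have hlap : ∀ y, Laplacian.laplacian u (stripPoint t y) =
      fderiv ℝ (fderiv ℝ u) (stripPoint t y) (EuclideanSpace.single 0 1)
        (EuclideanSpace.single 0 1) + ∑ i, coordDeriv i (coordDeriv i g) y := by
    intro y
    rw [laplacian_apply_eq_sum, Fin.sum_univ_succ]
    simp only [hg2]
  simp only [stripCoeff, torusCoeff, h0, hlap]
  change _ * ∫ y, g y * torusExp (-κ) y ∂(torusMeasure d) + _ = _
  have hgcont := hgc.continuous
  have hS : Continuous fun y => ∑ i, coordDeriv i (coordDeriv i g) y := by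
    simp only [hg2]
    exact continuous_finsetSum _ fun i _ => hc2 _ _
  have i1 : Integrable (fun y => (∑ i, coordDeriv i (coordDeriv i g) y) * torusExp (-κ) y)
      (torusMeasure d) := integrable_torusMeasure_of_continuous (hS.mul hE)
  have hsplit : ∫ y, (∑ i, coordDeriv i (coordDeriv i g) y + (multiIndexNorm κ : ℂ) ^ 2 * g y) *
      torusExp (-κ) y ∂(torusMeasure d) =
      ∫ y, (∑ i, coordDeriv i (coordDeriv i g) y) * torusExp (-κ) y ∂(torusMeasure d) +
        (multiIndexNorm κ : ℂ) ^ 2 * ∫ y, g y * torusExp (-κ) y ∂(torusMeasure d) := by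
    have i2 : Integrable (fun y => (multiIndexNorm κ : ℂ) ^ 2 * (g y * torusExp (-κ) y))
        (torusMeasure d) := integrable_torusMeasure_of_continuous (by fun_prop)
    rw [← integral_const_mul, ← integral_add i1 i2]
    congr 1; ext y; ring
  rw [hsplit] at hpart
  have hsplit2 : ∫ y, (fderiv ℝ (fderiv ℝ u) (stripPoint t y) (EuclideanSpace.single 0 1)
        (EuclideanSpace.single 0 1) + ∑ i, coordDeriv i (coordDeriv i g) y) * torusExp (-κ) y
        ∂(torusMeasure d) =
      ∫ y, fderiv ℝ (fderiv ℝ u) (stripPoint t y) (EuclideanSpace.single 0 1)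
        (EuclideanSpace.single 0 1) * torusExp (-κ) y ∂(torusMeasure d) +
      ∫ y, (∑ i, coordDeriv i (coordDeriv i g) y) * torusExp (-κ) y ∂(torusMeasure d) := by
    have i3 : Integrable (fun y => fderiv ℝ (fderiv ℝ u) (stripPoint t y)
        (EuclideanSpace.single 0 1) (EuclideanSpace.single 0 1) * torusExp (-κ) y)
        (torusMeasure d) := integrable_torusMeasure_of_continuous ((hc2 _ _).mul hE)
    rw [← integral_add i3 i1]
    congr 1; ext y; ring
  rw [hsplit2]
  linear_combination hpart

lemma isOpen_compl_int : IsOpen {t : ℝ | ∀ j : ℤ, t ≠ j} := by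
  have : {t : ℝ | ∀ j : ℤ, t ≠ j} = (Set.range ((↑) : ℤ → ℝ))ᶜ := by
    ext t; simp [eq_comm]
  rw [this]
  exact Int.isClosedEmbedding_coe_real.isClosed_range.isOpen_compl

lemma isExpSpline_stripCoeff_of_iterate (n : ℕ) (κ : Fin d → ℤ)
    {u : EuclideanSpace ℝ (Fin (d + 1)) → ℂ} (hper : IsPeriodicInY u)
    (h1 : ContDiff ℝ ((2 * n : ℕ)) u)
    (h2 : ContDiffOn ℝ ((2 * n + 2 : ℕ)) u (stripOver d {t | ∀ j : ℤ, t ≠ j}))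
    (h3 : ∀ x ∈ stripOver d {t | ∀ j : ℤ, t ≠ j},
      ((fun g : EuclideanSpace ℝ (Fin (d + 1)) → ℂ => Laplacian.laplacian g)^[n + 1] u) x = 0) :
    IsExpSpline (multiIndexNorm κ) n (stripCoeff u κ) := by
  induction n generalizing u with
  | zero =>
    refine ⟨continuous_stripCoeff h1.continuous κ, ?_⟩
    obtain ⟨v', h⟩ := solvesOn_stripCoeff isOpen_compl_int (by simpa using h2) hper κ
    refine ⟨v', fun t ht => ⟨(h t ht).1, ?_⟩⟩
    convert! (h t ht).2 using 2
    rw [stripCoeff, torusCoeff]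
    have : ∀ y, Laplacian.laplacian u (stripPoint t y) = 0 := fun y => h3 _ (stripPoint_mem ht y)
    simp [this]
  | succ n ih =>
    refine ⟨stripCoeff (Laplacian.laplacian u) κ, ?_, ?_⟩
    · apply ih hper.laplacian
      · rw [← contDiffOn_univ] at h1 ⊢
        exact contDiffOn_laplacian isOpen_univ (m := 2 * n) h1
      · exact contDiffOn_laplacian (isOpen_stripOver isOpen_compl_int) (m := 2 * n + 2) h2
      · intro x hx
        exact h3 x hx
    · apply solvesOn_stripCoeff isOpen_univ _ hper
      exact (h1.of_le (by norm_cast; omega)).contDiffOn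

/-- The Fourier coefficients of a polyspline are cardinal exponential splines. -/
lemma IsStripPolyspline.isExpSpline {n : ℕ} {u : EuclideanSpace ℝ (Fin (d + 1)) → ℂ}
    (hu : IsStripPolyspline (n + 1) u) (κ : Fin d → ℤ) :
    IsExpSpline (multiIndexNorm κ) n (stripCoeff u κ) :=
  isExpSpline_stripCoeff_of_iterate n κ hu.periodic hu.contDiff hu.contDiffOn hu.polyharmonic

end Strip

/-! ### Square integrability and the closure of the polysplines -/

section Closure

variable {d : ℕ}

/-- Lebesgue measure on the strip, in the coordinates `(t, y)`. -/
lemma measurePreserving_stripPoint (d : ℕ) :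
    MeasurePreserving (fun x : ℝ × (Fin d → ℝ) => stripPoint x.1 x.2)
      ((volume : Measure ℝ).prod
        (volume.restrict (Set.Icc (0 : Fin d → ℝ) fun _ => 2 * Real.pi))) (stripMeasure d) := by
  have h1 : MeasurePreserving (fun x : ℝ × (Fin d → ℝ) => stripPoint x.1 x.2) volume volume := by
    have h := (PiLp.volume_preserving_toLp (Fin (d + 1))).comp
      (volume_preserving_piFinSuccAbove (fun _ : Fin (d + 1) => ℝ) 0).symm
    convert! h using 1
    ext x i
    refine Fin.cases ?_ (fun j => ?_) i <;> simp [stripPoint, MeasurableEquiv.piFinSuccAbove]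
  have hP : MeasurableSet {x : EuclideanSpace ℝ (Fin (d + 1)) |
      ∀ i : Fin d, x i.succ ∈ Set.Icc 0 (2 * Real.pi)} := by
    apply IsClosed.measurableSet
    simp only [Set.ofPred_forall]
    exact isClosed_iInter fun i => isClosed_Icc.preimage (by fun_prop)
  have h2 := h1.restrict_preimage hP
  have e : (fun x : ℝ × (Fin d → ℝ) => stripPoint x.1 x.2) ⁻¹'
      {x : EuclideanSpace ℝ (Fin (d + 1)) | ∀ i : Fin d, x i.succ ∈ Set.Icc 0 (2 * Real.pi)} =
      Set.univ ×ˢ (Set.Icc (0 : Fin d → ℝ) fun _ => 2 * Real.pi) := by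
    ext x
    simp [stripPoint, Set.mem_Icc, Pi.le_def, forall_and]
  rw [e, Measure.volume_eq_prod, ← Measure.prod_restrict, Measure.restrict_univ] at h2
  exact h2

lemma eLpNorm_two_pow_two {α : Type*} [MeasurableSpace α] {E : Type*} [NormedAddCommGroup E]
    (μ : Measure α) (g : α → E) : eLpNorm g 2 μ ^ 2 = ∫⁻ x, ‖g x‖ₑ ^ 2 ∂μ := by
  have := eLpNorm_nnreal_pow_eq_lintegral (μ := μ) (f := g) (p := 2) two_ne_zero
  simpa using this

/-- By the Cauchy–Schwarz inequality, a Fourier coefficient is square-integrable in `t` when the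
function is square-integrable on the strip. -/
lemma exists_eLpNorm_stripCoeff_le (d : ℕ) : ∃ c : ENNReal, c ≠ ⊤ ∧
    ∀ (u : EuclideanSpace ℝ (Fin (d + 1)) → ℂ), Continuous u → ∀ κ : Fin d → ℤ,
      eLpNorm (stripCoeff u κ) 2 volume ≤ c * eLpNorm u 2 (stripMeasure d) := by
  set b := (volume (Set.Icc (0 : Fin d → ℝ) fun _ => 2 * Real.pi))⁻¹ with hb
  have hbt : b ≠ ⊤ := ENNReal.inv_ne_top.2 (volume_box_ne_zero d)
  refine ⟨b ^ (1 / 2 : ℝ), ENNReal.rpow_ne_top_of_nonneg (by norm_num) hbt, fun u hu κ => ?_⟩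
  have hE := continuous_torusExp (-κ)
  have h1 : ∀ t, ‖stripCoeff u κ t‖ₑ ^ 2 ≤ ∫⁻ y, ‖u (stripPoint t y)‖ₑ ^ 2 ∂(torusMeasure d) := by
    intro t
    have hut : Continuous fun y => u (stripPoint t y) :=
      hu.comp (contDiff_stripPoint t (n := 0)).continuous
    rw [← eLpNorm_two_pow_two]
    gcongr
    calc ‖stripCoeff u κ t‖ₑ ≤ ∫⁻ y, ‖u (stripPoint t y) * torusExp (-κ) y‖ₑ ∂(torusMeasure d) :=
          enorm_integral_le_lintegral_enorm _
      _ = eLpNorm (fun y => u (stripPoint t y)) 1 (torusMeasure d) := by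
          rw [eLpNorm_one_eq_lintegral_enorm]
          congr 1; ext y
          rw [enorm_mul, ← ofReal_norm (torusExp _ _), norm_torusExp]; simp
      _ ≤ _ := eLpNorm_le_eLpNorm_of_exponent_le (by norm_num) hut.aestronglyMeasurable
  have h2 : ∫⁻ t, ‖stripCoeff u κ t‖ₑ ^ 2 ≤ b * ∫⁻ x, ‖u x‖ₑ ^ 2 ∂(stripMeasure d) := by
    have hm : Measurable fun x => ‖u x‖ₑ ^ 2 := hu.measurable.enorm.pow_const 2
    have hm2 : Measurable fun x : ℝ × (Fin d → ℝ) => ‖u (stripPoint x.1 x.2)‖ₑ ^ 2 :=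
      hm.comp continuous_stripPoint.measurable
    rw [← (measurePreserving_stripPoint d).lintegral_comp hm, lintegral_prod _ hm2.aemeasurable,
      ← lintegral_const_mul' _ _ hbt]
    refine lintegral_mono fun t => (h1 t).trans_eq ?_
    rw [torusMeasure, ProbabilityTheory.cond, lintegral_smul_measure, smul_eq_mul]
  rw [← eLpNorm_two_pow_two, ← eLpNorm_two_pow_two] at h2
  have e : b = (b ^ (1 / 2 : ℝ)) ^ 2 := by
    rw [← ENNReal.rpow_natCast, ← ENNReal.rpow_mul]; norm_num
  rw [e, ← mul_pow] at h2
  exact (ENNReal.pow_le_pow_left_iff two_ne_zero).1 h2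

lemma stripCoeff_sub {u w : EuclideanSpace ℝ (Fin (d + 1)) → ℂ} (hu : Continuous u)
    (hw : Continuous w) (κ : Fin d → ℤ) (t : ℝ) :
    stripCoeff (fun x => u x - w x) κ t = stripCoeff u κ t - stripCoeff w κ t := by
  have hE := continuous_torusExp (-κ)
  have hs := (contDiff_stripPoint (d := d) t (n := 0)).continuous
  have i1 : Integrable (fun y => u (stripPoint t y) * torusExp (-κ) y) (torusMeasure d) :=
    integrable_torusMeasure_of_continuous ((hu.comp hs).mul hE)
  have i2 : Integrable (fun y => w (stripPoint t y) * torusExp (-κ) y) (torusMeasure d) :=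
    integrable_torusMeasure_of_continuous ((hw.comp hs).mul hE)
  rw [stripCoeff, stripCoeff, stripCoeff, torusCoeff, torusCoeff, torusCoeff, ← integral_sub i1 i2]
  congr 1; ext y; ring

lemma exists_norm_le_eLpNorm (n : ℕ) : ∃ C : ℝ, 0 < C ∧ ∀ (k : ℝ) (v : ℝ → ℂ), 0 ≤ k →
    IsExpSpline k n v → eLpNorm v 2 volume ≠ ⊤ →
      (∀ t, ‖v t‖ ≤ C * (1 + k) * (eLpNorm v 2 volume).toReal) ∧
      ∀ t, Tendsto (fun j : ℤ => v (t + j)) cofinite (𝓝 0) := by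
  obtain ⟨C, hC, h⟩ := exists_norm_le_of_integrable_sq n
  refine ⟨C, hC, fun k v hk hv hfin => ?_⟩
  have hmem : MemLp v 2 volume := ⟨hv.continuous.aestronglyMeasurable, hfin.lt_top⟩
  have h2 := h k v hk hv ((memLp_two_iff_integrable_sq_norm hmem.1).1 hmem)
  have e : Real.sqrt (∫ t, ‖v t‖ ^ 2) = (eLpNorm v 2 volume).toReal := by
    rw [hmem.eLpNorm_eq_integral_rpow_norm two_ne_zero (by simp), ENNReal.toReal_ofReal (by positivity),
      Real.sqrt_eq_rpow]
    simp
  rw [e] at h2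
  exact h2

lemma exists_seq_of_mem_polysplineSpace {p : ℕ} {f : EuclideanSpace ℝ (Fin (d + 1)) → ℂ}
    (hmem : ∃ F ∈ polysplineSpace p d,
      (F : EuclideanSpace ℝ (Fin (d + 1)) → ℂ) =ᵐ[stripMeasure d] f) :
    ∃ g : ℕ → EuclideanSpace ℝ (Fin (d + 1)) → ℂ, (∀ m, IsStripPolyspline p (g m)) ∧
      (∀ m, MemLp (g m) 2 (stripMeasure d)) ∧ MemLp f 2 (stripMeasure d) ∧
      Tendsto (fun m => eLpNorm (fun x => g m x - f x) 2 (stripMeasure d)) atTop (𝓝 0) := by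
  obtain ⟨F, hF, hFf⟩ := hmem
  obtain ⟨G, hG, hGF⟩ := mem_closure_iff_seq_limit.1 hF
  choose g hg hGg using hG
  refine ⟨g, hg, fun m => (memLp_congr_ae (hGg m)).1 (Lp.memLp _),
    (memLp_congr_ae hFf).1 (Lp.memLp _), ?_⟩
  rw [Lp.tendsto_Lp_iff_tendsto_eLpNorm'] at hGF
  refine hGF.congr fun m => eLpNorm_congr_ae ?_
  filter_upwards [hGg m, hFf] with x h1 h2
  rw [Pi.sub_apply, h1, h2]

/-- The Fourier coefficients of a continuous member of `PV_0` are uniform limits of exponential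
splines. -/
lemma norm_stripCoeff_sub_le {n : ℕ} {C : ℝ} (hC : ∀ (k : ℝ) (v : ℝ → ℂ), 0 ≤ k →
      IsExpSpline k n v → eLpNorm v 2 volume ≠ ⊤ →
      ∀ t, ‖v t‖ ≤ C * (1 + k) * (eLpNorm v 2 volume).toReal) {c : ENNReal} (hc : c ≠ ⊤)
    (hcu : ∀ (u : EuclideanSpace ℝ (Fin (d + 1)) → ℂ), Continuous u → ∀ κ : Fin d → ℤ,
      eLpNorm (stripCoeff u κ) 2 volume ≤ c * eLpNorm u 2 (stripMeasure d))
    (hC0 : 0 < C) {f : EuclideanSpace ℝ (Fin (d + 1)) → ℂ} (hf : Continuous f)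
    (hfm : MemLp f 2 (stripMeasure d)) {g : ℕ → EuclideanSpace ℝ (Fin (d + 1)) → ℂ}
    (hg : ∀ m, IsStripPolyspline (n + 1) (g m)) (hgm : ∀ m, MemLp (g m) 2 (stripMeasure d))
    (hlim : Tendsto (fun m => eLpNorm (fun x => g m x - f x) 2 (stripMeasure d)) atTop (𝓝 0))
    (κ : Fin d → ℤ) (m : ℕ) (t : ℝ) :
    ‖stripCoeff (g m) κ t - stripCoeff f κ t‖ ≤ C * (1 + multiIndexNorm κ) *
      (c * eLpNorm (fun x => g m x - f x) 2 (stripMeasure d)).toReal := by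
  have hk : 0 ≤ multiIndexNorm κ := Real.sqrt_nonneg _
  have hgc : ∀ m, Continuous (g m) := fun m => (hg m).contDiff.continuous
  set ε : ℕ → ENNReal := fun m => eLpNorm (fun x => g m x - f x) 2 (stripMeasure d) with hε
  have hεt : ∀ m, ε m ≠ ⊤ := fun m => ((hgm m).sub hfm).eLpNorm_ne_top
  -- two members of the sequence differ by an exponential spline
  have h1 : ∀ m m' t, ‖stripCoeff (g m) κ t - stripCoeff (g m') κ t‖ ≤
      C * (1 + multiIndexNorm κ) * (c * (ε m + ε m')).toReal := by
    intro m m' t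
    have hsp : IsExpSpline (multiIndexNorm κ) n
        (fun t => stripCoeff (g m) κ t - stripCoeff (g m') κ t) :=
      ((hg m).isExpSpline κ).sub ((hg m').isExpSpline κ)
    have hle : eLpNorm (fun t => stripCoeff (g m) κ t - stripCoeff (g m') κ t) 2 volume ≤
        c * (ε m + ε m') := by
      have e : (fun t => stripCoeff (g m) κ t - stripCoeff (g m') κ t) =
          stripCoeff (fun x => g m x - g m' x) κ := by
        ext t; rw [stripCoeff_sub (hgc m) (hgc m')]
      rw [e]
      refine (hcu _ ((hgc m).sub (hgc m')) κ).trans ?_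
      gcongr
      have e2 : g m - g m' =
          (fun x => g m x - f x) - fun x => g m' x - f x := by
        ext x; simp
      rw [e2]
      exact eLpNorm_sub_le ((hgc m).sub hf).aestronglyMeasurable
        ((hgc m').sub hf).aestronglyMeasurable (by norm_num)
    have hfin : c * (ε m + ε m') ≠ ⊤ :=
      ENNReal.mul_ne_top hc (ENNReal.add_ne_top.2 ⟨hεt m, hεt m'⟩)
    refine (hC _ _ hk hsp (ne_top_of_le_ne_top hfin hle) t).trans ?_
    gcongr
  -- almost everywhere along a subsequence the coefficients converge
  have hL2 : Tendsto (fun m => eLpNorm (stripCoeff (g m) κ - stripCoeff f κ) 2 volume) atTop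
      (𝓝 0) := by
    have h2 : Tendsto (fun m => c * ε m) atTop (𝓝 0) := by
      simpa using ENNReal.Tendsto.const_mul hlim (Or.inr hc)
    refine tendsto_of_tendsto_of_tendsto_of_le_of_le tendsto_const_nhds h2 (fun _ => zero_le)
      fun m => ?_
    have e : stripCoeff (g m) κ - stripCoeff f κ = stripCoeff (fun x => g m x - f x) κ := by
      ext t; rw [stripCoeff_sub (hgc m) hf, Pi.sub_apply]
    rw [e]
    exact hcu _ ((hgc m).sub hf) κ
  obtain ⟨ns, hns, hae⟩ := (tendstoInMeasure_of_tendsto_eLpNorm two_ne_zero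
    (fun m => (continuous_stripCoeff (hgc m) κ).aestronglyMeasurable)
    (continuous_stripCoeff hf κ).aestronglyMeasurable hL2).exists_seq_tendsto_ae
  have hae2 : ∀ᵐ t, t ∈ {t | ‖stripCoeff (g m) κ t - stripCoeff f κ t‖ ≤
      C * (1 + multiIndexNorm κ) * (c * ε m).toReal} := by
    filter_upwards [hae] with t ht
    have hl := (tendsto_const_nhds (x := stripCoeff (g m) κ t)).sub ht
    refine le_of_tendsto_of_tendsto' hl.norm ?_ fun s => h1 m (ns s) t
    apply Tendsto.const_mul
    have h3 : Tendsto (fun s => c * (ε m + ε (ns s))) atTop (𝓝 (c * (ε m + 0))) :=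
      ENNReal.Tendsto.const_mul (tendsto_const_nhds.add (hlim.comp hns.tendsto_atTop)) (Or.inr hc)
    rw [add_zero] at h3
    exact (ENNReal.tendsto_toReal (ENNReal.mul_ne_top hc (hεt m))).comp h3
  have hcl : IsClosed {t | ‖stripCoeff (g m) κ t - stripCoeff f κ t‖ ≤
      C * (1 + multiIndexNorm κ) * (c * ε m).toReal} :=
    isClosed_le ((continuous_stripCoeff (hgc m) κ).sub (continuous_stripCoeff hf κ)).norm
      continuous_const
  have := hcl.closure_subset (Measure.dense_of_ae hae2 t)
  exact this

/-- The Fourier coefficients of a continuous member of `PV_0` grow at most linearly in `|κ|`,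
uniformly in `t`, and satisfy the one-dimensional sampling formula. -/
lemma exists_stripCoeff_bound_and_hasSum {n : ℕ} {f : EuclideanSpace ℝ (Fin (d + 1)) → ℂ}
    (hf : Continuous f) (hmem : ∃ F ∈ polysplineSpace (n + 1) d,
      (F : EuclideanSpace ℝ (Fin (d + 1)) → ℂ) =ᵐ[stripMeasure d] f) :
    (∃ A : ℝ, 0 ≤ A ∧ ∀ (κ : Fin d → ℤ) (t : ℝ),
      ‖stripCoeff f κ t‖ ≤ A * (1 + multiIndexNorm κ)) ∧
    ∀ (κ : Fin d → ℤ) (t : ℝ), HasSum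
      (fun j : ℤ => stripShannon (n + 1) κ (t - j) * stripCoeff f κ j) (stripCoeff f κ t) := by
  obtain ⟨C, hC0, hC⟩ := exists_norm_le_eLpNorm n
  obtain ⟨c, hc, hcu⟩ := exists_eLpNorm_stripCoeff_le d
  obtain ⟨g, hg, hgm, hfm, hlim⟩ := exists_seq_of_mem_polysplineSpace hmem
  have hk : ∀ κ : Fin d → ℤ, 0 ≤ multiIndexNorm κ := fun κ => Real.sqrt_nonneg _
  have hgc : ∀ m, Continuous (g m) := fun m => (hg m).contDiff.continuous
  set ε : ℕ → ℝ := fun m =>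
    (c * eLpNorm (fun x => g m x - f x) 2 (stripMeasure d)).toReal with hε
  have hε0 : Tendsto ε atTop (𝓝 0) := by
    have h2 : Tendsto (fun m => c * eLpNorm (fun x => g m x - f x) 2 (stripMeasure d)) atTop
        (𝓝 0) := by
      simpa using ENNReal.Tendsto.const_mul hlim (Or.inr hc)
    exact (ENNReal.tendsto_toReal ENNReal.zero_ne_top).comp h2
  have hdiff : ∀ κ m t, ‖stripCoeff (g m) κ t - stripCoeff f κ t‖ ≤
      C * (1 + multiIndexNorm κ) * ε m := fun κ m t =>
    norm_stripCoeff_sub_le (fun k v h0 hv hfin => (hC k v h0 hv hfin).1) hc hcu hC0 hf hfm hg hgm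
      hlim κ m t
  have hfin : ∀ m, c * eLpNorm (g m) 2 (stripMeasure d) ≠ ⊤ := fun m =>
    ENNReal.mul_ne_top hc (hgm m).eLpNorm_ne_top
  have hfin' : ∀ m κ, eLpNorm (stripCoeff (g m) κ) 2 volume ≠ ⊤ := fun m κ =>
    ne_top_of_le_ne_top (hfin m) (hcu _ (hgc m) κ)
  have hgb : ∀ m κ t, ‖stripCoeff (g m) κ t‖ ≤
      C * (1 + multiIndexNorm κ) * (c * eLpNorm (g m) 2 (stripMeasure d)).toReal := by
    intro m κ t
    refine ((hC _ _ (hk κ) ((hg m).isExpSpline κ) (hfin' m κ)).1 t).trans ?_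
    have := hk κ
    gcongr
    · exact hfin m
    · exact hcu _ (hgc m) κ
  have hbound : ∀ κ t, ‖stripCoeff f κ t‖ ≤
      C * (ε 0 + (c * eLpNorm (g 0) 2 (stripMeasure d)).toReal) * (1 + multiIndexNorm κ) := by
    intro κ t
    have h1 := hdiff κ 0 t
    have h2 := hgb 0 κ t
    have h3 := norm_sub_norm_le (stripCoeff f κ t) (stripCoeff (g 0) κ t)
    rw [norm_sub_rev] at h3
    linarith
  refine ⟨⟨_, by positivity, hbound⟩, fun κ t => ?_⟩
  have hkk := multiIndexNorm_eq_zero_or_one_le κ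
  have hS := summable_norm_shannonWalter hkk n t
  have hsum := summable_mul_shannonWalter hkk n (x := fun j : ℤ => stripCoeff f κ j)
    (fun j => hbound κ j) t
  have hval : ∑' j : ℤ, stripCoeff f κ j * shannonWalter (stripFrequencies (n + 1)
      (multiIndexNorm κ)) (t - j) = stripCoeff f κ t := by
    have hA : Tendsto (fun m => stripCoeff (g m) κ t) atTop (𝓝 (stripCoeff f κ t)) := by
      rw [tendsto_iff_norm_sub_tendsto_zero]
      refine squeeze_zero (fun _ => norm_nonneg _) (fun m => hdiff κ m t) ?_
      simpa using hε0.const_mul (C * (1 + multiIndexNorm κ))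
    refine tendsto_nhds_unique ?_ hA
    rw [tendsto_iff_norm_sub_tendsto_zero]
    refine squeeze_zero (fun _ => norm_nonneg _) (g := fun m => C * (1 + multiIndexNorm κ) * ε m *
      ∑' j : ℤ, ‖shannonWalter (stripFrequencies (n + 1) (multiIndexNorm κ)) (t - j)‖)
      (fun m => ?_) ?_
    · have hm := ((hg m).isExpSpline κ).hasSum_shannonWalter hkk (fun t => hgb m κ t)
        (hC _ _ (hk κ) ((hg m).isExpSpline κ) (hfin' m κ)).2 t
      have hd := hm.sub hsum.hasSum
      rw [← hd.tsum_eq]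
      refine tsum_of_norm_bounded (hS.hasSum.mul_left _) fun j => ?_
      rw [← sub_mul, norm_mul]
      gcongr
      exact hdiff κ m j
    · simpa using (hε0.const_mul (C * (1 + multiIndexNorm κ))).mul_const
        (∑' j : ℤ, ‖shannonWalter (stripFrequencies (n + 1) (multiIndexNorm κ)) (t - j)‖)
  rw [← hval]
  convert! hsum.hasSum using 2
  rw [stripShannon, mul_comm]

end Closure

/-! ### Fourier series of continuous periodic functions -/

section FourierSeries

variable {d : ℕ}

/-- The normalized Haar measure on `ℝ / ℤ`. -/
noncomputable local instance : MeasureSpace UnitAddCircle := ⟨AddCircle.haarAddCircle⟩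

local instance : IsProbabilityMeasure (volume : Measure UnitAddCircle) :=
  inferInstanceAs (IsProbabilityMeasure AddCircle.haarAddCircle)

/-- The projection `y ↦ y / 2π` of `ℝ^d` onto the torus `(ℝ / ℤ)^d`. -/
noncomputable def torusProj (d : ℕ) (y : Fin d → ℝ) : UnitAddTorus (Fin d) :=
  fun i => ((y i / (2 * Real.pi) : ℝ) : UnitAddCircle)

lemma isOpenQuotientMap_torusProj (d : ℕ) : IsOpenQuotientMap (torusProj d) := by
  have h : IsOpenQuotientMap fun y : ℝ => ((y / (2 * Real.pi) : ℝ) : UnitAddCircle) := by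
    have h1 : IsOpenQuotientMap ((↑) : ℝ → UnitAddCircle) := QuotientAddGroup.isOpenQuotientMap_mk
    have h2 := (Homeomorph.mulRight₀ (2 * Real.pi)⁻¹ (by positivity)).isOpenQuotientMap
    exact h1.comp h2
  exact IsOpenQuotientMap.piMap fun _ => h

lemma torusMeasure_eq_pi (d : ℕ) : torusMeasure d =
    Measure.pi fun _ : Fin d => ProbabilityTheory.cond (volume : Measure ℝ)
      (Set.Icc 0 (2 * Real.pi)) := by
  have hne : (volume : Measure ℝ) (Set.Icc 0 (2 * Real.pi)) ≠ 0 := by simp [Real.pi_pos]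
  have hnt : (volume : Measure ℝ) (Set.Icc 0 (2 * Real.pi)) ≠ ⊤ := by
    rw [Real.volume_Icc]; exact ENNReal.ofReal_ne_top
  have : IsProbabilityMeasure (ProbabilityTheory.cond (volume : Measure ℝ)
      (Set.Icc 0 (2 * Real.pi))) :=
    ProbabilityTheory.cond_isProbabilityMeasure_of_finite hne hnt
  have hbox : (Set.Icc (0 : Fin d → ℝ) fun _ => 2 * Real.pi) =
      Set.univ.pi fun _ => Set.Icc 0 (2 * Real.pi) := (Set.pi_univ_Icc _ _).symm
  refine (Measure.pi_eq fun s hs => ?_).symm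
  -- both sides on a box: `vol(box)⁻¹ vol(box ∩ ∏ s i)` is a product over the coordinates
  rw [torusMeasure, ProbabilityTheory.cond_apply measurableSet_Icc, hbox, ← Set.pi_inter_distrib,
    volume_pi_pi, volume_pi_pi]
  simp only [ProbabilityTheory.cond_apply measurableSet_Icc]
  rw [Finset.prod_mul_distrib, ENNReal.prod_inv_distrib]
  intro i _ j _ _
  exact Or.inl hne

lemma measurePreserving_circleProj :
    MeasurePreserving (fun y : ℝ => ((y / (2 * Real.pi) : ℝ) : UnitAddCircle))
      (ProbabilityTheory.cond (volume : Measure ℝ) (Set.Icc 0 (2 * Real.pi))) volume := by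
  have hpi := Real.two_pi_pos
  have h1 : MeasurePreserving (fun y : ℝ => y / (2 * Real.pi))
      (ProbabilityTheory.cond (volume : Measure ℝ) (Set.Icc 0 (2 * Real.pi)))
      (volume.restrict (Set.Ioc 0 (0 + 1))) := by
    have hm : Measurable fun y : ℝ => y / (2 * Real.pi) := by fun_prop
    refine ⟨hm, ?_⟩
    have hpre : (fun y : ℝ => y / (2 * Real.pi)) ⁻¹' Set.Icc 0 1 = Set.Icc 0 (2 * Real.pi) := by
      ext y
      simp only [Set.mem_preimage, Set.mem_Icc, div_le_one hpi, div_nonneg_iff]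
      constructor
      · rintro ⟨h | h, h'⟩
        · exact ⟨h.1, h'⟩
        · linarith [h.2]
      · exact fun h => ⟨Or.inl ⟨h.1, hpi.le⟩, h.2⟩
    have hvol : Measure.map (fun y : ℝ => y / (2 * Real.pi)) volume =
        ENNReal.ofReal (2 * Real.pi) • volume := by
      have := Real.map_volume_mul_right (a := (2 * Real.pi)⁻¹) (by positivity)
      simpa [div_eq_mul_inv, abs_of_pos hpi, abs_of_pos Real.pi_pos] using this
    rw [ProbabilityTheory.cond, Measure.map_smul, ← hpre, ← Measure.restrict_map hm measurableSet_Icc,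
      hpre, hvol, Measure.restrict_smul, Real.volume_Icc, smul_smul, sub_zero,
      ENNReal.inv_mul_cancel (by simpa using Real.pi_pos) ENNReal.ofReal_ne_top, one_smul, zero_add]
    exact Measure.restrict_congr_set Ioc_ae_eq_Icc.symm
  have h2 := AddCircle.measurePreserving_mk 1 0
  have h3 := h2.comp h1
  convert! h3 using 1
  simp [volume, AddCircle.haarAddCircle]

lemma measurePreserving_torusProj (d : ℕ) :
    MeasurePreserving (torusProj d) (torusMeasure d) volume := by
  rw [torusMeasure_eq_pi]
  have : IsProbabilityMeasure (ProbabilityTheory.cond (volume : Measure ℝ)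
      (Set.Icc 0 (2 * Real.pi))) :=
    ProbabilityTheory.cond_isProbabilityMeasure_of_finite (by simp [Real.pi_pos])
      (by rw [Real.volume_Icc]; exact ENNReal.ofReal_ne_top)
  exact measurePreserving_pi _ _ fun _ => measurePreserving_circleProj

lemma torusExp_eq_mFourier (κ : Fin d → ℤ) (y : Fin d → ℝ) :
    torusExp κ y = UnitAddTorus.mFourier κ (torusProj d y) := by
  rw [torusExp, UnitAddTorus.mFourier, ContinuousMap.coe_mk, Finset.mul_sum, Complex.exp_sum]
  refine Finset.prod_congr rfl fun i _ => ?_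
  rw [torusProj, fourier_coe_apply]
  congr 1
  have := Complex.ofReal_ne_zero.2 Real.pi_ne_zero
  push_cast
  field_simp

/-- A continuous periodic function descends to the torus. -/
lemma exists_torus_lift {g : (Fin d → ℝ) → ℂ} (hg : Continuous g)
    (hper : ∀ i y, g (y + Pi.single i (2 * Real.pi)) = g y) :
    ∃ G : C(UnitAddTorus (Fin d), ℂ), ∀ y, G (torusProj d y) = g y := by
  have hshift : ∀ m : Fin d → ℤ, Function.Periodic g (∑ i, m i • Pi.single i (2 * Real.pi)) := by
    intro m
    refine Finset.sum_induction _ (Function.Periodic g) (fun a b ha hb => ha.add_period hb)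
      (fun y => by simp) fun i _ => ?_
    exact Function.Periodic.zsmul (fun y => hper i y) (m i)
  have hfib : ∀ a b, torusProj d a = torusProj d b → g a = g b := by
    intro a b hab
    have h1 : ∀ i, ∃ m : ℤ, a i = b i + m * (2 * Real.pi) := by
      intro i
      have h2 := congrFun hab i
      rw [torusProj, torusProj, QuotientAddGroup.eq_iff_sub_mem, AddSubgroup.mem_zmultiples_iff] at h2
      obtain ⟨m, hm⟩ := h2
      refine ⟨m, ?_⟩
      have := Real.pi_ne_zero
      simp only [zsmul_eq_mul, mul_one] at hm
      rw [hm]; field_simp; ring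
    choose m hm using h1
    rw [← hshift m b]
    congr 1
    ext i
    rw [hm, Pi.add_apply, Finset.sum_apply, Finset.sum_eq_single i]
    · simp
    · intro j _ hj; simp [Pi.single_eq_of_ne' hj]
    · simp
  have hq : IsQuotientMap (⟨torusProj d, (isOpenQuotientMap_torusProj d).continuous⟩ :
      C(Fin d → ℝ, UnitAddTorus (Fin d))) := (isOpenQuotientMap_torusProj d).isQuotientMap
  have hfac : Function.FactorsThrough (⟨g, hg⟩ : C(Fin d → ℝ, ℂ)) (⟨torusProj d,
      (isOpenQuotientMap_torusProj d).continuous⟩ : C(Fin d → ℝ, UnitAddTorus (Fin d))) :=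
    fun a b => hfib a b
  exact ⟨hq.lift ⟨g, hg⟩ hfac, fun y => DFunLike.congr_fun (hq.lift_comp ⟨g, hg⟩ hfac) y⟩

lemma torusCoeff_eq_mFourierCoeff {g : (Fin d → ℝ) → ℂ} {G : C(UnitAddTorus (Fin d), ℂ)}
    (hG : ∀ y, G (torusProj d y) = g y) (κ : Fin d → ℤ) :
    torusCoeff g κ = UnitAddTorus.mFourierCoeff G κ := by
  have hmp := measurePreserving_torusProj d
  rw [torusCoeff, UnitAddTorus.mFourierCoeff]
  change _ = ∫ x, UnitAddTorus.mFourier (-κ) x • G x ∂volume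
  rw [← hmp.map_eq, integral_map hmp.measurable.aemeasurable]
  · congr 1; ext y
    rw [torusExp_eq_mFourier, hG, smul_eq_mul, mul_comm]
  · exact (Continuous.aestronglyMeasurable (by fun_prop))

/-- The Fourier series of a continuous periodic function converges to it in `L_2`. -/
lemma hasSumInL2_fourier {g : (Fin d → ℝ) → ℂ} (hg : Continuous g)
    (hper : ∀ i y, g (y + Pi.single i (2 * Real.pi)) = g y) :
    HasSumInL2 (fun κ y => torusExp κ y * torusCoeff g κ) g := by
  obtain ⟨G, hG⟩ := exists_torus_lift hg hper
  have h := UnitAddTorus.hasSum_mFourier_series_L2 (ContinuousMap.toLp 2 volume ℂ G)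
  simp only [UnitAddTorus.mFourierCoeff_toLp] at h
  rw [HasSum, SummationFilter.unconditional_filter, Lp.tendsto_Lp_iff_tendsto_eLpNorm'] at h
  rw [HasSumInL2]
  refine h.congr fun s => ?_
  set H : C(UnitAddTorus (Fin d), ℂ) :=
    ∑ κ ∈ s, UnitAddTorus.mFourierCoeff G κ • UnitAddTorus.mFourier κ with hH
  have hsum : ∑ κ ∈ s, UnitAddTorus.mFourierCoeff G κ • UnitAddTorus.mFourierLp 2 κ =
      ContinuousMap.toLp 2 volume ℂ H := by
    rw [hH, map_sum]; simp only [map_smul]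
  rw [hsum, eLpNorm_congr_ae (g := ⇑H - ⇑G), eLpNorm_sub_comm,
    ← eLpNorm_comp_measurePreserving (Continuous.aestronglyMeasurable (by fun_prop))
      (measurePreserving_torusProj d)]
  · congr 1; ext y
    rw [Function.comp_apply, Pi.sub_apply, hG, hH]
    simp [torusExp_eq_mFourier, torusCoeff_eq_mFourierCoeff hG, mul_comm]
  · filter_upwards [ContinuousMap.coeFn_toLp (p := 2) (𝕜 := ℂ) volume H,
      ContinuousMap.coeFn_toLp (p := 2) (𝕜 := ℂ) volume G] with x h1 h2
    rw [Pi.sub_apply, Pi.sub_apply, h1, h2]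

lemma hasSum_fourier_of_summable {g : (Fin d → ℝ) → ℂ} (hg : Continuous g)
    (hper : ∀ i y, g (y + Pi.single i (2 * Real.pi)) = g y) (hs : Summable (torusCoeff g))
    (y : Fin d → ℝ) : HasSum (fun κ => torusExp κ y * torusCoeff g κ) (g y) := by
  obtain ⟨G, hG⟩ := exists_torus_lift hg hper
  have e : torusCoeff g = UnitAddTorus.mFourierCoeff G := funext (torusCoeff_eq_mFourierCoeff hG)
  rw [e] at hs
  have := UnitAddTorus.hasSum_mFourier_series_apply_of_summable hs (torusProj d y)
  rw [hG] at this
  convert! this using 2 with κ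
  rw [e, torusExp_eq_mFourier, smul_eq_mul, mul_comm]

end FourierSeries

/-! ### The sampling formula -/

section Sampling

variable {d : ℕ}

lemma memLp_torusMeasure_of_continuous {g : (Fin d → ℝ) → ℂ} (hg : Continuous g) :
    MemLp g 2 (torusMeasure d) := by
  obtain ⟨B, hB⟩ := (isCompact_Icc (a := (0 : Fin d → ℝ))
    (b := fun _ => 2 * Real.pi)).exists_bound_of_continuousOn hg.continuousOn
  exact MemLp.of_bound hg.aestronglyMeasurable B ((ae_mem_box d).mono hB)

/-- A series dominated by a convergent series of constants converges in `L_2` of the torus. -/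
lemma hasSumInL2_of_norm_le {ι : Type*} {u : ι → (Fin d → ℝ) → ℂ} {M : ι → ℝ} (hM : Summable M)
    (hu : ∀ i y, ‖u i y‖ ≤ M i) {g : (Fin d → ℝ) → ℂ} (hg : ∀ y, HasSum (fun i => u i y) (g y)) :
    HasSumInL2 u g := by
  have hunif := tendstoUniformly_tsum hM hu
  have e : (fun y => ∑' i, u i y) = g := funext fun y => (hg y).tsum_eq
  rw [e, Metric.tendstoUniformly_iff] at hunif
  rw [HasSumInL2, ENNReal.tendsto_nhds_zero]
  intro ε hε
  obtain ⟨r, hr0, hr⟩ := ENNReal.lt_iff_exists_nnreal_btwn.1 hε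
  filter_upwards [hunif r (by exact_mod_cast hr0)] with s hs
  refine (eLpNorm_le_of_ae_bound (C := r) (ae_of_all _ fun y => ?_)).trans ?_
  · rw [← dist_eq_norm]; exact (hs y).le
  · simpa using hr.le

lemma hasSumInL2_zero {ι : Type*} : HasSumInL2 (fun (_ : ι) (_ : Fin d → ℝ) => (0 : ℂ)) fun _ => 0 := by
  simp [HasSumInL2]

lemma hasSumInL2_single {ι : Type*} [DecidableEq ι] (i : ι) (g : (Fin d → ℝ) → ℂ) :
    HasSumInL2 (fun (j : ι) y => if j = i then g y else 0) g := by
  refine tendsto_const_nhds.congr' ?_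
  filter_upwards [eventually_ge_atTop {i}] with s hs
  have hi : i ∈ s := hs (Finset.mem_singleton_self i)
  simp [Finset.sum_ite_eq', hi]

lemma summable_prod_apply {φ : ℤ → ℝ} (h0 : ∀ m, 0 ≤ φ m) (hφ : Summable φ) (d : ℕ) :
    Summable fun κ : Fin d → ℤ => ∏ i, φ (κ i) := by
  induction d with
  | zero => exact Summable.of_finite
  | succ d ih =>
    rw [← (Fin.consEquiv fun _ : Fin (d + 1) => ℤ).summable_iff]
    convert! hφ.mul_of_nonneg ih h0 (fun κ => Finset.prod_nonneg fun i _ => h0 _) using 2 with x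
    simp [Fin.consEquiv, Fin.prod_univ_succ]

/-- Exponential decay in `|κ|` beats polynomial growth and the number of multi-indices. -/
lemma summable_multiIndexNorm_pow_mul_exp (d N : ℕ) {δ : ℝ} (hδ : 0 < δ) :
    Summable fun κ : Fin d → ℤ =>
      (1 + multiIndexNorm κ) ^ N * Real.exp (-(multiIndexNorm κ * δ)) := by
  have hφ : Summable fun m : ℤ => (1 + (m : ℝ) ^ 2)⁻¹ := by
    refine Summable.of_norm_bounded_eventually
      (Real.summable_one_div_int_pow (p := 2).2 (by norm_num)) ?_
    have : ({0}ᶜ : Set ℤ) ∈ cofinite := (Set.finite_singleton 0).compl_mem_cofinite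
    filter_upwards [this] with m hm
    have hm' : (0 : ℝ) < (m : ℝ) ^ 2 := by
      have : (m : ℝ) ≠ 0 := by exact_mod_cast hm
      positivity
    rw [Real.norm_of_nonneg (by positivity), one_div]
    gcongr; linarith
  have hprod := summable_prod_apply (fun m => by positivity) hφ d
  set Q := N + 2 * d with hQ
  refine Summable.of_nonneg_of_le (fun κ => ?_) (fun κ => ?_)
    (hprod.mul_left ((Q.factorial : ℝ) / δ ^ Q * Real.exp δ))
  · have : 0 ≤ multiIndexNorm κ := Real.sqrt_nonneg _
    positivity
  · have hk : 0 ≤ multiIndexNorm κ := Real.sqrt_nonneg _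
    set k := multiIndexNorm κ with hkdef
    -- `x ^ Q ≤ Q! e ^ x` at `x = δ (1 + k)`
    have h1 : (1 + k) ^ Q * Real.exp (-(k * δ)) ≤ (Q.factorial : ℝ) / δ ^ Q * Real.exp δ := by
      have h := Real.pow_div_factorial_le_exp (δ * (1 + k)) (by positivity) Q
      rw [div_le_iff₀ (by positivity), mul_pow] at h
      have h2 : Real.exp (δ * (1 + k)) = Real.exp δ * Real.exp (k * δ) := by
        rw [← Real.exp_add]; ring_nf
      rw [h2] at h
      rw [Real.exp_neg, ← div_eq_mul_inv, div_le_iff₀ (by positivity), div_mul_eq_mul_div,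
        div_mul_eq_mul_div, le_div_iff₀ (by positivity)]
      linarith
    have h3 : ∏ i, (1 + (κ i : ℝ) ^ 2) ≤ (1 + k) ^ (2 * d) := by
      calc ∏ i, (1 + (κ i : ℝ) ^ 2) ≤ ∏ _i : Fin d, (1 + k) ^ 2 := by
            refine Finset.prod_le_prod (fun i _ => by positivity) fun i _ => ?_
            have : (κ i : ℝ) ^ 2 ≤ k ^ 2 := by
              rw [hkdef, multiIndexNorm_sq]
              exact Finset.single_le_sum (f := fun i => (κ i : ℝ) ^ 2)
                (fun _ _ => sq_nonneg _) (Finset.mem_univ i)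
            nlinarith
        _ = _ := by simp [pow_mul]
    rw [Finset.prod_inv_distrib, ← div_eq_mul_inv,
      le_div_iff₀ (Finset.prod_pos fun i _ => by positivity)]
    calc (1 + k) ^ N * Real.exp (-(k * δ)) * ∏ i, (1 + (κ i : ℝ) ^ 2)
        ≤ (1 + k) ^ N * Real.exp (-(k * δ)) * (1 + k) ^ (2 * d) := by gcongr
      _ = (1 + k) ^ Q * Real.exp (-(k * δ)) := by rw [hQ, pow_add]; ring
      _ ≤ _ := h1

lemma exists_le_abs_sub_int {t : ℝ} (ht : ∀ j : ℤ, t ≠ j) : ∃ δ > 0, ∀ j : ℤ, δ ≤ |t - j| := by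
  obtain ⟨δ, hδ, h⟩ := Metric.isOpen_iff.1 isOpen_compl_int t ht
  refine ⟨δ, hδ, fun j => ?_⟩
  by_contra! hlt
  have hmem : (j : ℝ) ∈ Metric.ball t δ := by
    rw [Metric.mem_ball, dist_comm, Real.dist_eq]; exact hlt
  exact h hmem j rfl

/-- Off the integers the double series of the sampling formula converges absolutely, uniformly
in the point of the torus. -/
lemma summable_stripShannon_mul (n : ℕ) {t : ℝ} (ht : ∀ j : ℤ, t ≠ j) (A : ℝ) (hA : 0 ≤ A) :
    Summable fun x : (Fin d → ℤ) × ℤ =>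
      ‖stripShannon (n + 1) x.1 (t - x.2)‖ * (A * (1 + multiIndexNorm x.1)) := by
  obtain ⟨δ, hδ, hdist⟩ := exists_le_abs_sub_int ht
  obtain ⟨C, hC, h⟩ := exists_tsum_norm_shannonWalter_le n
  have hk : ∀ κ : Fin d → ℤ, 0 ≤ multiIndexNorm κ := fun κ => Real.sqrt_nonneg _
  have hS : ∀ κ : Fin d → ℤ, Summable (fun j : ℤ => ‖stripShannon (n + 1) κ (t - j)‖) ∧
      ∑' j : ℤ, ‖stripShannon (n + 1) κ (t - j)‖ ≤
        C * (1 + multiIndexNorm κ) ^ (6 * (n + 1)) * Real.exp (-(multiIndexNorm κ * δ)) :=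
    fun κ => h (multiIndexNorm κ) (multiIndexNorm_eq_zero_or_one_le κ) t δ hdist
  have hnn : ∀ (κ : Fin d → ℤ) (j : ℤ),
      0 ≤ ‖stripShannon (n + 1) κ (t - j)‖ * (A * (1 + multiIndexNorm κ)) := fun κ j =>
    mul_nonneg (norm_nonneg _) (mul_nonneg hA (by linarith [hk κ]))
  set F : (Fin d → ℤ) × ℤ → ℝ := fun x =>
    ‖stripShannon (n + 1) x.1 (t - x.2)‖ * (A * (1 + multiIndexNorm x.1))
  have hF0 : 0 ≤ F := fun x => hnn x.1 x.2
  have hrow : ∀ κ, Summable fun j : ℤ => F (κ, j) := fun κ =>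
    (hS κ).1.mul_right (A * (1 + multiIndexNorm κ))
  refine (summable_prod_of_nonneg hF0).2 ⟨hrow, ?_⟩
  refine Summable.of_nonneg_of_le (fun κ => tsum_nonneg fun j => hnn κ j) (fun κ => ?_)
    ((summable_multiIndexNorm_pow_mul_exp d (6 * (n + 1) + 1) hδ).mul_left (C * A))
  · have hk' := hk κ
    change ∑' j : ℤ, ‖stripShannon (n + 1) κ (t - j)‖ * (A * (1 + multiIndexNorm κ)) ≤ _
    rw [tsum_mul_right]
    calc (∑' j : ℤ, ‖stripShannon (n + 1) κ (t - j)‖) * (A * (1 + multiIndexNorm κ))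
        ≤ C * (1 + multiIndexNorm κ) ^ (6 * (n + 1)) * Real.exp (-(multiIndexNorm κ * δ)) *
            (A * (1 + multiIndexNorm κ)) :=
          mul_le_mul_of_nonneg_right (hS κ).2 (by positivity)
      _ = C * A * ((1 + multiIndexNorm κ) ^ (6 * (n + 1) + 1) *
            Real.exp (-(multiIndexNorm κ * δ))) := by rw [pow_succ _ (6 * (n + 1))]; ring

variable {n : ℕ} {f : EuclideanSpace ℝ (Fin (d + 1)) → ℂ}

lemma IsPeriodicInY.slice (hper : IsPeriodicInY f) (t : ℝ) (i : Fin d) (y : Fin d → ℝ) :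
    f (stripPoint t (y + Pi.single i (2 * Real.pi))) = f (stripPoint t y) := by
  rw [stripPoint_add_single, hper]

lemma continuous_slice (hf : Continuous f) (t : ℝ) : Continuous fun y => f (stripPoint t y) :=
  hf.comp (contDiff_stripPoint t (n := 0)).continuous

lemma shannonPairingTerm_slice (t : ℝ) (j : ℤ) (κ : Fin d → ℤ) (y' : Fin d → ℝ) :
    shannonPairingTerm (n + 1) (t - j) (fun y => f (stripPoint j y)) κ y' =
      stripShannon (n + 1) κ (t - j) * torusExp κ y' * stripCoeff f κ j := rfl

/-- The sampling formula at the points with `t ∉ ℤ`. The double series over `κ` and `j` may be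
summed in either order: summing over `j` first gives the Fourier series of `f(t, ·)`. -/
lemma hasSum_pairing (hf : Continuous f) (hper : IsPeriodicInY f) {A : ℝ} (hA : 0 ≤ A)
    (hbound : ∀ (κ : Fin d → ℤ) (t : ℝ), ‖stripCoeff f κ t‖ ≤ A * (1 + multiIndexNorm κ))
    (hsum : ∀ (κ : Fin d → ℤ) (t : ℝ), HasSum
      (fun j : ℤ => stripShannon (n + 1) κ (t - j) * stripCoeff f κ j) (stripCoeff f κ t))
    {t : ℝ} (ht : ∀ j : ℤ, t ≠ j) (y' : Fin d → ℝ) :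
    (∀ j : ℤ, Summable fun κ : Fin d → ℤ =>
      shannonPairingTerm (n + 1) (t - j) (fun y => f (stripPoint j y)) κ y') ∧
    HasSum (fun j : ℤ => ∑' κ : Fin d → ℤ,
      shannonPairingTerm (n + 1) (t - j) (fun y => f (stripPoint j y)) κ y')
      (f (stripPoint t y')) := by
  have hM := summable_stripShannon_mul (d := d) n ht A hA
  have hS : Summable fun x : (Fin d → ℤ) × ℤ =>
      stripShannon (n + 1) x.1 (t - x.2) * stripCoeff f x.1 x.2 := by
    refine Summable.of_norm_bounded hM fun x => ?_
    rw [norm_mul]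
    gcongr
    exact hbound _ _
  have hT : Summable fun x : (Fin d → ℤ) × ℤ =>
      shannonPairingTerm (n + 1) (t - x.2) (fun y => f (stripPoint x.2 y)) x.1 y' := by
    refine Summable.of_norm_bounded hM fun x => ?_
    rw [shannonPairingTerm_slice, norm_mul, norm_mul, norm_torusExp, mul_one]
    gcongr
    exact hbound _ _
  have hcoef : Summable (torusCoeff fun y => f (stripPoint t y)) :=
    hS.prod.congr fun κ => (hsum κ t).tsum_eq
  have hF := hasSum_fourier_of_summable (continuous_slice hf t) (hper.slice t) hcoef y'
  have hrow : ∀ κ, HasSum (fun j : ℤ =>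
      shannonPairingTerm (n + 1) (t - j) (fun y => f (stripPoint j y)) κ y')
      (torusExp κ y' * torusCoeff (fun y => f (stripPoint t y)) κ) := by
    intro κ
    convert! (hsum κ t).mul_left (torusExp κ y') using 2 with j
    rw [shannonPairingTerm_slice]; ring
  have htot : HasSum (fun x : (Fin d → ℤ) × ℤ =>
      shannonPairingTerm (n + 1) (t - x.2) (fun y => f (stripPoint x.2 y)) x.1 y')
      (f (stripPoint t y')) := by
    rw [← (hT.hasSum.prod_fiberwise hrow).unique hF]
    exact hT.hasSum
  have hswap := (Equiv.prodComm ℤ (Fin d → ℤ)).hasSum_iff.2 htot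
  have hcol : ∀ j : ℤ, Summable fun κ : Fin d → ℤ =>
      shannonPairingTerm (n + 1) (t - j) (fun y => f (stripPoint j y)) κ y' := fun j =>
    hswap.summable.prod_factor j
  exact ⟨hcol, hswap.prod_fiberwise fun j => (hcol j).hasSum⟩

/-- The sampling formula in `L_2` of the torus, for `t ∉ ℤ`. -/
lemma exists_hasSumInL2_of_forall_ne_int (hf : Continuous f) (hper : IsPeriodicInY f) {A : ℝ}
    (hA : 0 ≤ A)
    (hbound : ∀ (κ : Fin d → ℤ) (t : ℝ), ‖stripCoeff f κ t‖ ≤ A * (1 + multiIndexNorm κ))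
    (hsum : ∀ (κ : Fin d → ℤ) (t : ℝ), HasSum
      (fun j : ℤ => stripShannon (n + 1) κ (t - j) * stripCoeff f κ j) (stripCoeff f κ t))
    {t : ℝ} (ht : ∀ j : ℤ, t ≠ j) :
    ∃ h : ℤ → (Fin d → ℝ) → ℂ,
      (∀ j : ℤ, MemLp (h j) 2 (torusMeasure d) ∧
        HasSumInL2 (shannonPairingTerm (n + 1) (t - j) fun y => f (stripPoint j y)) (h j)) ∧
      HasSumInL2 h fun y' => f (stripPoint t y') := by
  have hM := summable_stripShannon_mul (d := d) n ht A hA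
  have hM' := (Equiv.prodComm ℤ (Fin d → ℤ)).summable_iff.2 hM
  have hterm : ∀ (j : ℤ) (κ : Fin d → ℤ) y',
      ‖shannonPairingTerm (n + 1) (t - j) (fun y => f (stripPoint j y)) κ y'‖ ≤
        ‖stripShannon (n + 1) κ (t - j)‖ * (A * (1 + multiIndexNorm κ)) := by
    intro j κ y'
    rw [shannonPairingTerm_slice, norm_mul, norm_mul, norm_torusExp, mul_one]
    gcongr
    exact hbound _ _
  have hMj : ∀ j : ℤ, Summable fun κ : Fin d → ℤ =>
      ‖stripShannon (n + 1) κ (t - j)‖ * (A * (1 + multiIndexNorm κ)) := fun j =>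
    hM'.prod_factor j
  refine ⟨fun j y' => ∑' κ : Fin d → ℤ,
    shannonPairingTerm (n + 1) (t - j) (fun y => f (stripPoint j y)) κ y', fun j => ⟨?_, ?_⟩, ?_⟩
  · refine memLp_torusMeasure_of_continuous (continuous_tsum (fun κ => ?_) (hMj j) (hterm j))
    have := continuous_torusExp κ
    change Continuous fun y' => stripShannon (n + 1) κ (t - j) * torusExp κ y' * stripCoeff f κ j
    fun_prop
  · exact hasSumInL2_of_norm_le (hMj j) (hterm j) fun y' =>
      ((hasSum_pairing hf hper hA hbound hsum ht y').1 j).hasSum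
  · exact hasSumInL2_of_norm_le hM'.prod
      (fun j y' => tsum_of_norm_bounded (hMj j).hasSum fun κ => hterm j κ y')
      fun y' => (hasSum_pairing hf hper hA hbound hsum ht y').2

/-- The sampling formula in `L_2` of the torus at `t ∈ ℤ`, where it reduces to the Fourier series
of `f(t, ·)`. -/
lemma exists_hasSumInL2_int (n : ℕ) (hf : Continuous f) (hper : IsPeriodicInY f) (i : ℤ) :
    ∃ h : ℤ → (Fin d → ℝ) → ℂ,
      (∀ j : ℤ, MemLp (h j) 2 (torusMeasure d) ∧
        HasSumInL2 (shannonPairingTerm (n + 1) (i - j) fun y => f (stripPoint j y)) (h j)) ∧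
      HasSumInL2 h fun y' => f (stripPoint i y') := by
  have hval : ∀ (κ : Fin d → ℤ) (j : ℤ),
      stripShannon (n + 1) κ ((i : ℝ) - j) = if j = i then 1 else 0 := by
    intro κ j
    have := shannonWalter_int (multiIndexNorm_eq_zero_or_one_le κ) n (i - j)
    rw [Int.cast_sub] at this
    rw [stripShannon, this]
    simp only [sub_eq_zero, eq_comm]
  refine ⟨fun j y => if j = i then f (stripPoint i y) else 0, fun j => ?_, hasSumInL2_single i _⟩
  by_cases hj : j = i
  · subst hj
    simp only [if_true]
    refine ⟨memLp_torusMeasure_of_continuous (continuous_slice hf _), ?_⟩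
    convert! hasSumInL2_fourier (continuous_slice hf j) (hper.slice j) using 1
    ext κ y'
    rw [shannonPairingTerm_slice, hval, if_pos rfl, one_mul]; rfl
  · simp only [hj, if_false]
    refine ⟨memLp_torusMeasure_of_continuous continuous_const, ?_⟩
    convert! hasSumInL2_zero (d := d) (ι := Fin d → ℤ) using 1
    ext κ y'
    rw [shannonPairingTerm_slice, hval, if_neg hj, zero_mul, zero_mul]

end Sampling

theorem mainTheorem2 (p d : ℕ) (hp : 1 ≤ p)
    (f : EuclideanSpace ℝ (Fin (d + 1)) → ℂ) (hcont : Continuous f) (hper : IsPeriodicInY f)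
    (hmem : ∃ F ∈ polysplineSpace p d,
      (F : EuclideanSpace ℝ (Fin (d + 1)) → ℂ) =ᵐ[stripMeasure d] f) :
    -- the coefficients are bounded: the series `S_0(t, y, y')` does define distributions
    (∃ C : ℝ, ∀ (κ : Fin d → ℤ) (t : ℝ), ‖stripShannon p κ t‖ ≤ C) ∧
    -- for every `t`, the formula as an identity of functions of `y'` in `L_2(𝕋^d)`:
    -- `h j` is the distributional integral of `S_0(t - j, y, ·) f(j, y)`
    (∀ t : ℝ, ∃ h : ℤ → (Fin d → ℝ) → ℂ,
      (∀ j : ℤ, MemLp (h j) 2 (torusMeasure d) ∧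
        HasSumInL2 (shannonPairingTerm p (t - j) fun y => f (stripPoint j y)) (h j)) ∧
      HasSumInL2 h fun y' => f (stripPoint t y')) ∧
    -- off the sampling hyperplanes, the formula at every single point `(t, y')`, with absolutely
    -- convergent pairings
    (∀ t : ℝ, (∀ j : ℤ, t ≠ j) → ∀ y' : Fin d → ℝ,
      (∀ j : ℤ, Summable fun κ : Fin d → ℤ =>
        shannonPairingTerm p (t - j) (fun y => f (stripPoint j y)) κ y') ∧
      HasSum (fun j : ℤ => ∑' κ : Fin d → ℤ,
          shannonPairingTerm p (t - j) (fun y => f (stripPoint j y)) κ y')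
        (f (stripPoint t y'))) := by

  obtain ⟨n, rfl⟩ : ∃ n, p = n + 1 := ⟨p - 1, by omega⟩
  obtain ⟨⟨A, hA, hbound⟩, hsum⟩ := exists_stripCoeff_bound_and_hasSum hcont hmem
  refine ⟨⟨1, fun κ t => norm_shannonWalter_le (multiIndexNorm_eq_zero_or_one_le κ) n t⟩,
    fun t => ?_, fun t ht y' => hasSum_pairing hcont hper hA hbound hsum ht y'⟩
  by_cases ht : ∃ i : ℤ, t = i
  · obtain ⟨i, rfl⟩ := ht
    exact exists_hasSumInL2_int n hcont hper i
  · push Not at ht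
    exact exists_hasSumInL2_of_forall_ne_int hcont hper hA hbound hsum ht
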